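/- Assume the Riemann hypothesis. Then for every real number $c_3 < \sqrt{2/3}$ there is a constant $C > 0$ (depending only on $c_3$) such that, for infinitely many ordinates $\gamma = \operatorname{Im}\rho$ of non-trivial zeros $\rho$ of the Riemann zeta function (the zeros in the strip $0 < \operatorname{Re} s < 1$), one has $$|\zeta'(\rho)| \le C \exp\left(-c_3 \sqrt{\frac{\log|\gamma|}{\log\log|\gamma|}}\right).$$ -/

import Mathlib

/-- `ρ` is a non-trivial zero of the Riemann zeta function: a zero in the open critical strip
`0 < Re ρ < 1`. -/
def IsNontrivialZetaZero (ρ : ℂ) : Prop :=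
  riemannZeta ρ = 0 ∧ 0 < ρ.re ∧ ρ.re < 1

/-! The proof is Soundararajan's resonance method applied to the residues `1 / ζ'(ρ)` of `1 / ζ`.
Let `A` be a Dirichlet polynomial of length `N = X ^ 8` with real coefficients `r n`, and integrate
`exp ((s - 1/2 - iT)² / H²) A(s - 1/2) A(1/2 - s) / ζ(s)` around a rectangle, with `T = X ^ 12` and
`H = X ^ 9`. On the line `re s = 3` the Dirichlet series of `1 / ζ` produces the main term
`√π H ∑ μ(n) n^(-1/2) r(h) r(hn)`, the other edges are negligible, and at a zero `ρ = 1/2 + iγ` the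
residue has modulus `exp (-(γ - T)² / H²) |A(iγ)|² / |ζ'(ρ)|`.

If `|ζ'(ρ)| > exp (-c √(log γ / log log γ))` for all large `γ`, then all these zeros are simple and
a large sieve inequality over the zeros bounds the sum of the residues by `H ∑ r(n)²`, up to a power
of `log X` and the factor `exp (c √(log T / log log T))`. On the other hand the coefficients can be
chosen, supported on products of primes, so that the quadratic form `∑ μ(n) n^(-1/2) r(h) r(hn)` is
at least `exp (a √(log N / log log N)) ∑ r(n)²` for any `a < 1`. As `log T = 3/2 log N`, this is a
contradiction if `c √(3/2) < a`.
-/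

open Complex Filter MeasureTheory Metric Set Topology

/-! ### The zeta function to the right of the imaginary axis -/

/-- The fractional part, cut off at `1`. It enters as the Mellin kernel of the representation
`ζ s = s / (s - 1) - s ∫₁^∞ {t} t^(-s - 1) dt`. -/
noncomputable def fractTail : ℝ → ℂ :=
  (Ioi 1).indicator fun t ↦ ((Int.fract t : ℝ) : ℂ)

lemma norm_ofReal_fract_le_one (t : ℝ) : ‖((Int.fract t : ℝ) : ℂ)‖ ≤ 1 := by
  rw [norm_real, Real.norm_of_nonneg (Int.fract_nonneg t)]
  exact (Int.fract_lt_one t).le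

lemma norm_fractTail_le_one (t : ℝ) : ‖fractTail t‖ ≤ 1 :=
  (norm_indicator_le_norm_self _ t).trans (norm_ofReal_fract_le_one t)

lemma measurable_ofReal_fract : Measurable fun t : ℝ ↦ ((Int.fract t : ℝ) : ℂ) :=
  measurable_ofReal.comp measurable_fract

lemma differentiableAt_mellin_fractTail {s : ℂ} (hs : 0 < s.re) :
    DifferentiableAt ℂ (fun s ↦ mellin fractTail (-s)) s := by
  have hloc : LocallyIntegrable fractTail :=
    (locallyIntegrable_const (1 : ℝ)).mono
      (measurable_ofReal_fract.indicator measurableSet_Ioi).aestronglyMeasurable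
      (.of_forall fun t ↦ by simpa using norm_fractTail_le_one t)
  have htop : fractTail =O[atTop] fun t ↦ t ^ (-(0 : ℝ)) :=
    .of_bound 1 (.of_forall fun t ↦ by simpa using norm_fractTail_le_one t)
  have hzero : fractTail =O[𝓝[>] 0] fun t ↦ t ^ (-(-s.re - 1)) := by
    refine .of_bound 1 ?_
    filter_upwards [nhdsWithin_le_nhds (Iio_mem_nhds (zero_lt_one (α := ℝ)))] with t ht
    rw [fractTail, indicator_of_notMem (notMem_Ioi.mpr (le_of_lt ht)), norm_zero]
    positivity
  have h : DifferentiableAt ℂ (mellin fractTail) (-s) :=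
    mellin_differentiableAt_of_isBigO_rpow (hloc.locallyIntegrableOn _) htop (by simpa)
      hzero (by simp)
  exact h.comp s differentiableAt_id.neg

lemma mellin_fractTail_neg (s : ℂ) : mellin fractTail (-s) =
    ∫ t in Ioi (1 : ℝ), (t : ℂ) ^ (-(s + 1)) * ((Int.fract t : ℝ) : ℂ) := by
  have h (t : ℝ) : (t : ℂ) ^ (-s - 1) • fractTail t =
      (Ioi (1 : ℝ)).indicator (fun t ↦ (t : ℂ) ^ (-(s + 1)) * ((Int.fract t : ℝ) : ℂ)) t := by
    by_cases ht : t ∈ Ioi (1 : ℝ)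
    · simp only [fractTail, ht, indicator_of_mem, smul_eq_mul, neg_add']
    · simp only [fractTail, ht, not_false_eq_true, indicator_of_notMem, smul_zero]
  simp_rw [mellin, h]
  rw [setIntegral_indicator measurableSet_Ioi, Ioi_inter_Ioi, max_eq_right zero_le_one]

lemma norm_mellin_fractTail_neg_le {s : ℂ} (hs : 0 < s.re) :
    ‖mellin fractTail (-s)‖ ≤ 1 / s.re := by
  have hint : ∫ t in Ioi (1 : ℝ), t ^ (-s.re - 1) = 1 / s.re := by
    rw [integral_Ioi_rpow_of_lt (by linarith) one_pos, sub_add_cancel, Real.one_rpow,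
      neg_div_neg_eq]
  rw [mellin_fractTail_neg, ← hint]
  refine (norm_integral_le_integral_norm _).trans <|
    integral_mono_of_nonneg (.of_forall fun _ ↦ norm_nonneg _)
      (integrableOn_Ioi_rpow_of_lt (by linarith) one_pos) ?_
  filter_upwards [ae_restrict_mem measurableSet_Ioi] with t (ht : 1 < t)
  have ht0 : 0 < t := one_pos.trans ht
  rw [norm_mul, norm_cpow_eq_rpow_re_of_pos ht0, neg_re, add_re, one_re, neg_add']
  exact mul_le_of_le_one_right (by positivity) (norm_ofReal_fract_le_one t)

lemma sum_Icc_one_mul_cpow {s : ℂ} {t : ℝ} (ht : 0 < t) :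
    (∑ k ∈ Finset.Icc 1 ⌊t⌋₊, (1 : ℕ → ℂ) k) * (t : ℂ) ^ (-(s + 1)) =
      (t : ℂ) ^ (-s) - (t : ℂ) ^ (-(s + 1)) * ((Int.fract t : ℝ) : ℂ) := by
  have hsum : (∑ k ∈ Finset.Icc 1 ⌊t⌋₊, (1 : ℕ → ℂ) k) = t - ((Int.fract t : ℝ) : ℂ) := by
    rw [← ofReal_sub, Int.self_sub_fract, ← natCast_floor_eq_intCast_floor ht.le]
    simp
  have htc : (t : ℂ) ≠ 0 := ofReal_ne_zero.mpr ht.ne'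
  rw [hsum, sub_mul, mul_comm ((Int.fract t : ℝ) : ℂ), neg_add', cpow_sub _ _ htc, cpow_one,
    mul_div_cancel₀ _ htc]

lemma riemannZeta_eq_sub_mellin_of_one_lt {s : ℂ} (hs : 1 < s.re) :
    riemannZeta s = s / (s - 1) - s * mellin fractTail (-s) := by
  have hO : (fun n ↦ ∑ k ∈ Finset.Icc 1 n, ‖(1 : ℕ → ℂ) k‖) =O[atTop]
      fun n ↦ (n : ℝ) ^ (1 : ℝ) :=
    .of_bound 1 (.of_forall fun n ↦ by simp)
  have hmain : IntegrableOn (fun t : ℝ ↦ (t : ℂ) ^ (-s)) (Ioi 1) :=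
    integrableOn_Ioi_cpow_of_lt (by simpa) one_pos
  have hfract : IntegrableOn (fun t : ℝ ↦ (t : ℂ) ^ (-(s + 1)) * ((Int.fract t : ℝ) : ℂ))
      (Ioi 1) :=
    Integrable.mul_bdd (c := 1) (integrableOn_Ioi_cpow_of_lt (by simp; linarith) one_pos)
      measurable_ofReal_fract.aestronglyMeasurable (.of_forall norm_ofReal_fract_le_one)
  have h1 : s - 1 ≠ 0 := sub_ne_zero.mpr (by rintro rfl; simp at hs)
  have h2 : -s + 1 ≠ 0 := fun h ↦ h1 (by linear_combination -h)
  rw [← LSeries_one_eq_riemannZeta hs, LSeries_eq_mul_integral' (1 : ℕ → ℂ) zero_le_one hs hO,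
    mellin_fractTail_neg, setIntegral_congr_fun measurableSet_Ioi
      fun t ht ↦ sum_Icc_one_mul_cpow (one_pos.trans ht),
    integral_sub hmain hfract, integral_Ioi_cpow_of_lt (by simpa) one_pos, ofReal_one, one_cpow,
    mul_sub]
  congr 1
  field_simp
  ring

lemma riemannZeta_eq_sub_mellin {s : ℂ} (hs : 0 < s.re) (hs1 : s ≠ 1) :
    riemannZeta s = s / (s - 1) - s * mellin fractTail (-s) := by
  let U : Set ℂ := {s | 0 < s.re}
  have hU : IsOpen U := isOpen_lt continuous_const continuous_re
  have hf : AnalyticOnNhd ℂ riemannZeta₁ U :=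
    differentiable_riemannZeta₁.differentiableOn.analyticOnNhd hU
  have hg : AnalyticOnNhd ℂ (fun s ↦ s - s * (s - 1) * mellin fractTail (-s)) U :=
    DifferentiableOn.analyticOnNhd (fun s hs ↦ (differentiableAt_id.sub (.mul (by fun_prop)
      (differentiableAt_mellin_fractTail hs))).differentiableWithinAt) hU
  have hnear : riemannZeta₁ =ᶠ[𝓝 2] fun s ↦ s - s * (s - 1) * mellin fractTail (-s) := by
    filter_upwards [(isOpen_lt continuous_const continuous_re).mem_nhds
      (show (1 : ℝ) < (2 : ℂ).re by simp)] with z (hz : 1 < z.re)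
    have hz1 : z ≠ 1 := by rintro rfl; simp at hz
    have h := riemannZeta_eq_inv_sub_mul hz1
    rw [riemannZeta_eq_sub_mellin_of_one_lt hz] at h
    have hz1' : z - 1 ≠ 0 := sub_ne_zero.mpr hz1
    field_simp at h
    linear_combination -h
  have hEq := hf.eqOn_of_preconnected_of_eventuallyEq hg
    (convex_halfSpace_re_gt 0).isPreconnected (show (2 : ℂ) ∈ U by simp [U]) hnear hs
  have hs1' : s - 1 ≠ 0 := sub_ne_zero.mpr hs1
  rw [riemannZeta_eq_inv_sub_mul hs1, hEq]
  field_simp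

lemma norm_riemannZeta_le {s : ℂ} (hs : 0 < s.re) (hs1 : 1 ≤ |s.im|) :
    ‖riemannZeta s‖ ≤ (1 + 1 / s.re) * ‖s‖ := by
  have hne : s ≠ 1 := by rintro rfl; norm_num at hs1
  have hdist : 1 ≤ ‖s - 1‖ := hs1.trans (by simpa using abs_im_le_norm (s - 1))
  calc ‖riemannZeta s‖ = ‖s / (s - 1) - s * mellin fractTail (-s)‖ := by
        rw [riemannZeta_eq_sub_mellin hs hne]
    _ ≤ ‖s / (s - 1)‖ + ‖s * mellin fractTail (-s)‖ := norm_sub_le _ _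
    _ ≤ ‖s‖ + ‖s‖ * (1 / s.re) := by
        rw [norm_div, norm_mul]
        gcongr
        · exact div_le_self (norm_nonneg _) hdist
        · exact norm_mellin_fractTail_neg_le hs
    _ = (1 + 1 / s.re) * ‖s‖ := by ring

/-! ### Analytic functions in a disc and their zeros -/

lemma exists_eq_prod_sub_mul {U : Set ℂ} (hU : IsOpen U) {f : ℂ → ℂ}
    (hf : DifferentiableOn ℂ f U) {Z : Finset ℂ} (hZ : ∀ ρ ∈ Z, ρ ∈ U ∧ f ρ = 0) :
    ∃ g : ℂ → ℂ, DifferentiableOn ℂ g U ∧ ∀ s, f s = (∏ ρ ∈ Z, (s - ρ)) * g s := by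
  classical
  induction Z using Finset.induction_on generalizing f with
  | empty => exact ⟨f, hf, by simp⟩
  | insert a Z ha ih =>
    obtain ⟨haU, hfa⟩ := hZ a (Finset.mem_insert_self _ _)
    have hslope (s : ℂ) : f s = (s - a) * dslope f a s := by
      rw [← smul_eq_mul, sub_smul_dslope, hfa, sub_zero]
    obtain ⟨g, hg, hfg⟩ := ih (f := dslope f a)
      ((differentiableOn_dslope (hU.mem_nhds haU)).mpr hf) fun ρ hρ ↦ by
        obtain ⟨hρU, hfρ⟩ := hZ ρ (Finset.mem_insert_of_mem hρ)
        refine ⟨hρU, (mul_eq_zero.mp ((hslope ρ).symm.trans hfρ)).resolve_left ?_⟩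
        exact sub_ne_zero.mpr fun h ↦ ha (h ▸ hρ)
    exact ⟨g, hg, fun s ↦ by rw [Finset.prod_insert ha, hslope s, hfg s, mul_assoc]⟩

lemma deriv_eq_prod_erase_mul {f g : ℂ → ℂ} {Z : Finset ℂ} {ρ : ℂ}
    (hg : DifferentiableAt ℂ g ρ) (hfg : ∀ s, f s = (∏ ρ ∈ Z, (s - ρ)) * g s) (hρ : ρ ∈ Z) :
    deriv f ρ = (∏ ρ' ∈ Z.erase ρ, (ρ - ρ')) * g ρ := by
  have hf : f = fun s ↦ (s - ρ) * ((∏ ρ' ∈ Z.erase ρ, (s - ρ')) * g s) := by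
    funext s
    rw [hfg s, ← Finset.mul_prod_erase Z _ hρ, mul_assoc]
  have hcof : DifferentiableAt ℂ (fun s ↦ (∏ ρ' ∈ Z.erase ρ, (s - ρ')) * g s) ρ := by
    fun_prop
  rw [hf]
  exact (((hasDerivAt_id ρ).sub_const ρ).mul hcof.hasDerivAt).deriv.trans (by simp)

lemma card_zeros_mul_log_le {f : ℂ → ℂ} {c : ℂ} {r R M : ℝ} (hr : 0 < r) (hrR : r < R)
    (hf : AnalyticOnNhd ℂ f (closedBall c R)) (hM1 : 1 ≤ M) (hM : ∀ s ∈ sphere c R, ‖f s‖ ≤ M)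
    (hc : f c ≠ 0) {Z : Finset ℂ} (hZ : ∀ ρ ∈ Z, ρ ∈ closedBall c r ∧ f ρ = 0) :
    Z.card * Real.log (R / r) ≤ Real.log (M / ‖f c‖) := by
  have hfr : AnalyticOnNhd ℂ f (closedBall c r) :=
    hf.mono (closedBall_subset_closedBall hrR.le)
  set D := MeromorphicOn.divisor f (closedBall c r)
  have hone : ∀ ρ ∈ Z, 1 ≤ D ρ := fun ρ hρ ↦ by
    obtain ⟨hρr, hρ0⟩ := hZ ρ hρ
    have hzero := (hfr ρ hρr).analyticOrderAt_ne_zero.mpr hρ0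
    have htop := hfr.analyticOrderAt_ne_top_of_isPreconnected
      (convex_closedBall c r).isPreconnected (mem_closedBall_self hr.le) hρr
      (by rw [(hfr c (mem_closedBall_self hr.le)).analyticOrderAt_eq_zero.mpr hc]; simp)
    rw [MeromorphicOn.AnalyticOnNhd.divisor_apply hfr hρr]
    lift analyticOrderAt f ρ to ℕ using htop with n
    simpa [Nat.one_le_iff_ne_zero] using hzero
  have hfin : (Function.support D).Finite := D.finiteSupport (isCompact_closedBall c r)
  have hcard : (Z.card : ℤ) ≤ ∑ᶠ ρ, D ρ := by
    have hsub : Function.support D ⊆ ↑(hfin.toFinset ∪ Z) := fun ρ hρ ↦ by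
      simp [Function.mem_support.mp hρ]
    rw [finsum_eq_sum_of_support_subset _ hsub, Finset.cast_card]
    exact (Finset.sum_le_sum hone).trans <| Finset.sum_le_sum_of_subset_of_nonneg
      Finset.subset_union_right fun ρ _ _ ↦ MeromorphicOn.AnalyticOnNhd.divisor_nonneg hfr ρ
  have hjensen : ((∑ᶠ ρ, D ρ : ℤ) : ℝ) ≤ Real.log (M / ‖f c‖) / Real.log (R / r) := by
    have hR := abs_of_pos (hr.trans hrR)
    have h := AnalyticOnNhd.sum_divisor_le (R := R) (abs_pos.mpr hr.ne')
      (by rwa [abs_of_pos hr, hR]) hM1 (by rwa [hR]) hc (by rwa [hR])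
    rwa [abs_of_pos hr] at h
  rw [← le_div_iff₀ (Real.log_pos ((one_lt_div hr).mpr hrR))]
  exact le_trans (by exact_mod_cast hcard) hjensen

lemma exists_exp_eq_of_ne_zero {g : ℂ → ℂ} {c : ℂ} {r : ℝ} (hr : 0 < r)
    (hg : DifferentiableOn ℂ g (ball c r)) (h0 : ∀ s ∈ ball c r, g s ≠ 0) :
    ∃ h : ℂ → ℂ, DifferentiableOn ℂ h (ball c r) ∧ h c = 0 ∧
      ∀ s ∈ ball c r, g s = g c * exp (h s) := by
  have hd : DifferentiableOn ℂ (fun s ↦ deriv g s / g s) (ball c r) :=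
    (hg.deriv isOpen_ball).div hg h0
  obtain ⟨h, hc, hh⟩ := hd.isExactOn_ball.with_val_at c 0
  have hhd : DifferentiableOn ℂ h (ball c r) := fun s hs ↦
    (hh s hs).differentiableAt.differentiableWithinAt
  have hderiv : EqOn (deriv fun s ↦ g s * exp (-h s)) 0 (ball c r) := fun z hz ↦ by
    have hmul := (hg.differentiableAt (isOpen_ball.mem_nhds hz)).hasDerivAt.mul (hh z hz).neg.cexp
    have hz0 := h0 z hz
    refine hmul.deriv.trans ?_
    rw [Pi.zero_apply]
    field_simp
    ring
  refine ⟨h, hhd, hc, fun s hs ↦ ?_⟩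
  have hconst := isOpen_ball.is_const_of_deriv_eq_zero (convex_ball c r).isPreconnected
    (f := fun s ↦ g s * exp (-h s)) (hg.mul hhd.neg.cexp) hderiv hs (mem_ball_self hr)
  simp only [hc, neg_zero, exp_zero, mul_one] at hconst
  rw [← hconst, mul_assoc, ← exp_add, neg_add_cancel, exp_zero, mul_one]

lemma norm_le_of_forall_re_le {h : ℂ → ℂ} {c s : ℂ} {r M : ℝ} (hM : 0 ≤ M)
    (hd : DifferentiableOn ℂ h (ball c r)) (hc : h c = 0) (hre : ∀ z ∈ ball c r, (h z).re ≤ M)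
    (hs : s ∈ ball c r) : ‖h s‖ ≤ 2 * ‖s - c‖ / (r - ‖s - c‖) * M := by
  have hshift (z : ℂ) : z ∈ ball (0 : ℂ) r ↔ z + c ∈ ball c r := by simp
  have hlt : ∀ᶠ M' in 𝓝[>] M, ‖h s‖ ≤ 2 * ‖s - c‖ / (r - ‖s - c‖) * M' := by
    filter_upwards [self_mem_nhdsWithin] with M' (hM' : M < M')
    have hBC := borelCaratheodory_zero (f := fun z ↦ h (z + c)) (z := s - c) (hM.trans_lt hM')
      (hd.comp (by fun_prop) fun z ↦ (hshift z).mp)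
      (fun z hz ↦ (hre _ ((hshift z).mp hz)).trans hM'.le) (pos_of_mem_ball hs)
      (by rwa [hshift, sub_add_cancel]) (by rwa [zero_add])
    rw [sub_add_cancel] at hBC
    exact hBC.trans_eq (by ring)
  exact ge_of_tendsto ((continuous_const_mul _).continuousWithinAt) hlt

lemma norm_mul_exp_le_of_ne_zero {g : ℂ → ℂ} {c s : ℂ} {r B : ℝ}
    (hg : DifferentiableOn ℂ g (ball c r)) (h0 : ∀ z ∈ ball c r, g z ≠ 0)
    (hB : ∀ z ∈ ball c r, ‖g z‖ ≤ B) (hs : s ∈ ball c r) :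
    ‖g c‖ * Real.exp (-(2 * ‖s - c‖ / (r - ‖s - c‖) * Real.log (B / ‖g c‖))) ≤ ‖g s‖ := by
  have hr : 0 < r := pos_of_mem_ball hs
  have hgc : 0 < ‖g c‖ := norm_pos_iff.mpr (h0 c (mem_ball_self hr))
  obtain ⟨h, hd, hc, hgh⟩ := exists_exp_eq_of_ne_zero hr hg h0
  have hre : ∀ z ∈ ball c r, (h z).re ≤ Real.log (B / ‖g c‖) := fun z hz ↦ by
    have hz' := hB z hz
    rw [hgh z hz, norm_mul, norm_exp, ← le_div_iff₀' hgc] at hz'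
    exact (Real.le_log_iff_exp_le ((Real.exp_pos _).trans_le hz')).mpr hz'
  have hnonneg : 0 ≤ Real.log (B / ‖g c‖) := by simpa [hc] using hre c (mem_ball_self hr)
  rw [hgh s hs, norm_mul, norm_exp]
  gcongr
  exact (neg_le_neg (norm_le_of_forall_re_le hnonneg hd hc hre hs)).trans
    (neg_le_of_abs_le (abs_re_le_norm (h s)))

lemma norm_le_norm_cofactor_mul_pow {f g : ℂ → ℂ} {Z : Finset ℂ} {c : ℂ} {r : ℝ}
    (hfg : ∀ s, f s = (∏ ρ ∈ Z, (s - ρ)) * g s) (hZ : ∀ ρ ∈ Z, ρ ∈ closedBall c r) :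
    ‖f c‖ ≤ ‖g c‖ * r ^ Z.card := by
  rw [hfg c, norm_mul, mul_comm, norm_prod, ← Finset.prod_const]
  gcongr with ρ hρ
  exact (mem_closedBall_iff_norm'.mp (hZ ρ hρ))

lemma norm_cofactor_le {f g : ℂ → ℂ} {Z : Finset ℂ} {c : ℂ} {r R M : ℝ} (hR : 0 < R)
    (hrR : r < R) (hg : DifferentiableOn ℂ g (closedBall c R))
    (hfg : ∀ s, f s = (∏ ρ ∈ Z, (s - ρ)) * g s) (hZ : ∀ ρ ∈ Z, ρ ∈ closedBall c r)
    (hM : ∀ s ∈ sphere c R, ‖f s‖ ≤ M) {s : ℂ} (hs : s ∈ closedBall c R) :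
    ‖g s‖ ≤ M / (R - r) ^ Z.card := by
  refine norm_le_of_forall_mem_frontier_norm_le isBounded_ball (hg.diffContOnCl_ball subset_rfl)
    (fun z hz ↦ ?_) (by rwa [closure_ball c hR.ne'])
  have hzR := frontier_ball_subset_sphere hz
  rw [le_div_iff₀ (pow_pos (sub_pos.mpr hrR) _)]
  refine le_trans ?_ (hM z hzR)
  rw [hfg z, norm_mul, norm_prod, mul_comm, ← Finset.prod_const]
  refine mul_le_mul_of_nonneg_right (Finset.prod_le_prod (fun _ _ ↦ (sub_pos.mpr hrR).le)
    fun ρ hρ ↦ ?_) (norm_nonneg _)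
  calc R - r ≤ ‖z - c‖ - ‖ρ - c‖ :=
        sub_le_sub (mem_sphere_iff_norm.mp hzR).ge (mem_closedBall_iff_norm.mp (hZ ρ hρ))
    _ ≤ ‖z - ρ‖ := by simpa using norm_sub_norm_le (z - c) (ρ - c)

/- Dividing by the zeros leaves a non-vanishing function, which has a logarithm; this is bounded
by Borel–Carathéodory. -/
lemma mul_prod_norm_sub_le_norm {U : Set ℂ} (hU : IsOpen U) {f : ℂ → ℂ}
    (hf : DifferentiableOn ℂ f U) {c s : ℂ} {r R M : ℝ} (hrR : r < R) (hcU : closedBall c R ⊆ U)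
    (hM : ∀ z ∈ sphere c R, ‖f z‖ ≤ M) (hc : f c ≠ 0) {Z : Finset ℂ}
    (hZ : ∀ ρ, ρ ∈ Z ↔ ρ ∈ closedBall c r ∧ f ρ = 0) (hsimple : ∀ ρ ∈ Z, deriv f ρ ≠ 0)
    (hs : s ∈ ball c r) :
    ‖f c‖ / r ^ Z.card * Real.exp (-(2 * ‖s - c‖ / (r - ‖s - c‖) *
      Real.log (M / ‖f c‖ * (r / (R - r)) ^ Z.card))) * ∏ ρ ∈ Z, ‖s - ρ‖ ≤ ‖f s‖ := by
  have hr : 0 < r := pos_of_mem_ball hs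
  have hZr : ∀ ρ ∈ Z, ρ ∈ closedBall c r := fun ρ hρ ↦ ((hZ ρ).mp hρ).1
  have hrU : closedBall c r ⊆ U := (closedBall_subset_closedBall hrR.le).trans hcU
  obtain ⟨g, hg, hfg⟩ := exists_eq_prod_sub_mul hU hf fun ρ hρ ↦
    ⟨hrU (hZr ρ hρ), ((hZ ρ).mp hρ).2⟩
  have hg0 : ∀ z ∈ ball c r, g z ≠ 0 := fun z hz h ↦ by
    have hz' := ball_subset_closedBall hz
    have hzZ : z ∈ Z := (hZ z).mpr ⟨hz', by rw [hfg z, h, mul_zero]⟩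
    apply hsimple z hzZ
    rw [deriv_eq_prod_erase_mul (hg.differentiableAt (hU.mem_nhds (hrU hz'))) hfg hzZ, h, mul_zero]
  have hgB : ∀ z ∈ closedBall c R, ‖g z‖ ≤ M / (R - r) ^ Z.card := fun z hz ↦
    norm_cofactor_le (hr.trans hrR) hrR (hg.mono hcU) hfg hZr hM hz
  have hgc : ‖f c‖ / r ^ Z.card ≤ ‖g c‖ := by
    rw [div_le_iff₀ (pow_pos hr _)]
    exact norm_le_norm_cofactor_mul_pow hfg hZr
  have hfc : 0 < ‖f c‖ := norm_pos_iff.mpr hc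
  have hgc0 : 0 < ‖g c‖ := (div_pos hfc (pow_pos hr _)).trans_le hgc
  have hM0 : 0 < M / (R - r) ^ Z.card :=
    hgc0.trans_le (hgB c (mem_closedBall_self (hr.trans hrR).le))
  have hratio : M / (R - r) ^ Z.card / ‖g c‖ ≤ M / ‖f c‖ * (r / (R - r)) ^ Z.card :=
    calc M / (R - r) ^ Z.card / ‖g c‖ ≤ M / (R - r) ^ Z.card / (‖f c‖ / r ^ Z.card) := by gcongr
      _ = M / ‖f c‖ * (r / (R - r)) ^ Z.card := by rw [div_pow]; field_simp
  have hsr : 0 ≤ r - ‖s - c‖ := sub_nonneg.mpr (mem_ball_iff_norm.mp hs).le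
  rw [hfg s, norm_mul, norm_prod, mul_comm _ ‖g s‖]
  gcongr
  refine le_trans ?_ (norm_mul_exp_le_of_ne_zero (hg.mono (ball_subset_closedBall.trans hrU)) hg0
    (fun z hz ↦ hgB z (closedBall_subset_closedBall hrR.le (ball_subset_closedBall hz))) hs)
  gcongr

lemma log_exp_div_le {K x : ℝ} (hx : Real.exp (-K) ≤ x) : Real.log (Real.exp K / x) ≤ 2 * K := by
  have hx0 : 0 < x := (Real.exp_pos _).trans_le hx
  rw [Real.log_div (Real.exp_ne_zero _) hx0.ne', Real.log_exp]
  linarith [(Real.le_log_iff_exp_le hx0).mpr hx]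

lemma pow_le_exp_mul_abs_log {x N : ℝ} (hx : 0 < x) {n : ℕ} (hn : n ≤ N) :
    x ^ n ≤ Real.exp (N * |Real.log x|) := by
  rw [← Real.exp_log (pow_pos hx n), Real.exp_le_exp, Real.log_pow]
  exact (mul_le_mul_of_nonneg_left (le_abs_self _) n.cast_nonneg).trans (by gcongr)

lemma exp_mul_prod_norm_sub_le_norm {U : Set ℂ} (hU : IsOpen U) {f : ℂ → ℂ}
    (hf : DifferentiableOn ℂ f U) {c s : ℂ} {r₁ r R K N : ℝ} (hK : 0 ≤ K) (hr : r₁ < r)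
    (hrR : r < R) (hcU : closedBall c R ⊆ U) (hM : ∀ z ∈ sphere c R, ‖f z‖ ≤ Real.exp K)
    (hc : Real.exp (-K) ≤ ‖f c‖) {Z : Finset ℂ}
    (hZ : ∀ ρ, ρ ∈ Z ↔ ρ ∈ closedBall c r ∧ f ρ = 0) (hsimple : ∀ ρ ∈ Z, deriv f ρ ≠ 0)
    (hN : Z.card ≤ N) (hs : s ∈ closedBall c r₁) :
    Real.exp (-(K + N * |Real.log r| +
      2 * r₁ / (r - r₁) * (2 * K + N * |Real.log (r / (R - r))|))) * ∏ ρ ∈ Z, ‖s - ρ‖ ≤ ‖f s‖ := by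
  have hsr : ‖s - c‖ ≤ r₁ := mem_closedBall_iff_norm.mp hs
  have hr0 : 0 < r := (norm_nonneg _).trans_lt (hsr.trans_lt hr)
  have hd : 0 < R - r := sub_pos.mpr hrR
  have hfc : 0 < ‖f c‖ := (Real.exp_pos _).trans_le hc
  have hlog : Real.log (Real.exp K / ‖f c‖ * (r / (R - r)) ^ Z.card) ≤
      2 * K + N * |Real.log (r / (R - r))| := by
    rw [Real.log_mul (by positivity) (pow_pos (div_pos hr0 hd) _).ne']
    exact add_le_add (log_exp_div_le hc) ((Real.log_le_iff_le_exp (pow_pos (div_pos hr0 hd) _)).mpr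
      (pow_le_exp_mul_abs_log (div_pos hr0 hd) hN))
  have hcof : Real.exp (-(K + N * |Real.log r|)) ≤ ‖f c‖ / r ^ Z.card := by
    rw [neg_add, Real.exp_add, Real.exp_neg (N * _), ← div_eq_mul_inv]
    gcongr
    exact pow_le_exp_mul_abs_log hr0 hN
  have hquot : 2 * ‖s - c‖ / (r - ‖s - c‖) ≤ 2 * r₁ / (r - r₁) :=
    div_le_div₀ (by linarith [norm_nonneg (s - c)]) (by gcongr) (sub_pos.mpr hr) (by gcongr)
  have hquot0 : 0 ≤ 2 * ‖s - c‖ / (r - ‖s - c‖) := div_nonneg (by positivity) (by linarith)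
  refine le_trans ?_ (mul_prod_norm_sub_le_norm hU hf hrR hcU hM (norm_pos_iff.mp hfc) hZ hsimple
    (mem_ball_iff_norm.mpr (hsr.trans_lt hr)))
  have hN0 : 0 ≤ N := Z.card.cast_nonneg.trans hN
  rw [neg_add, Real.exp_add]
  refine mul_le_mul_of_nonneg_right (mul_le_mul hcof (Real.exp_le_exp.mpr (neg_le_neg ?_))
    (Real.exp_pos _).le (by positivity)) (by positivity)
  exact mul_le_mul_of_nonneg hquot hlog hquot0 (by positivity)

lemma exists_exp_mul_prod_norm_sub_le_norm {r₁ r R : ℝ} (hr₁ : 0 ≤ r₁) (hr : r₁ < r)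
    (hrR : r < R) : ∃ A : ℝ, 0 < A ∧ ∀ {U : Set ℂ} {f : ℂ → ℂ} {c : ℂ} {K : ℝ} {Z : Finset ℂ},
      IsOpen U → DifferentiableOn ℂ f U → closedBall c R ⊆ U → 0 ≤ K →
      (∀ z ∈ sphere c R, ‖f z‖ ≤ Real.exp K) → Real.exp (-K) ≤ ‖f c‖ →
      (∀ ρ, ρ ∈ Z ↔ ρ ∈ closedBall c r ∧ f ρ = 0) → (∀ ρ ∈ Z, deriv f ρ ≠ 0) →
      Z.card ≤ A * K ∧
        ∀ s ∈ closedBall c r₁, Real.exp (-(A * K)) * ∏ ρ ∈ Z, ‖s - ρ‖ ≤ ‖f s‖ := by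
  have hr0 : 0 < r := hr₁.trans_lt hr
  set L := Real.log (R / r)
  have hL : 0 < L := Real.log_pos ((one_lt_div hr0).mpr hrR)
  set q := 2 * r₁ / (r - r₁)
  have : 0 ≤ q := div_nonneg (by positivity) (sub_pos.mpr hr).le
  set a := |Real.log r|
  set l := |Real.log (r / (R - r))|
  refine ⟨2 / L + 1 + 2 / L * a + q * (2 + 2 / L * l), by positivity, ?_⟩
  intro U f c K Z hU hf hcU hK hM hc hZ hsimple
  have hcard : Z.card ≤ 2 / L * K := by
    rw [div_mul_eq_mul_div, le_div_iff₀ hL]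
    exact (card_zeros_mul_log_le hr0 hrR ((hf.analyticOnNhd hU).mono hcU) (Real.one_le_exp hK) hM
      (norm_pos_iff.mp ((Real.exp_pos _).trans_le hc)) fun ρ hρ ↦ (hZ ρ).mp hρ).trans
      (log_exp_div_le hc)
  have : 0 ≤ 2 / L * K := by positivity
  have haK : 0 ≤ K + 2 / L * K * a + q * (2 * K + 2 / L * K * l) := by positivity
  refine ⟨by linarith, fun s hs ↦ le_trans ?_
    (exp_mul_prod_norm_sub_le_norm hU hf hK hr hrR hcU hM hc hZ hsimple hcard hs)⟩
  gcongr
  linarith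

/-! ### Size and zeros of the zeta function in vertical strips -/

lemma norm_Gamma_le_Gamma_re {s : ℂ} (hs : 0 < s.re) : ‖Gamma s‖ ≤ Real.Gamma s.re := by
  rw [Gamma_eq_integral hs, GammaIntegral, Real.Gamma_eq_integral hs]
  refine (norm_integral_le_integral_norm _).trans_eq ?_
  refine setIntegral_congr_fun measurableSet_Ioi fun t (ht : 0 < t) ↦ ?_
  simp only [norm_mul, norm_cpow_eq_rpow_re_of_pos ht, norm_real, Real.norm_eq_abs,
    Real.abs_exp, sub_re, one_re]

lemma norm_cos_le_exp_abs_im (z : ℂ) : ‖cos z‖ ≤ Real.exp |z.im| := by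
  have h1 : ‖exp (z * I)‖ ≤ Real.exp |z.im| := by
    rw [norm_exp, Real.exp_le_exp]
    simpa using neg_le_abs z.im
  have h2 : ‖exp (-z * I)‖ ≤ Real.exp |z.im| := by
    rw [norm_exp, Real.exp_le_exp]
    simpa using le_abs_self z.im
  rw [cos, norm_div, norm_ofNat, div_le_iff₀ two_pos]
  linarith [norm_add_le (exp (z * I)) (exp (-z * I))]

lemma norm_riemannZeta_le_exp_of_half_le {s : ℂ} {b : ℝ} (hs : 1 / 2 ≤ s.re) (hb : s.re ≤ b)
    (hs1 : 1 ≤ |s.im|) : ‖riemannZeta s‖ ≤ 3 * (b + 1) * Real.exp |s.im| := by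
  have hre : 0 < s.re := one_half_pos.trans_le hs
  have hcoef : 1 + 1 / s.re ≤ 3 := by
    have := one_div_le_one_div_of_le one_half_pos hs
    norm_num at this ⊢
    linarith
  have hnorm : ‖s‖ ≤ (b + 1) * |s.im| := by
    have := norm_le_abs_re_add_abs_im s
    rw [abs_of_pos hre] at this
    nlinarith
  calc ‖riemannZeta s‖ ≤ (1 + 1 / s.re) * ‖s‖ := norm_riemannZeta_le hre hs1
    _ ≤ 3 * ((b + 1) * |s.im|) := by gcongr
    _ ≤ 3 * ((b + 1) * Real.exp |s.im|) := by
        have : 0 ≤ b + 1 := by linarith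
        gcongr
        linarith [Real.add_one_le_exp |s.im|]
    _ = 3 * (b + 1) * Real.exp |s.im| := by ring

lemma norm_riemannZeta_one_sub_le {w : ℂ} (hw : 0 < w.re) (hw1 : w ≠ 1) :
    ‖riemannZeta (1 - w)‖ ≤ 2 * Real.Gamma w.re * Real.exp (2 * |w.im|) * ‖riemannZeta w‖ := by
  have hpole (n : ℕ) : w ≠ -n := by
    rintro rfl
    simp only [neg_re, natCast_re, Left.neg_pos_iff] at hw
    exact absurd hw n.cast_nonneg.not_gt
  have hpow : ‖(2 * (Real.pi : ℂ)) ^ (-w)‖ ≤ 1 := by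
    rw [show 2 * (Real.pi : ℂ) = ((2 * Real.pi : ℝ) : ℂ) by push_cast; ring,
      norm_cpow_eq_rpow_re_of_pos Real.two_pi_pos]
    exact Real.rpow_le_one_of_one_le_of_nonpos (by linarith [Real.pi_gt_three])
      (neg_nonpos.mpr hw.le)
  have hcos : ‖cos (Real.pi * w / 2)‖ ≤ Real.exp (2 * |w.im|) := by
    refine (norm_cos_le_exp_abs_im _).trans (Real.exp_le_exp.mpr ?_)
    rw [show (Real.pi * w / 2 : ℂ) = ((Real.pi / 2 : ℝ) : ℂ) * w by push_cast; ring,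
      im_ofReal_mul, abs_mul, abs_of_pos Real.pi_div_two_pos]
    gcongr
    linarith [Real.pi_lt_four]
  rw [riemannZeta_one_sub hpole hw1]
  simp only [norm_mul, norm_ofNat]
  gcongr
  · exact mul_le_of_le_one_right zero_le_two hpow
  · exact norm_Gamma_le_Gamma_re hw

lemma exists_norm_riemannZeta_le_exp (a b : ℝ) : ∃ K : ℝ, 0 < K ∧ ∀ s : ℂ, a ≤ s.re → s.re ≤ b →
    1 ≤ |s.im| → ‖riemannZeta s‖ ≤ Real.exp (K * |s.im|) := by
  obtain ⟨G, hG⟩ := (isCompact_Icc (a := (1 / 2 : ℝ)) (b := 1 - a)).exists_bound_of_continuousOn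
    (f := Real.Gamma) fun x hx ↦ (Real.differentiableAt_Gamma fun m ↦ by
      linarith [hx.1, m.cast_nonneg (α := ℝ)]).continuousAt.continuousWithinAt
  set C := 3 * (|b| + 1) + 2 * |G| * (3 * (|1 - a| + 1))
  have hC : 1 ≤ C := by
    have h1 : 0 ≤ 2 * |G| * (3 * (|1 - a| + 1)) := by positivity
    linarith [abs_nonneg b]
  refine ⟨Real.log C + 3, by linarith [Real.log_nonneg hC], fun s ha hb hs ↦ ?_⟩
  have hexp : C * Real.exp (3 * |s.im|) ≤ Real.exp ((Real.log C + 3) * |s.im|) := by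
    rw [add_mul (Real.log C), Real.exp_add]
    gcongr
    nth_rewrite 1 [← Real.exp_log (one_pos.trans_le hC)]
    exact Real.exp_le_exp.mpr (le_mul_of_one_le_right (Real.log_nonneg hC) hs)
  refine le_trans ?_ hexp
  rcases le_or_gt (1 / 2) s.re with h | h
  · refine (norm_riemannZeta_le_exp_of_half_le h (hb.trans (le_abs_self b)) hs).trans ?_
    gcongr
    · exact le_add_of_nonneg_right (by positivity)
    · linarith [abs_nonneg s.im]
  · have hw : 1 / 2 ≤ (1 - s).re := by rw [sub_re, one_re]; linarith
    have hw' : (1 - s).re ≤ 1 - a := by rw [sub_re, one_re]; linarith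
    have him : |(1 - s).im| = |s.im| := by simp
    have hne : 1 - s ≠ 1 := fun h ↦ by
      rw [h, one_im, abs_zero] at him
      linarith
    have hfe := norm_riemannZeta_one_sub_le (one_half_pos.trans_le hw) hne
    have hζ := norm_riemannZeta_le_exp_of_half_le hw (hw'.trans (le_abs_self _)) (by rwa [him])
    have hΓ := ((le_abs_self _).trans (hG (1 - s).re ⟨hw, hw'⟩)).trans (le_abs_self G)
    rw [sub_sub_cancel, him] at hfe
    rw [him] at hζ
    calc ‖riemannZeta s‖
        ≤ 2 * |G| * Real.exp (2 * |s.im|) * (3 * (|1 - a| + 1) * Real.exp |s.im|) := by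
          refine hfe.trans ?_
          gcongr
      _ = 2 * |G| * (3 * (|1 - a| + 1)) * Real.exp (3 * |s.im|) := by
          rw [show 3 * |s.im| = 2 * |s.im| + |s.im| by ring, Real.exp_add]
          ring
      _ ≤ C * Real.exp (3 * |s.im|) := by
          gcongr
          exact le_add_of_nonneg_left (by positivity)

section

open ArithmeticFunction ArithmeticFunction.Moebius LSeries.notation

lemma norm_term_moebius_le {s : ℂ} (hs : 2 ≤ s.re) (n : ℕ) :
    ‖LSeries.term ↗μ s n‖ ≤ 1 / (n : ℝ) ^ 2 := by
  rcases eq_or_ne n 0 with rfl | hn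
  · simp
  have hn1 : (1 : ℝ) ≤ n := Nat.one_le_cast.mpr (Nat.one_le_iff_ne_zero.mpr hn)
  rw [LSeries.norm_term_eq, if_neg hn]
  gcongr
  · rw [norm_intCast]
    exact_mod_cast abs_moebius_le_one
  · rw [← Real.rpow_natCast]
    exact Real.rpow_le_rpow_of_exponent_le hn1 (by exact_mod_cast hs)

lemma norm_LSeries_moebius_le_two {s : ℂ} (hs : 2 ≤ s.re) : ‖LSeries ↗μ s‖ ≤ 2 := by
  have hsum : Summable fun n : ℕ ↦ 1 / (n : ℝ) ^ 2 :=
    Real.summable_one_div_nat_pow.mpr one_lt_two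
  refine (tsum_of_norm_bounded hsum.hasSum (norm_term_moebius_le hs)).trans ?_
  rw [hasSum_zeta_two.tsum_eq]
  nlinarith [Real.pi_lt_d2, Real.pi_pos]

lemma half_le_norm_riemannZeta {s : ℂ} (hs : 2 ≤ s.re) : 1 / 2 ≤ ‖riemannZeta s‖ := by
  have hs1 : 1 < s.re := one_lt_two.trans_le hs
  have hinv : ‖riemannZeta s‖ * ‖LSeries ↗μ s‖ = 1 := by
    rw [← LSeries_zeta_eq_riemannZeta hs1, ← norm_mul, LSeries_zeta_mul_Lseries_moebius hs1,
      norm_one]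
  nlinarith [norm_nonneg (riemannZeta s), norm_LSeries_moebius_le_two hs]

end

lemma differentiableOn_riemannZeta_compl : DifferentiableOn ℂ riemannZeta {1}ᶜ :=
  fun _ hs ↦ (differentiableAt_riemannZeta hs).differentiableWithinAt

lemma abs_re_sub_le_of_mem_closedBall {s c : ℂ} {R : ℝ} (hs : s ∈ closedBall c R) :
    |s.re - c.re| ≤ R :=
  (sub_re s c ▸ abs_re_le_norm (s - c)).trans (mem_closedBall_iff_norm.mp hs)

lemma abs_im_sub_le_of_mem_closedBall {s c : ℂ} {R : ℝ} (hs : s ∈ closedBall c R) :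
    |s.im - c.im| ≤ R :=
  (sub_im s c ▸ abs_im_le_norm (s - c)).trans (mem_closedBall_iff_norm.mp hs)

lemma mem_closedBall_of_sq_add_sq_le {s c : ℂ} {R : ℝ} (hR : 0 ≤ R)
    (h : (s.re - c.re) ^ 2 + (s.im - c.im) ^ 2 ≤ R ^ 2) : s ∈ closedBall c R := by
  rwa [mem_closedBall_iff_norm, norm_eq_sqrt_sq_add_sq, Real.sqrt_le_left hR, sub_re, sub_im]

lemma closedBall_subset_compl_one {c : ℂ} {R : ℝ} (h : R < c.im) : closedBall c R ⊆ {1}ᶜ := by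
  rintro s hs rfl
  have := abs_im_sub_le_of_mem_closedBall hs
  rw [one_im, zero_sub, abs_neg] at this
  linarith [le_abs_self c.im]

lemma one_lt_log_of_three_le {t : ℝ} (ht : 3 ≤ t) : 1 < Real.log t := by
  rw [Real.lt_log_iff_exp_lt (by linarith)]
  linarith [Real.exp_one_lt_d9]

lemma norm_riemannZeta_le_of_mem_sphere {t : ℝ} (ht : 3 ≤ t) {s : ℂ}
    (hs : s ∈ sphere (⟨2, t⟩ : ℂ) (19 / 10)) : ‖riemannZeta s‖ ≤ 11 * (t + 6) := by
  have hball := sphere_subset_closedBall hs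
  have hre := abs_le.mp (abs_re_sub_le_of_mem_closedBall hball)
  have him := abs_le.mp (abs_im_sub_le_of_mem_closedBall hball)
  dsimp only at hre him
  have hre0 : 1 / 10 ≤ s.re := by linarith [hre.1]
  have him0 : 1 ≤ s.im := by linarith [him.1]
  have hnorm : ‖s‖ ≤ s.re + s.im := by
    have := norm_le_abs_re_add_abs_im s
    rwa [abs_of_nonneg (by linarith : 0 ≤ s.re), abs_of_nonneg (by linarith : 0 ≤ s.im)] at this
  have hinv : 1 / s.re ≤ 10 := by
    simpa using one_div_le_one_div_of_le (by norm_num) hre0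
  calc ‖riemannZeta s‖ ≤ (1 + 1 / s.re) * ‖s‖ :=
        norm_riemannZeta_le (by linarith) (him0.trans (le_abs_self _))
    _ ≤ (1 + 10) * (s.re + s.im) := by gcongr
    _ ≤ 11 * (t + 6) := by linarith [hre.2, him.2]

lemma exists_card_zeros_le : ∃ C : ℝ, 1 ≤ C ∧ ∀ t : ℝ, 3 ≤ t → ∀ Z : Finset ℂ,
    (∀ ρ ∈ Z, riemannZeta ρ = 0 ∧ 1 / 2 ≤ ρ.re ∧ |ρ.im - t| ≤ 1 / 2) →
    (Z.card : ℝ) ≤ C * Real.log t := by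
  set l := Real.log (19 / 10 / (8 / 5))
  have hl : 0 < l := Real.log_pos (by norm_num)
  refine ⟨6 / l + 1, by linarith [div_pos (by norm_num : (0 : ℝ) < 6) hl], fun t ht Z hZ ↦ ?_⟩
  have hlogt := one_lt_log_of_three_le ht
  set c : ℂ := ⟨2, t⟩
  have hc : 1 / 2 ≤ ‖riemannZeta c‖ := half_le_norm_riemannZeta le_rfl
  have hcU : closedBall c (19 / 10) ⊆ {1}ᶜ :=
    closedBall_subset_compl_one (show (19 / 10 : ℝ) < t by linarith)
  have hZball : ∀ ρ ∈ Z, ρ ∈ closedBall c (8 / 5) ∧ riemannZeta ρ = 0 := fun ρ hρ ↦ by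
    obtain ⟨h0, hre, him⟩ := hZ ρ hρ
    have hre1 : ρ.re < 1 := lt_of_not_ge fun h ↦ riemannZeta_ne_zero_of_one_le_re h h0
    refine ⟨mem_closedBall_of_sq_add_sq_le (by norm_num) ?_, h0⟩
    change (ρ.re - 2) ^ 2 + (ρ.im - t) ^ 2 ≤ _
    nlinarith [abs_le.mp him]
  have hjensen := card_zeros_mul_log_le (by norm_num) (by norm_num)
    ((differentiableOn_riemannZeta_compl.analyticOnNhd isOpen_compl_singleton).mono hcU)
    (by linarith) (fun s ↦ norm_riemannZeta_le_of_mem_sphere ht)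
    (norm_pos_iff.mp (by linarith)) hZball
  have hlog : Real.log (11 * (t + 6) / ‖riemannZeta c‖) ≤ 6 * Real.log t := by
    have hpow : 22 * (t + 6) ≤ t ^ 6 := by
      have : 3 ^ 5 * t ≤ t ^ 5 * t := by gcongr
      nlinarith
    rw [show 6 * Real.log t = Real.log (t ^ 6) by rw [Real.log_pow]; norm_num]
    refine Real.log_le_log (by positivity) ?_
    rw [div_le_iff₀ (by positivity)]
    nlinarith [pow_pos (by linarith : 0 < t) 6]
  have hcard : Z.card ≤ 6 * Real.log t / l := (le_div_iff₀ hl).mpr (hjensen.trans hlog)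
  rw [add_mul, one_mul, div_mul_eq_mul_div]
  linarith

lemma exists_forall_le_abs_sub (Z : Finset ℝ) (τ : ℝ) :
    ∃ t ∈ Icc τ (τ + 1 / 2), ∀ γ ∈ Z, 1 / (4 * (Z.card + 1) : ℝ) ≤ |t - γ| := by
  by_contra! h
  set d : ℝ := 1 / (4 * (Z.card + 1) : ℝ) with hd
  have hcover : Icc τ (τ + 1 / 2) ⊆ ⋃ γ ∈ Z, ball γ d := fun t ht ↦ by
    obtain ⟨γ, hγ, hlt⟩ := h t ht
    exact mem_biUnion hγ (by rwa [mem_ball, Real.dist_eq])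
  have hvol := (measure_mono (μ := volume) hcover).trans (measure_biUnion_finset_le Z _)
  simp only [Real.volume_Icc, Real.volume_ball, Finset.sum_const, nsmul_eq_mul] at hvol
  rw [← ENNReal.ofReal_natCast, ← ENNReal.ofReal_mul (by positivity),
    ENNReal.ofReal_le_ofReal_iff (by positivity)] at hvol
  have hlen : (Z.card : ℝ) * (2 * d) = Z.card / (2 * (Z.card + 1)) := by
    rw [hd]
    field_simp
    norm_num
  rw [hlen, le_div_iff₀ (by positivity)] at hvol
  linarith

lemma exists_exp_neg_card_mul_log_le_prod (Z : Finset ℂ) (τ : ℝ) : ∃ t ∈ Icc τ (τ + 1 / 2),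
    ∀ σ : ℝ, Real.exp (-(Z.card * Real.log (4 * (Z.card + 1)))) ≤
      ∏ ρ ∈ Z, ‖(σ + t * I : ℂ) - ρ‖ := by
  classical
  obtain ⟨t, ht, hdist⟩ := exists_forall_le_abs_sub (Z.image im) τ
  refine ⟨t, ht, fun σ ↦ ?_⟩
  have hfactor : ∀ ρ ∈ Z, 1 / (4 * (Z.card + 1) : ℝ) ≤ ‖(σ + t * I : ℂ) - ρ‖ := fun ρ hρ ↦
    calc 1 / (4 * (Z.card + 1) : ℝ) ≤ 1 / (4 * ((Z.image im).card + 1) : ℝ) := by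
          gcongr
          exact Finset.card_image_le
      _ ≤ |t - ρ.im| := hdist ρ.im (Finset.mem_image_of_mem _ hρ)
      _ ≤ ‖(σ + t * I : ℂ) - ρ‖ := by simpa using abs_im_le_norm ((σ + t * I : ℂ) - ρ)
  calc Real.exp (-(Z.card * Real.log (4 * (Z.card + 1))))
      = ∏ _ρ ∈ Z, 1 / (4 * (Z.card + 1) : ℝ) := by
        rw [Finset.prod_const, Real.exp_neg, Real.exp_nat_mul, Real.exp_log (by positivity),
          one_div, inv_pow]
    _ ≤ _ := Finset.prod_le_prod (fun _ _ ↦ by positivity) hfactor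

lemma exists_exp_mul_prod_norm_sub_le_norm_riemannZeta (T₀ : ℝ) (hsimple : ∀ ρ : ℂ,
    riemannZeta ρ = 0 → T₀ ≤ ρ.im → deriv riemannZeta ρ ≠ 0) :
    ∃ K : ℝ, 1 ≤ K ∧ ∀ τ : ℝ, 10 ≤ τ → T₀ + 7 ≤ τ → ∃ Z : Finset ℂ, Z.card ≤ K * τ ∧
      ∀ s ∈ closedBall (⟨3, τ⟩ : ℂ) (51 / 10),
        Real.exp (-(K * τ)) * ∏ ρ ∈ Z, ‖s - ρ‖ ≤ ‖riemannZeta s‖ := by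
  obtain ⟨A, hA, hmain⟩ := exists_exp_mul_prod_norm_sub_le_norm (r₁ := 51 / 10) (r := 6) (R := 7)
    (by norm_num) (by norm_num) (by norm_num)
  obtain ⟨B, hB, hbound⟩ := exists_norm_riemannZeta_le_exp (-4) 10
  set K := 2 * B + 1
  refine ⟨A * K + 1, le_add_of_nonneg_left (by positivity), fun τ hτ hτ₀ ↦ ?_⟩
  set c : ℂ := ⟨3, τ⟩
  have hfin : (closedBall c 6 ∩ riemannZetaZeros).Finite :=
    (isCompact_closedBall c 6).inter_riemannZetaZeros_finite
  have hZ (ρ : ℂ) : ρ ∈ hfin.toFinset ↔ ρ ∈ closedBall c 6 ∧ riemannZeta ρ = 0 := by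
    simp [mem_riemannZetaZeros]
  have hsphere : ∀ z ∈ sphere c 7, ‖riemannZeta z‖ ≤ Real.exp (K * τ) := fun z hz ↦ by
    have hre := abs_le.mp (abs_re_sub_le_of_mem_closedBall (sphere_subset_closedBall hz))
    have him := abs_le.mp (abs_im_sub_le_of_mem_closedBall (sphere_subset_closedBall hz))
    dsimp only [c] at hre him
    have habs : |z.im| = z.im := abs_of_nonneg (by linarith [him.1])
    refine (hbound z (by linarith [hre.1]) (by linarith [hre.2])
      (by linarith [him.1])).trans (Real.exp_le_exp.mpr ?_)
    rw [habs]
    nlinarith [him.2]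
  have hcenter : Real.exp (-(K * τ)) ≤ ‖riemannZeta c‖ := by
    refine le_trans ?_ (half_le_norm_riemannZeta (show 2 ≤ c.re by norm_num [c]))
    rw [Real.exp_neg, one_div]
    exact inv_anti₀ two_pos (by nlinarith [Real.add_one_le_exp (K * τ)])
  obtain ⟨hcard, hlow⟩ := hmain isOpen_compl_singleton differentiableOn_riemannZeta_compl
    (closedBall_subset_compl_one (show 7 < τ by linarith)) (by positivity) hsphere hcenter hZ
    fun ρ hρ ↦ hsimple ρ ((hZ ρ).mp hρ).2 (by
      have := (abs_le.mp (abs_im_sub_le_of_mem_closedBall ((hZ ρ).mp hρ).1)).1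
      dsimp only [c] at this
      linarith)
  refine ⟨hfin.toFinset, by linarith, fun s hs ↦ le_trans ?_ (hlow s hs)⟩
  exact mul_le_mul_of_nonneg_right (Real.exp_le_exp.mpr (by linarith)) (by positivity)

lemma exists_height_riemannZeta_ge (T₀ : ℝ) (hsimple : ∀ ρ : ℂ, riemannZeta ρ = 0 → T₀ ≤ ρ.im →
    deriv riemannZeta ρ ≠ 0) : ∃ K : ℝ, 1 ≤ K ∧ ∀ τ : ℝ, 10 ≤ τ → T₀ + 7 ≤ τ →
    ∃ t ∈ Icc τ (τ + 1 / 2), ∀ σ ∈ Icc (-2 : ℝ) 3,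
      Real.exp (-(K * τ * Real.log τ)) ≤ ‖riemannZeta (σ + t * I)‖ := by
  obtain ⟨K, hK, hmain⟩ := exists_exp_mul_prod_norm_sub_le_norm_riemannZeta T₀ hsimple
  have hlogK : 0 ≤ Real.log (8 * K) := Real.log_nonneg (by linarith)
  refine ⟨K * (Real.log (8 * K) + 2), by nlinarith, fun τ hτ hτ₀ ↦ ?_⟩
  obtain ⟨Z, hcard, hlow⟩ := hmain τ hτ hτ₀
  obtain ⟨t, ht, hprod⟩ := exists_exp_neg_card_mul_log_le_prod Z τ
  refine ⟨t, ht, fun σ hσ ↦ ?_⟩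
  have hball : (σ + t * I : ℂ) ∈ closedBall (⟨3, τ⟩ : ℂ) (51 / 10) := by
    refine mem_closedBall_of_sq_add_sq_le (by norm_num) ?_
    simp only [add_re, add_im, ofReal_re, ofReal_im, re_ofReal_mul, im_ofReal_mul, I_re, I_im]
    nlinarith [hσ.1, hσ.2, ht.1, ht.2]
  have hlogτ := one_lt_log_of_three_le (by linarith : 3 ≤ τ)
  have hlog : Real.log (4 * (Z.card + 1)) ≤ (Real.log (8 * K) + 1) * Real.log τ := by
    have h : (4 * (Z.card + 1) : ℝ) ≤ 8 * K * τ := by nlinarith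
    have := Real.log_le_log (by positivity) h
    rw [Real.log_mul (x := 8 * K) (by positivity) (by positivity)] at this
    nlinarith
  have hexponent : K * τ + Z.card * Real.log (4 * (Z.card + 1)) ≤
      K * (Real.log (8 * K) + 2) * τ * Real.log τ :=
    calc K * τ + Z.card * Real.log (4 * (Z.card + 1))
        ≤ K * τ * Real.log τ + K * τ * ((Real.log (8 * K) + 1) * Real.log τ) :=
          add_le_add (le_mul_of_one_le_right (by positivity) hlogτ.le)
            (mul_le_mul hcard hlog (Real.log_nonneg (by linarith [Z.card.cast_nonneg (α := ℝ)]))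
              (by positivity))
      _ = K * (Real.log (8 * K) + 2) * τ * Real.log τ := by ring
  calc Real.exp (-(K * (Real.log (8 * K) + 2) * τ * Real.log τ))
      ≤ Real.exp (-(K * τ)) * Real.exp (-(Z.card * Real.log (4 * (Z.card + 1)))) := by
        rw [← Real.exp_add, Real.exp_le_exp]
        linarith
    _ ≤ Real.exp (-(K * τ)) * ∏ ρ ∈ Z, ‖(σ + t * I : ℂ) - ρ‖ := by
        gcongr
        exact hprod σ
    _ ≤ ‖riemannZeta (σ + t * I)‖ := hlow _ hball

/-! ### Residues in a rectangle -/

/-- The integral of `f` along the positively oriented boundary of `[a, b] × [c, d]`. -/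
noncomputable def rectIntegral (f : ℂ → ℂ) (a b c d : ℝ) : ℂ :=
  (∫ x : ℝ in a..b, f (x + c * I)) - (∫ x : ℝ in a..b, f (x + d * I)) +
    I * (∫ y : ℝ in c..d, f (b + y * I)) - I * (∫ y : ℝ in c..d, f (a + y * I))

/-- The boundary of the rectangle `[a, b] × [c, d]`, the contour of `rectIntegral`. -/
def rectBoundary (a b c d : ℝ) : Set ℂ :=
  {s | s.re ∈ Icc a b ∧ s.im ∈ Icc c d ∧ (s.re = a ∨ s.re = b ∨ s.im = c ∨ s.im = d)}

section

variable {a b c d : ℝ} {f g : ℂ → ℂ}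

lemma bot_mem_rectBoundary (hab : a ≤ b) (hcd : c ≤ d) {x : ℝ} (hx : x ∈ uIcc a b) :
    (x + c * I : ℂ) ∈ rectBoundary a b c d := by
  rw [uIcc_of_le hab] at hx
  simp [rectBoundary, hx.1, hx.2, hcd]

lemma top_mem_rectBoundary (hab : a ≤ b) (hcd : c ≤ d) {x : ℝ} (hx : x ∈ uIcc a b) :
    (x + d * I : ℂ) ∈ rectBoundary a b c d := by
  rw [uIcc_of_le hab] at hx
  simp [rectBoundary, hx.1, hx.2, hcd]

lemma left_mem_rectBoundary (hab : a ≤ b) (hcd : c ≤ d) {y : ℝ} (hy : y ∈ uIcc c d) :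
    (a + y * I : ℂ) ∈ rectBoundary a b c d := by
  rw [uIcc_of_le hcd] at hy
  simp [rectBoundary, hy.1, hy.2, hab]

lemma right_mem_rectBoundary (hab : a ≤ b) (hcd : c ≤ d) {y : ℝ} (hy : y ∈ uIcc c d) :
    (b + y * I : ℂ) ∈ rectBoundary a b c d := by
  rw [uIcc_of_le hcd] at hy
  simp [rectBoundary, hy.1, hy.2, hab]

lemma rectIntegral_congr (hab : a ≤ b) (hcd : c ≤ d) (h : ∀ s ∈ rectBoundary a b c d, f s = g s) :
    rectIntegral f a b c d = rectIntegral g a b c d := by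
  unfold rectIntegral
  rw [intervalIntegral.integral_congr fun x hx ↦ h _ (bot_mem_rectBoundary hab hcd hx),
    intervalIntegral.integral_congr fun x hx ↦ h _ (top_mem_rectBoundary hab hcd hx),
    intervalIntegral.integral_congr fun y hy ↦ h _ (right_mem_rectBoundary hab hcd hy),
    intervalIntegral.integral_congr fun y hy ↦ h _ (left_mem_rectBoundary hab hcd hy)]

lemma rectIntegral_add (hab : a ≤ b) (hcd : c ≤ d) (hf : ContinuousOn f (rectBoundary a b c d))
    (hg : ContinuousOn g (rectBoundary a b c d)) :
    rectIntegral (fun s ↦ f s + g s) a b c d = rectIntegral f a b c d + rectIntegral g a b c d := by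
  unfold rectIntegral
  rw [intervalIntegral.integral_add, intervalIntegral.integral_add, intervalIntegral.integral_add,
    intervalIntegral.integral_add]
  · ring
  all_goals apply ContinuousOn.intervalIntegrable
  · exact hf.comp (by fun_prop) fun y hy ↦ left_mem_rectBoundary hab hcd hy
  · exact hg.comp (by fun_prop) fun y hy ↦ left_mem_rectBoundary hab hcd hy
  · exact hf.comp (by fun_prop) fun y hy ↦ right_mem_rectBoundary hab hcd hy
  · exact hg.comp (by fun_prop) fun y hy ↦ right_mem_rectBoundary hab hcd hy
  · exact hf.comp (by fun_prop) fun x hx ↦ top_mem_rectBoundary hab hcd hx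
  · exact hg.comp (by fun_prop) fun x hx ↦ top_mem_rectBoundary hab hcd hx
  · exact hf.comp (by fun_prop) fun x hx ↦ bot_mem_rectBoundary hab hcd hx
  · exact hg.comp (by fun_prop) fun x hx ↦ bot_mem_rectBoundary hab hcd hx

lemma rectIntegral_const_mul (k : ℂ) :
    rectIntegral (fun s ↦ k * f s) a b c d = k * rectIntegral f a b c d := by
  simp only [rectIntegral, intervalIntegral.integral_const_mul]
  ring

lemma rectIntegral_sum {ι : Type*} (Z : Finset ι) {F : ι → ℂ → ℂ} (hab : a ≤ b) (hcd : c ≤ d)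
    (hF : ∀ i ∈ Z, ContinuousOn (F i) (rectBoundary a b c d)) :
    rectIntegral (fun s ↦ ∑ i ∈ Z, F i s) a b c d = ∑ i ∈ Z, rectIntegral (F i) a b c d := by
  classical
  induction Z using Finset.induction_on with
  | empty => simp [rectIntegral]
  | insert i Z hi ih =>
    have hFZ : ∀ j ∈ Z, ContinuousOn (F j) (rectBoundary a b c d) := fun j hj ↦
      hF j (Finset.mem_insert_of_mem hj)
    simp only [Finset.sum_insert hi]
    rw [rectIntegral_add hab hcd (hF i (Finset.mem_insert_self _ _))
      (continuousOn_finsetSum _ hFZ), ih hFZ]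

lemma rectIntegral_eq_zero (hab : a ≤ b) (hcd : c ≤ d)
    (hf : DifferentiableOn ℂ f (Icc a b ×ℂ Icc c d)) : rectIntegral f a b c d = 0 := by
  have h := integral_boundary_rect_eq_zero_of_differentiableOn f ⟨a, c⟩ ⟨b, d⟩
    (by simpa [uIcc_of_le hab, uIcc_of_le hcd] using hf)
  simpa [rectIntegral] using h

lemma rectIntegral_comp_sub (ρ : ℂ) : rectIntegral (fun s ↦ f (s - ρ)) a b c d =
    rectIntegral f (a - ρ.re) (b - ρ.re) (c - ρ.im) (d - ρ.im) := by
  have hsub (x y : ℝ) : (x + y * I : ℂ) - ρ = (x - ρ.re : ℝ) + (y - ρ.im : ℝ) * I := by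
    apply Complex.ext <;> simp
  have hhor (y : ℝ) : ∫ x : ℝ in a..b, f (x + y * I - ρ) =
      ∫ x : ℝ in a - ρ.re..b - ρ.re, f (x + (y - ρ.im : ℝ) * I) := by
    simp only [hsub]
    exact intervalIntegral.integral_comp_sub_right (fun x : ℝ ↦ f (x + (y - ρ.im : ℝ) * I)) _
  have hver (x : ℝ) : ∫ y : ℝ in c..d, f (x + y * I - ρ) =
      ∫ y : ℝ in c - ρ.im..d - ρ.im, f ((x - ρ.re : ℝ) + y * I) := by
    simp only [hsub]
    exact intervalIntegral.integral_comp_sub_right (fun y : ℝ ↦ f ((x - ρ.re : ℝ) + y * I)) _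
  simp only [rectIntegral, hhor, hver]

lemma log_neg_of_im_pos {z : ℂ} (hz : 0 < z.im) : log (-z) = log z - Real.pi * I := by
  rw [log, log, norm_neg, arg_neg_eq_arg_sub_pi_of_im_pos hz]
  push_cast
  ring

lemma integral_inv_horizontal {y : ℝ} (hy : y ≠ 0) (a b : ℝ) :
    ∫ x : ℝ in a..b, (x + y * I : ℂ)⁻¹ = log (b + y * I) - log (a + y * I) := by
  have hmem (x : ℝ) : (x + y * I : ℂ) ∈ slitPlane := by simp [slitPlane, hy]
  refine intervalIntegral.integral_eq_sub_of_hasDerivAt (f := fun x : ℝ ↦ log (x + y * I))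
    (fun x _ ↦ ?_) ?_
  · have hline : HasDerivAt (fun x : ℝ ↦ (x + y * I : ℂ)) 1 x := by
      simpa using (ofRealCLM.hasDerivAt (x := x)).add_const (y * I : ℂ)
    simpa using hline.clog_real (hmem x)
  · exact (Continuous.inv₀ (by fun_prop) fun x ↦ slitPlane_ne_zero (hmem x)).intervalIntegrable _ _

lemma integral_inv_vertical {x : ℝ} (hx : 0 < x) (c d : ℝ) :
    I * ∫ y : ℝ in c..d, (x + y * I : ℂ)⁻¹ = log (x + d * I) - log (x + c * I) := by
  have hmem (y : ℝ) : (x + y * I : ℂ) ∈ slitPlane := by simp [slitPlane, hx]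
  rw [← intervalIntegral.integral_const_mul]
  refine intervalIntegral.integral_eq_sub_of_hasDerivAt (f := fun y : ℝ ↦ log (x + y * I))
    (fun y _ ↦ ?_) ?_
  · have hline : HasDerivAt (fun y : ℝ ↦ (x + y * I : ℂ)) I y := by
      simpa using ((ofRealCLM.hasDerivAt (x := y)).mul_const I).const_add (x : ℂ)
    simpa [div_eq_mul_inv] using hline.clog_real (hmem y)
  · exact (continuous_const.mul (Continuous.inv₀ (by fun_prop) fun y ↦
      slitPlane_ne_zero (hmem y))).intervalIntegrable _ _

lemma integral_inv_vertical_of_neg {x : ℝ} (hx : x < 0) (c d : ℝ) :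
    I * ∫ y : ℝ in c..d, (x + y * I : ℂ)⁻¹ = log (-(x + d * I)) - log (-(x + c * I)) := by
  have hneg (y : ℝ) : ((-x : ℝ) + (-y : ℝ) * I : ℂ) = -(x + y * I) := by
    push_cast
    ring
  have hflip := intervalIntegral.integral_comp_neg (a := c) (b := d)
    fun y : ℝ ↦ ((-x : ℝ) + y * I : ℂ)⁻¹
  have hright := integral_inv_vertical (neg_pos.mpr hx) (-d) (-c)
  rw [← hflip] at hright
  simp only [hneg, inv_neg, intervalIntegral.integral_neg] at hright
  linear_combination -hright

/- The principal logarithm is a primitive of `z⁻¹` on the edges off the negative real axis and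
`log (-z)` is one on the left edge; the two differ by `±πi` at the left corners. -/
lemma rectIntegral_inv (ha : a < 0) (hb : 0 < b) (hc : c < 0) (hd : 0 < d) :
    rectIntegral (fun s ↦ s⁻¹) a b c d = 2 * Real.pi * I := by
  have htop := log_neg_of_im_pos (z := a + d * I) (by simpa)
  have hbot := log_neg_of_im_pos (z := -(a + c * I)) (by simpa)
  rw [neg_neg] at hbot
  rw [rectIntegral, integral_inv_horizontal hc.ne, integral_inv_horizontal hd.ne',
    integral_inv_vertical hb, integral_inv_vertical_of_neg ha, htop, hbot]
  ring

lemma rectIntegral_inv_sub {ρ : ℂ} (ha : a < ρ.re) (hb : ρ.re < b) (hc : c < ρ.im)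
    (hd : ρ.im < d) : rectIntegral (fun s ↦ (s - ρ)⁻¹) a b c d = 2 * Real.pi * I :=
  (rectIntegral_comp_sub ρ).trans
    (rectIntegral_inv (sub_neg.mpr ha) (sub_pos.mpr hb) (sub_neg.mpr hc) (sub_pos.mpr hd))

end

lemma sum_mul_prod_erase_sub_self {Z : Finset ℂ} (k : ℂ → ℂ) {ρ : ℂ} (hρ : ρ ∈ Z) :
    ∑ ρ₁ ∈ Z, k ρ₁ * ∏ ρ' ∈ Z.erase ρ₁, (ρ - ρ') = k ρ * ∏ ρ' ∈ Z.erase ρ, (ρ - ρ') := by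
  refine Finset.sum_eq_single_of_mem ρ hρ fun ρ₁ _ hne ↦ ?_
  rw [Finset.prod_eq_zero (Finset.mem_erase.mpr ⟨hne.symm, hρ⟩) (sub_self ρ), mul_zero]

lemma sum_mul_prod_erase_sub_div_prod {Z : Finset ℂ} (k : ℂ → ℂ) {s : ℂ} (hs : s ∉ Z) :
    (∑ ρ ∈ Z, k ρ * ∏ ρ' ∈ Z.erase ρ, (s - ρ')) / ∏ ρ ∈ Z, (s - ρ) =
      ∑ ρ ∈ Z, k ρ * (s - ρ)⁻¹ := by
  have hne : ∀ ρ ∈ Z, s - ρ ≠ 0 := fun ρ hρ h ↦ hs (sub_eq_zero.mp h ▸ hρ)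
  rw [Finset.sum_div]
  refine Finset.sum_congr rfl fun ρ hρ ↦ ?_
  have hprod : ∏ ρ' ∈ Z.erase ρ, (s - ρ') ≠ 0 :=
    Finset.prod_ne_zero_iff.mpr fun ρ' hρ' ↦ hne ρ' (Finset.mem_of_mem_erase hρ')
  rw [← Finset.mul_prod_erase Z _ hρ, mul_div_assoc, div_mul_cancel_right₀ hprod]

/- With `f = q ∏ (s - ρ)`, the numerator `g / q` minus its Lagrange interpolation polynomial at
the zeros of `f` vanishes at those zeros, hence is again divisible by `∏ (s - ρ)`. -/
lemma exists_div_eq_add_sum_mul_inv {f g : ℂ → ℂ} {U S : Set ℂ} (hU : IsOpen U)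
    (hSU : S ⊆ U) (hf : DifferentiableOn ℂ f U) (hg : DifferentiableOn ℂ g U) {Z : Finset ℂ}
    (hZ : ∀ ρ ∈ Z, ρ ∈ S ∧ f ρ = 0 ∧ deriv f ρ ≠ 0) (hS : ∀ s ∈ S, f s = 0 → s ∈ Z) :
    ∃ Q : ℂ → ℂ, DifferentiableOn ℂ Q S ∧ ∀ s, s ∉ Z →
      g s / f s = Q s + ∑ ρ ∈ Z, g ρ / deriv f ρ * (s - ρ)⁻¹ := by
  obtain ⟨q, hq, hfq⟩ := exists_eq_prod_sub_mul hU hf fun ρ hρ ↦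
    ⟨hSU (hZ ρ hρ).1, (hZ ρ hρ).2.1⟩
  have hderiv : ∀ ρ ∈ Z, deriv f ρ = (∏ ρ' ∈ Z.erase ρ, (ρ - ρ')) * q ρ := fun ρ hρ ↦
    deriv_eq_prod_erase_mul (hq.differentiableAt (hU.mem_nhds (hSU (hZ ρ hρ).1))) hfq hρ
  have hq0 : ∀ s ∈ S, q s ≠ 0 := fun s hs h0 ↦ by
    have hsZ := hS s hs (by rw [hfq s, h0, mul_zero])
    exact (hZ s hsZ).2.2 (by rw [hderiv s hsZ, h0, mul_zero])
  set V : Set ℂ := U ∩ q ⁻¹' {0}ᶜ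
  have hV : IsOpen V := hq.continuousOn.isOpen_inter_preimage hU isOpen_compl_singleton
  have hSV : S ⊆ V := fun s hs ↦ ⟨hSU hs, hq0 s hs⟩
  set k : ℂ → ℂ := fun ρ ↦ g ρ / deriv f ρ
  set N : ℂ → ℂ := fun s ↦ g s / q s - ∑ ρ ∈ Z, k ρ * ∏ ρ' ∈ Z.erase ρ, (s - ρ')
  have hN : DifferentiableOn ℂ N V :=
    ((hg.mono inter_subset_left).div (hq.mono inter_subset_left) fun s hs ↦ hs.2).sub
      (by fun_prop)
  have hN0 : ∀ ρ ∈ Z, N ρ = 0 := fun ρ hρ ↦ by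
    have hprod : ∏ ρ' ∈ Z.erase ρ, (ρ - ρ') ≠ 0 := Finset.prod_ne_zero_iff.mpr fun ρ' hρ' ↦
      sub_ne_zero.mpr (Finset.ne_of_mem_erase hρ').symm
    have hqρ := hq0 ρ (hZ ρ hρ).1
    simp only [N, sum_mul_prod_erase_sub_self k hρ, k, hderiv ρ hρ]
    field_simp
    ring
  obtain ⟨Q, hQ, hNQ⟩ := exists_eq_prod_sub_mul hV hN fun ρ hρ ↦
    ⟨hSV (hZ ρ hρ).1, hN0 ρ hρ⟩
  refine ⟨Q, hQ.mono hSV, fun s hs ↦ ?_⟩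
  have hprod : ∏ ρ ∈ Z, (s - ρ) ≠ 0 := Finset.prod_ne_zero_iff.mpr fun ρ hρ h ↦
    hs (sub_eq_zero.mp h ▸ hρ)
  have hQs : Q s = N s / ∏ ρ ∈ Z, (s - ρ) := by rw [hNQ s, mul_div_cancel_left₀ _ hprod]
  rw [hQs, ← sum_mul_prod_erase_sub_div_prod k hs, ← add_div, sub_add_cancel, div_div, mul_comm,
    hfq s]

lemma rectIntegral_div_eq_sum {f g : ℂ → ℂ} {a b c d : ℝ} {U : Set ℂ} (hU : IsOpen U) (hab : a ≤ b)
    (hcd : c ≤ d) (hRU : Icc a b ×ℂ Icc c d ⊆ U) (hf : DifferentiableOn ℂ f U)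
    (hg : DifferentiableOn ℂ g U) {Z : Finset ℂ}
    (hZ : ∀ ρ ∈ Z, f ρ = 0 ∧ deriv f ρ ≠ 0 ∧ a < ρ.re ∧ ρ.re < b ∧ c < ρ.im ∧ ρ.im < d)
    (hZ' : ∀ s ∈ Icc a b ×ℂ Icc c d, f s = 0 → s ∈ Z) :
    rectIntegral (fun s ↦ g s / f s) a b c d = 2 * Real.pi * I * ∑ ρ ∈ Z, g ρ / deriv f ρ := by
  obtain ⟨Q, hQ, hdiv⟩ := exists_div_eq_add_sum_mul_inv hU hRU hf hg (fun ρ hρ ↦ by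
    obtain ⟨h0, h0', ha, hb, hc, hd⟩ := hZ ρ hρ
    exact ⟨⟨⟨ha.le, hb.le⟩, ⟨hc.le, hd.le⟩⟩, h0, h0'⟩) hZ'
  have hbd : rectBoundary a b c d ⊆ Icc a b ×ℂ Icc c d := fun s hs ↦ ⟨hs.1, hs.2.1⟩
  have hbdZ : ∀ s ∈ rectBoundary a b c d, s ∉ Z := fun s hs hsZ ↦ by
    obtain ⟨_, _, ha, hb, hc, hd⟩ := hZ s hsZ
    rcases hs.2.2 with h | h | h | h <;> linarith
  have hcont : ∀ ρ ∈ Z,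
      ContinuousOn (fun s ↦ g ρ / deriv f ρ * (s - ρ)⁻¹) (rectBoundary a b c d) := fun ρ hρ ↦
    continuousOn_const.mul (ContinuousOn.inv₀ (by fun_prop) fun s hs h ↦
      hbdZ s hs (sub_eq_zero.mp h ▸ hρ))
  rw [rectIntegral_congr hab hcd fun s hs ↦ hdiv s (hbdZ s hs), rectIntegral_add hab hcd
    (hQ.continuousOn.mono hbd) (continuousOn_finsetSum _ hcont), rectIntegral_eq_zero hab hcd hQ,
    rectIntegral_sum Z hab hcd hcont, zero_add, Finset.mul_sum]
  refine Finset.sum_congr rfl fun ρ hρ ↦ ?_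
  obtain ⟨_, _, ha, hb, hc, hd⟩ := hZ ρ hρ
  rw [rectIntegral_const_mul, rectIntegral_inv_sub ha hb hc hd]
  ring

/-! ### The zeta function on the line `Re s = -2` -/

lemma sq_norm_Gamma_one_sub_mul_I {t : ℝ} (ht : 0 < t) :
    ‖Gamma (1 - t * I)‖ ^ 2 = Real.pi * t / Real.sinh (Real.pi * t) := by
  have hsinh : (Real.sinh (Real.pi * t) : ℂ) ≠ 0 := by
    exact_mod_cast (Real.sinh_pos_iff.mpr (by positivity)).ne'
  have hconj : Gamma (t * I + 1) = (starRingEnd ℂ) (Gamma (1 - t * I)) := by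
    rw [← Gamma_conj]
    simp [add_comm]
  have hsin : sin (Real.pi * (t * I)) = (Real.sinh (Real.pi * t) : ℂ) * I := by
    rw [← mul_assoc, sin_mul_I]
    push_cast
    rfl
  have hnorm : ((‖Gamma (1 - t * I)‖ ^ 2 : ℝ) : ℂ) =
      (Real.pi * t / Real.sinh (Real.pi * t) : ℝ) := by
    calc ((‖Gamma (1 - t * I)‖ ^ 2 : ℝ) : ℂ)
        = Gamma (1 - t * I) * (t * I * Gamma (t * I)) := by
          rw [← normSq_eq_norm_sq, ← mul_conj, ← hconj,
            Gamma_add_one _ (mul_ne_zero (ofReal_ne_zero.mpr ht.ne') I_ne_zero)]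
      _ = t * I * (Gamma (t * I) * Gamma (1 - t * I)) := by ring
      _ = (Real.pi * t / Real.sinh (Real.pi * t) : ℝ) := by
          rw [Gamma_mul_Gamma_one_sub, hsin]
          push_cast at hsinh ⊢
          field_simp [I_ne_zero]
  exact_mod_cast hnorm

lemma sq_norm_cos_pi_mul_three_sub_div_two (t : ℝ) :
    ‖cos (Real.pi * (3 - t * I) / 2)‖ ^ 2 = Real.sinh (Real.pi * t / 2) ^ 2 := by
  have hcos : cos (Real.pi * (3 - t * I) / 2) = -((Real.sinh (Real.pi * t / 2) : ℂ) * I) := by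
    rw [show (Real.pi * (3 - t * I) / 2 : ℂ) =
        Real.pi / 2 - ((Real.pi * t / 2 : ℝ) : ℂ) * I + Real.pi by push_cast; ring,
      cos_add_pi, cos_pi_div_two_sub, sin_mul_I, ofReal_sinh]
  rw [hcos, norm_neg, norm_mul, norm_I, mul_one, norm_real, Real.norm_eq_abs, sq_abs]

lemma cosh_le_two_mul_sinh {x : ℝ} (hx : 1 ≤ x) : Real.cosh x ≤ 2 * Real.sinh x := by
  have hpos : 1 + x ≤ Real.exp x := by linarith [Real.add_one_le_exp x]
  have hneg : Real.exp (-x) ≤ 1 / 2 := by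
    rw [Real.exp_neg, ← one_div]
    exact one_div_le_one_div_of_le two_pos (by linarith)
  rw [Real.cosh_eq, Real.sinh_eq]
  linarith

lemma div_two_le_sq_norm_cos_mul_sq_norm_Gamma {t : ℝ} (ht : 1 ≤ t) :
    t / 2 ≤ ‖cos (Real.pi * (3 - t * I) / 2)‖ ^ 2 * ‖Gamma (1 - t * I)‖ ^ 2 := by
  set x := Real.pi * t / 2 with hx
  have hxt : t ≤ x := by nlinarith [Real.pi_gt_three]
  have hsinh : 0 < Real.sinh x := Real.sinh_pos_iff.mpr (by linarith)
  have hcosh : 0 < Real.cosh x := Real.cosh_pos x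
  have htanh : 1 / 2 ≤ Real.sinh x / Real.cosh x := by
    rw [le_div_iff₀ hcosh]
    linarith [cosh_le_two_mul_sinh (ht.trans hxt)]
  rw [sq_norm_cos_pi_mul_three_sub_div_two, sq_norm_Gamma_one_sub_mul_I (one_pos.trans_le ht),
    show Real.pi * t = 2 * x by rw [hx]; ring, Real.sinh_two_mul,
    mul_div_cancel_left₀ _ two_ne_zero]
  calc t / 2 ≤ x * (Real.sinh x / Real.cosh x) := by nlinarith
    _ = Real.sinh x ^ 2 * (2 * x / (2 * Real.sinh x * Real.cosh x)) := by field_simp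

lemma sq_le_sq_norm_sub_mul_I (x t : ℝ) : t ^ 2 ≤ ‖(x - t * I : ℂ)‖ ^ 2 := by
  rw [← sq_abs t]
  gcongr
  simpa using abs_im_le_norm (x - t * I : ℂ)

lemma pow_four_mul_le_sq_norm_Gamma_three_sub {t : ℝ} (ht : t ≠ 0) :
    t ^ 4 * ‖Gamma (1 - t * I)‖ ^ 2 ≤ ‖Gamma (3 - t * I)‖ ^ 2 := by
  have hne (x : ℝ) : (x - t * I : ℂ) ≠ 0 := fun h ↦ ht (by simpa using congrArg im h)
  have hone : Gamma (2 - t * I) = (1 - t * I) * Gamma (1 - t * I) := by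
    rw [← Gamma_add_one _ (by simpa using hne 1)]
    ring_nf
  have htwo : Gamma (3 - t * I) = (2 - t * I) * Gamma (2 - t * I) := by
    rw [← Gamma_add_one _ (by simpa using hne 2)]
    ring_nf
  have h1 := sq_le_sq_norm_sub_mul_I 1 t
  have h2 := sq_le_sq_norm_sub_mul_I 2 t
  push_cast at h1 h2
  rw [htwo, hone, norm_mul, norm_mul, mul_pow, mul_pow, ← mul_assoc,
    show t ^ 4 = t ^ 2 * t ^ 2 by ring]
  gcongr

lemma exists_mul_pow_five_le_sq_norm_riemannZeta : ∃ k : ℝ, 0 < k ∧ ∀ t : ℝ, 1 ≤ t →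
    k * t ^ 5 ≤ ‖riemannZeta (-2 + t * I)‖ ^ 2 := by
  refine ⟨4 * ((2 * Real.pi) ^ (-3 : ℝ)) ^ 2 * (1 / 2) * (1 / 2) ^ 2, by positivity,
    fun t ht ↦ ?_⟩
  have ht0 : t ≠ 0 := (one_pos.trans_le ht).ne'
  set s : ℂ := 3 - t * I with hs
  have hsre : s.re = 3 := by simp [hs]
  have hsim : s.im ≠ 0 := by simpa [hs] using ht0
  have hfe : riemannZeta (-2 + t * I) =
      2 * (2 * Real.pi) ^ (-s) * Gamma s * cos (Real.pi * s / 2) * riemannZeta s := by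
    rw [← riemannZeta_one_sub (s := s) (fun n h ↦ hsim (by simp [h])) (fun h ↦ hsim (by simp [h]))]
    congr 1
    rw [hs]
    ring
  have hpow : ‖(2 * (Real.pi : ℂ)) ^ (-s)‖ = (2 * Real.pi) ^ (-3 : ℝ) := by
    rw [show 2 * (Real.pi : ℂ) = ((2 * Real.pi : ℝ) : ℂ) by push_cast; ring,
      norm_cpow_eq_rpow_re_of_pos Real.two_pi_pos, neg_re, hsre]
  have hζ : 1 / 2 ≤ ‖riemannZeta s‖ := half_le_norm_riemannZeta (by rw [hsre]; norm_num)
  have hΓcos : t ^ 4 * (t / 2) ≤ ‖Gamma s‖ ^ 2 * ‖cos (Real.pi * s / 2)‖ ^ 2 :=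
    calc t ^ 4 * (t / 2)
        ≤ t ^ 4 * (‖cos (Real.pi * s / 2)‖ ^ 2 * ‖Gamma (1 - t * I)‖ ^ 2) := by
          gcongr
          exact div_two_le_sq_norm_cos_mul_sq_norm_Gamma ht
      _ = t ^ 4 * ‖Gamma (1 - t * I)‖ ^ 2 * ‖cos (Real.pi * s / 2)‖ ^ 2 := by ring
      _ ≤ ‖Gamma s‖ ^ 2 * ‖cos (Real.pi * s / 2)‖ ^ 2 := by
          gcongr
          exact pow_four_mul_le_sq_norm_Gamma_three_sub ht0
  rw [hfe]
  simp only [norm_mul, mul_pow, norm_ofNat]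
  rw [hpow]
  calc 4 * ((2 * Real.pi) ^ (-3 : ℝ)) ^ 2 * (1 / 2) * (1 / 2) ^ 2 * t ^ 5
      = 2 ^ 2 * ((2 * Real.pi) ^ (-3 : ℝ)) ^ 2 * (t ^ 4 * (t / 2)) * (1 / 2) ^ 2 := by ring
    _ ≤ 2 ^ 2 * ((2 * Real.pi) ^ (-3 : ℝ)) ^ 2 *
        (‖Gamma s‖ ^ 2 * ‖cos (Real.pi * s / 2)‖ ^ 2) * ‖riemannZeta s‖ ^ 2 := by gcongr
    _ = _ := by ring

/-! ### Mean values with a Gaussian weight -/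

lemma integrable_cexp_gaussian {β : ℝ} (hβ : 0 < β) (T μ : ℝ) :
    Integrable fun u : ℝ ↦ exp (-β * (u - T) ^ 2 + μ * u * I) := by
  have h := integrable_cexp_quadratic (b := (β : ℂ)) (by simpa) (2 * β * T + μ * I) (-β * T ^ 2)
  refine h.congr (Eventually.of_forall fun u ↦ ?_)
  dsimp only
  congr 1
  ring

lemma integral_cexp_gaussian {β : ℝ} (hβ : 0 < β) (T μ : ℝ) :
    ∫ u : ℝ, exp (-β * (u - T) ^ 2 + μ * u * I) =
      (Real.sqrt (Real.pi / β) : ℂ) * exp (μ * T * I - μ ^ 2 / (4 * β)) := by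
  have h := integral_cexp_quadratic (b := (-β : ℂ)) (by simpa) (2 * β * T + μ * I) (-β * T ^ 2)
  have hβ' : (β : ℂ) ≠ 0 := by exact_mod_cast hβ.ne'
  have hexp (u : ℝ) : (-β * u ^ 2 + (2 * β * T + μ * I) * u + -β * T ^ 2 : ℂ) =
      -β * (u - T) ^ 2 + μ * u * I := by ring
  simp only [hexp] at h
  rw [h]
  congr 1
  · rw [neg_neg, Real.sqrt_eq_rpow, ofReal_cpow (by positivity)]
    push_cast
    rfl
  · congr 1
    field_simp
    ring_nf
    rw [I_sq]
    ring

lemma integral_gaussian_sub (β T : ℝ) :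
    ∫ u : ℝ, Real.exp (-β * (u - T) ^ 2) = Real.sqrt (Real.pi / β) := by
  rw [← integral_gaussian]
  exact integral_sub_right_eq_self (fun u : ℝ ↦ Real.exp (-β * u ^ 2)) T

lemma integrable_gaussian_sub {β : ℝ} (hβ : 0 < β) (T : ℝ) :
    Integrable fun u : ℝ ↦ Real.exp (-β * (u - T) ^ 2) :=
  (integrable_exp_neg_mul_sq hβ).comp_sub_right T

section

variable {ι : Type*} (S : Finset ι) (a l : ι → ℝ)

/-- The trigonometric polynomial with real coefficients `a i` and real frequencies `-l i`, the sign
being the one that makes `∑ a n * n ^ (-iu)` the case `l n = log n`. -/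
noncomputable def trigPoly (u : ℝ) : ℂ :=
  ∑ i ∈ S, (a i : ℂ) * exp (-(l i * u * I))

@[fun_prop]
lemma continuous_trigPoly : Continuous (trigPoly S a l) := by
  unfold trigPoly
  fun_prop

lemma sq_norm_trigPoly_mul_gaussian (β T u : ℝ) :
    ((‖trigPoly S a l u‖ ^ 2 * Real.exp (-β * (u - T) ^ 2) : ℝ) : ℂ) =
      ∑ i ∈ S, ∑ j ∈ S, (a i * a j : ℂ) * exp (-β * (u - T) ^ 2 + (l j - l i : ℝ) * u * I) := by
  have hnorm := mul_conj (trigPoly S a l u)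
  rw [normSq_eq_norm_sq] at hnorm
  push_cast at hnorm ⊢
  rw [← hnorm]
  simp only [trigPoly, map_sum, map_mul, conj_ofReal, ← exp_conj, map_neg, conj_I]
  rw [Finset.sum_mul_sum, Finset.sum_mul]
  refine Finset.sum_congr rfl fun i _ ↦ ?_
  rw [Finset.sum_mul]
  refine Finset.sum_congr rfl fun j _ ↦ ?_
  have hexp : exp (-β * (u - T) ^ 2 + (l j - l i) * u * I) =
      exp (-(l i * u * I)) * exp (-(l j * u * -I)) * exp (-β * (u - T) ^ 2) := by
    rw [← exp_add, ← exp_add]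
    congr 1
    ring
  rw [hexp]
  ring

lemma integrable_sq_norm_trigPoly_mul_gaussian {β : ℝ} (hβ : 0 < β) (T : ℝ) :
    Integrable fun u : ℝ ↦ ‖trigPoly S a l u‖ ^ 2 * Real.exp (-β * (u - T) ^ 2) := by
  have h : Integrable fun u : ℝ ↦ ∑ i ∈ S, ∑ j ∈ S, (a i * a j : ℂ) *
      exp (-β * (u - T) ^ 2 + (l j - l i : ℝ) * u * I) :=
    integrable_finsetSum _ fun i _ ↦ integrable_finsetSum _ fun j _ ↦
      (integrable_cexp_gaussian hβ T _).const_mul _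
  simp only [← sq_norm_trigPoly_mul_gaussian] at h
  simpa only [RCLike.re_to_complex, ofReal_re] using h.re

lemma integral_sq_norm_trigPoly_mul_gaussian {β : ℝ} (hβ : 0 < β) (T : ℝ) :
    ((∫ u : ℝ, ‖trigPoly S a l u‖ ^ 2 * Real.exp (-β * (u - T) ^ 2) : ℝ) : ℂ) =
      ∑ i ∈ S, ∑ j ∈ S, (a i * a j : ℂ) * ((Real.sqrt (Real.pi / β) : ℂ) *
        exp ((l j - l i : ℝ) * T * I - (l j - l i : ℝ) ^ 2 / (4 * β))) := by
  rw [← integral_complex_ofReal]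
  simp only [sq_norm_trigPoly_mul_gaussian]
  rw [integral_finsetSum _ fun i _ ↦ integrable_finsetSum _ fun j _ ↦
    (integrable_cexp_gaussian hβ T _).const_mul _]
  refine Finset.sum_congr rfl fun i _ ↦ ?_
  rw [integral_finsetSum _ fun j _ ↦ (integrable_cexp_gaussian hβ T _).const_mul _]
  refine Finset.sum_congr rfl fun j _ ↦ ?_
  rw [integral_const_mul, integral_cexp_gaussian hβ]

lemma norm_mul_cexp_gaussian (x y β T μ : ℝ) :
    ‖(x * y : ℂ) * ((Real.sqrt (Real.pi / β) : ℂ) * exp (μ * T * I - μ ^ 2 / (4 * β)))‖ =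
      Real.sqrt (Real.pi / β) * (|x * y| * Real.exp (-(μ ^ 2 / (4 * β)))) := by
  have hre : (μ * T * I - μ ^ 2 / (4 * β) : ℂ).re = -(μ ^ 2 / (4 * β)) := by
    rw [show (μ * T * I - μ ^ 2 / (4 * β) : ℂ) =
      ((-(μ ^ 2 / (4 * β)) : ℝ) : ℂ) + ((μ * T : ℝ) : ℂ) * I by push_cast; ring,
      add_re, ofReal_re, re_ofReal_mul, I_re, mul_zero, add_zero]
  rw [← ofReal_mul, norm_mul, norm_mul, norm_exp, norm_real, norm_real, Real.norm_eq_abs,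
    Real.norm_eq_abs, abs_of_nonneg (Real.sqrt_nonneg _), hre]
  ring

lemma abs_mul_mul_exp_le [DecidableEq ι] {β δ : ℝ} (hβ : 0 ≤ β) (hδ : 0 ≤ δ) {i j : ι}
    (hl : i ≠ j → δ ≤ |l i - l j|) :
    |a i * a j| * Real.exp (-((l j - l i) ^ 2 / (4 * β))) ≤
      (if i = j then a i ^ 2 else 0) +
        Real.exp (-(δ ^ 2 / (4 * β))) * ((a i ^ 2 + a j ^ 2) / 2) := by
  split_ifs with h
  · subst h
    simp only [sub_self, ne_eq, OfNat.ofNat_ne_zero, not_false_eq_true, zero_pow, zero_div,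
      neg_zero, Real.exp_zero, mul_one, ← sq, abs_sq]
    exact le_add_of_nonneg_right (by positivity)
  · have hprod : |a i * a j| ≤ (a i ^ 2 + a j ^ 2) / 2 := by
      rw [abs_le]
      constructor <;> nlinarith [sq_nonneg (a i + a j), sq_nonneg (a i - a j)]
    have hexp : Real.exp (-((l j - l i) ^ 2 / (4 * β))) ≤ Real.exp (-(δ ^ 2 / (4 * β))) := by
      rw [Real.exp_le_exp, neg_le_neg_iff, ← sq_abs (l j - l i), abs_sub_comm]
      gcongr
      exact hl h
    rw [zero_add, mul_comm (Real.exp (-(δ ^ 2 / (4 * β))))]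
    gcongr

lemma integral_sq_norm_trigPoly_mul_gaussian_le {β δ : ℝ} (hβ : 0 < β) (hδ : 0 ≤ δ) (T : ℝ)
    (hl : ∀ i ∈ S, ∀ j ∈ S, i ≠ j → δ ≤ |l i - l j|) :
    ∫ u : ℝ, ‖trigPoly S a l u‖ ^ 2 * Real.exp (-β * (u - T) ^ 2) ≤
      Real.sqrt (Real.pi / β) * (1 + S.card * Real.exp (-(δ ^ 2 / (4 * β)))) *
        ∑ i ∈ S, a i ^ 2 := by
  classical
  refine (le_abs_self _).trans ?_
  rw [← Real.norm_eq_abs, ← norm_real, integral_sq_norm_trigPoly_mul_gaussian S a l hβ T]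
  calc _ ≤ ∑ i ∈ S, ∑ j ∈ S, Real.sqrt (Real.pi / β) * ((if i = j then a i ^ 2 else 0) +
        Real.exp (-(δ ^ 2 / (4 * β))) * ((a i ^ 2 + a j ^ 2) / 2)) := by
        refine (norm_sum_le _ _).trans (Finset.sum_le_sum fun i hi ↦ ?_)
        refine (norm_sum_le _ _).trans (Finset.sum_le_sum fun j hj ↦ ?_)
        rw [norm_mul_cexp_gaussian]
        gcongr
        exact abs_mul_mul_exp_le a l hβ.le hδ (hl i hi j hj)
    _ = _ := by
        simp only [← Finset.mul_sum, Finset.sum_add_distrib, Finset.sum_ite_eq, ← Finset.sum_div,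
          Finset.sum_const, nsmul_eq_mul, Finset.sum_ite_mem, Finset.inter_self]
        ring

end

lemma abs_integral_le_integral_abs_of_mem_Icc {f : ℝ → ℝ} (hf : Continuous f) {a b x y : ℝ}
    (hx : x ∈ Icc a b) (hy : y ∈ Icc a b) : |∫ v in x..y, f v| ≤ ∫ v in a..b, |f v| := by
  have hab : a ≤ b := hx.1.trans hx.2
  have hnonneg : 0 ≤ ∫ v in a..b, |f v| :=
    intervalIntegral.integral_nonneg hab fun v _ ↦ abs_nonneg (f v)
  refine (intervalIntegral.norm_integral_le_abs_integral_norm (f := f)).trans ?_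
  simp only [Real.norm_eq_abs]
  rw [← abs_of_nonneg hnonneg]
  refine intervalIntegral.abs_integral_mono_interval ?_
    (Eventually.of_forall fun v ↦ abs_nonneg _) (hf.abs.intervalIntegrable _ _)
  refine uIoc_subset_uIoc_of_uIcc_subset_uIcc ?_
  rw [uIcc_of_le hab]
  exact uIcc_subset_Icc hx hy

lemma le_integral_add_abs_of_hasDerivAt {φ φ' : ℝ → ℝ} (hφ : ∀ u, HasDerivAt φ (φ' u) u)
    (hφ' : Continuous φ') (γ : ℝ) :
    φ γ ≤ ∫ u in (γ - 1 / 2)..(γ + 1 / 2), (φ u + |φ' u|) := by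
  have hφc : Continuous φ := continuous_iff_continuousAt.mpr fun u ↦ (hφ u).continuousAt
  set A := ∫ v in (γ - 1 / 2)..(γ + 1 / 2), |φ' v|
  have hpoint : ∀ u ∈ Icc (γ - 1 / 2) (γ + 1 / 2), φ γ ≤ φ u + A := fun u hu ↦ by
    have hFTC : ∫ v in u..γ, φ' v = φ γ - φ u :=
      intervalIntegral.integral_eq_sub_of_hasDerivAt (fun v _ ↦ hφ v)
        (hφ'.intervalIntegrable _ _)
    have hle := abs_integral_le_integral_abs_of_mem_Icc hφ' hu
      (show γ ∈ Icc (γ - 1 / 2) (γ + 1 / 2) from ⟨by linarith, by linarith⟩)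
    linarith [le_abs_self (∫ v in u..γ, φ' v)]
  have hmean : ∫ _u in (γ - 1 / 2)..(γ + 1 / 2), φ γ ≤
      ∫ u in (γ - 1 / 2)..(γ + 1 / 2), (φ u + A) :=
    intervalIntegral.integral_mono_on (by linarith) (by simp)
      ((hφc.add continuous_const).intervalIntegrable _ _) hpoint
  rw [intervalIntegral.integral_add (hφc.intervalIntegrable _ _) (by simp)] at hmean
  rw [intervalIntegral.integral_add (hφc.intervalIntegrable _ _) (hφ'.abs.intervalIntegrable _ _)]
  simp only [intervalIntegral.integral_const, smul_eq_mul] at hmean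
  norm_num at hmean
  norm_num
  linarith

/-! ### The large sieve at zeta zeros -/

section

variable {ι : Type*} (S : Finset ι) (a l : ι → ℝ)

lemma hasDerivAt_trigPoly (u : ℝ) :
    HasDerivAt (trigPoly S a l) (-I * trigPoly S (fun i ↦ a i * l i) l u) u := by
  unfold trigPoly
  rw [Finset.mul_sum]
  refine HasDerivAt.fun_sum fun i _ ↦ ?_
  have hphase : HasDerivAt (fun u : ℝ ↦ (-(l i * u * I) : ℂ)) (-(l i * I)) u := by
    simpa using (((ofRealCLM.hasDerivAt (x := u)).const_mul (l i : ℂ)).mul_const I).fun_neg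
  refine (hphase.cexp.const_mul (a i : ℂ)).congr_deriv ?_
  push_cast
  ring

lemma sq_norm_trigPoly_le_integral (γ : ℝ) :
    ‖trigPoly S a l γ‖ ^ 2 ≤ ∫ u in (γ - 1 / 2)..(γ + 1 / 2),
      (2 * ‖trigPoly S a l u‖ ^ 2 + ‖trigPoly S (fun i ↦ a i * l i) l u‖ ^ 2) := by
  set F := trigPoly S a l
  set G := trigPoly S (fun i ↦ a i * l i) l
  have hF : Continuous F := continuous_trigPoly S a l
  have hG : Continuous G := continuous_trigPoly S _ l
  have hderiv (u : ℝ) : HasDerivAt (fun u ↦ ‖F u‖ ^ 2) (2 * inner ℝ (F u) (-I * G u)) u :=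
    (hasDerivAt_trigPoly S a l u).norm_sq
  refine (le_integral_add_abs_of_hasDerivAt hderiv (by fun_prop) γ).trans ?_
  refine intervalIntegral.integral_mono_on (by linarith)
    (Continuous.intervalIntegrable (by fun_prop) _ _)
    (Continuous.intervalIntegrable (by fun_prop) _ _) fun u _ ↦ ?_
  have hinner := abs_real_inner_le_norm (F u) (-I * G u)
  rw [norm_mul, norm_neg, norm_I, one_mul] at hinner
  rw [abs_mul, abs_two]
  nlinarith [sq_nonneg (‖F u‖ - ‖G u‖)]

lemma exp_gaussian_le_of_abs_sub_le {β : ℝ} (hβ : 0 ≤ β) (hβ1 : β ≤ 1) (T : ℝ) {u γ : ℝ}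
    (hu : |u - γ| ≤ 1 / 2) :
    Real.exp (-(2 * β) * (γ - T) ^ 2) ≤ 2 * Real.exp (-β * (u - T) ^ 2) := by
  have hsq : (u - T) ^ 2 ≤ 2 * (γ - T) ^ 2 + 1 / 2 := by
    have : (u - γ) ^ 2 ≤ 1 / 4 := by nlinarith [abs_le.mp hu]
    nlinarith [sq_nonneg (u - γ - (γ - T))]
  have hexp : Real.exp (1 / 2) ≤ 2 := by
    have : Real.exp (1 / 2) ^ 2 = Real.exp 1 := by
      rw [← Real.exp_nat_mul]
      norm_num
    nlinarith [Real.exp_one_lt_d9, Real.exp_pos (1 / 2)]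
  calc Real.exp (-(2 * β) * (γ - T) ^ 2) ≤ Real.exp (1 / 2 + -β * (u - T) ^ 2) := by
        rw [Real.exp_le_exp]
        nlinarith
    _ ≤ 2 * Real.exp (-β * (u - T) ^ 2) := by
        rw [Real.exp_add]
        gcongr

lemma gaussian_mul_sq_norm_trigPoly_le_integral {β : ℝ} (hβ : 0 ≤ β) (hβ1 : β ≤ 1) (T γ : ℝ) :
    Real.exp (-(2 * β) * (γ - T) ^ 2) * ‖trigPoly S a l γ‖ ^ 2 ≤
      ∫ u in (γ - 1 / 2)..(γ + 1 / 2), 2 * (2 * (‖trigPoly S a l u‖ ^ 2 *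
        Real.exp (-β * (u - T) ^ 2)) + ‖trigPoly S (fun i ↦ a i * l i) l u‖ ^ 2 *
          Real.exp (-β * (u - T) ^ 2)) := by
  refine (mul_le_mul_of_nonneg_left (sq_norm_trigPoly_le_integral S a l γ)
    (Real.exp_pos _).le).trans ?_
  rw [← intervalIntegral.integral_const_mul]
  refine intervalIntegral.integral_mono_on (by linarith)
    (Continuous.intervalIntegrable (by fun_prop) _ _)
    (Continuous.intervalIntegrable (by fun_prop) _ _) fun u hu ↦ ?_
  have hu' : |u - γ| ≤ 1 / 2 := abs_le.mpr ⟨by linarith [hu.1], by linarith [hu.2]⟩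
  refine (mul_le_mul_of_nonneg_right (exp_gaussian_le_of_abs_sub_le hβ hβ1 T hu')
    (by positivity)).trans_eq ?_
  ring

lemma sum_integral_le_of_card_le (Z : Finset ℝ) {M : ℝ}
    (hZ : ∀ u : ℝ, (({γ ∈ Z | |γ - u| ≤ 1 / 2} : Finset ℝ).card : ℝ) ≤ M) {Ψ : ℝ → ℝ}
    (hΨ : Integrable Ψ) (hΨ0 : ∀ u, 0 ≤ Ψ u) :
    ∑ γ ∈ Z, ∫ u in (γ - 1 / 2)..(γ + 1 / 2), Ψ u ≤ M * ∫ u, Ψ u := by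
  have hindicator : ∀ γ ∈ Z, ∫ u in (γ - 1 / 2)..(γ + 1 / 2), Ψ u =
      ∫ u, (Ioc (γ - 1 / 2) (γ + 1 / 2)).indicator Ψ u := fun γ _ ↦ by
    rw [intervalIntegral.integral_of_le (by linarith), integral_indicator measurableSet_Ioc]
  rw [Finset.sum_congr rfl hindicator,
    ← integral_finsetSum _ fun γ _ ↦ hΨ.indicator measurableSet_Ioc, ← integral_const_mul]
  refine integral_mono (integrable_finsetSum _ fun γ _ ↦ hΨ.indicator measurableSet_Ioc)
    (hΨ.const_mul M) fun u ↦ ?_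
  simp only [indicator_apply]
  rw [← Finset.sum_filter, Finset.sum_const, nsmul_eq_mul]
  refine mul_le_mul_of_nonneg_right (le_trans ?_ (hZ u)) (hΨ0 u)
  refine Nat.cast_le.mpr (Finset.card_le_card fun γ hγ ↦ ?_)
  rw [Finset.mem_filter] at hγ ⊢
  refine ⟨hγ.1, abs_le.mpr ⟨?_, ?_⟩⟩ <;> linarith [hγ.2.1, hγ.2.2]

lemma sum_gaussian_mul_sq_norm_trigPoly_le {β T M : ℝ} (hβ : 0 < β) (hβ1 : β ≤ 1) (Z : Finset ℝ)
    (hZ : ∀ u : ℝ, (({γ ∈ Z | |γ - u| ≤ 1 / 2} : Finset ℝ).card : ℝ) ≤ M) :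
    ∑ γ ∈ Z, Real.exp (-(2 * β) * (γ - T) ^ 2) * ‖trigPoly S a l γ‖ ^ 2 ≤
      2 * M * (2 * ∫ u, ‖trigPoly S a l u‖ ^ 2 * Real.exp (-β * (u - T) ^ 2)) +
      2 * M * ∫ u, ‖trigPoly S (fun i ↦ a i * l i) l u‖ ^ 2 * Real.exp (-β * (u - T) ^ 2) := by
  have hF := integrable_sq_norm_trigPoly_mul_gaussian S a l hβ T
  have hG := integrable_sq_norm_trigPoly_mul_gaussian S (fun i ↦ a i * l i) l hβ T
  refine (Finset.sum_le_sum fun γ _ ↦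
    gaussian_mul_sq_norm_trigPoly_le_integral S a l hβ.le hβ1 T γ).trans ?_
  have hsum : Integrable fun u ↦ 2 * (2 * (‖trigPoly S a l u‖ ^ 2 *
      Real.exp (-β * (u - T) ^ 2)) + ‖trigPoly S (fun i ↦ a i * l i) l u‖ ^ 2 *
        Real.exp (-β * (u - T) ^ 2)) := ((hF.const_mul 2).add hG).const_mul 2
  refine (sum_integral_le_of_card_le Z hZ hsum fun u ↦ by positivity).trans_eq ?_
  rw [integral_const_mul, integral_add (hF.const_mul 2) hG, integral_const_mul]
  ring

end

lemma one_div_le_log_sub_log_of_lt {m n : ℕ} (hm : 0 < m) (hmn : m < n) :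
    1 / (n : ℝ) ≤ Real.log n - Real.log m := by
  have hm' : (0 : ℝ) < m := Nat.cast_pos.mpr hm
  have hmn' : (m : ℝ) + 1 ≤ n := by exact_mod_cast hmn
  have hn' : (0 : ℝ) < n := by linarith
  rw [← Real.log_div hn'.ne' hm'.ne']
  refine le_trans ?_ (Real.one_sub_inv_le_log_of_pos (div_pos hn' hm'))
  rw [inv_div, one_sub_div hn'.ne']
  gcongr
  linarith

lemma one_div_le_abs_log_sub_log {N m n : ℕ} (hm : 0 < m) (hn : 0 < n) (hmN : m ≤ N)
    (hmn : m ≠ n) : 1 / (2 * N : ℝ) ≤ |Real.log m - Real.log n| := by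
  have hm1 : (1 : ℝ) ≤ m := Nat.one_le_cast.mpr hm
  have hmN' : (m : ℝ) ≤ N := Nat.cast_le.mpr hmN
  rcases hmn.lt_or_gt with hlt | hgt
  · have hn' : (m : ℝ) + 1 ≤ n := by exact_mod_cast hlt
    have hsucc := one_div_le_log_sub_log_of_lt hm (Nat.lt_add_one m)
    push_cast at hsucc
    rw [abs_sub_comm]
    refine le_trans ?_ ((hsucc.trans ?_).trans (le_abs_self _))
    · gcongr
      linarith
    · gcongr
  · refine le_trans ?_ ((one_div_le_log_sub_log_of_lt hn hgt).trans (le_abs_self _))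
    gcongr
    linarith

/-- The resonator `u ↦ ∑ n ≤ N, r n * n ^ (-iu)`, a Dirichlet polynomial on a vertical line. -/
noncomputable def resonator (r : ℕ → ℝ) (N : ℕ) : ℝ → ℂ :=
  trigPoly (Finset.Icc 1 N) r fun n ↦ Real.log n

lemma integral_sq_norm_resonator_mul_gaussian_le (r : ℕ → ℝ) {N : ℕ} {H : ℝ} (T : ℝ) (hH : 0 < H)
    (hN : N * Real.exp (-(H / N) ^ 2 / 4) ≤ 1) :
    ∫ u : ℝ, ‖resonator r N u‖ ^ 2 * Real.exp (-(1 / (4 * H ^ 2)) * (u - T) ^ 2) ≤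
      8 * H * ∑ n ∈ Finset.Icc 1 N, r n ^ 2 := by
  refine (integral_sq_norm_trigPoly_mul_gaussian_le (Finset.Icc 1 N) r (fun n ↦ Real.log n)
    (by positivity) (δ := 1 / (2 * N)) (by positivity) T fun m hm n hn hmn ↦
      one_div_le_abs_log_sub_log (Finset.mem_Icc.mp hm).1 (Finset.mem_Icc.mp hn).1
        (Finset.mem_Icc.mp hm).2 hmn).trans ?_
  have hsqrt : Real.sqrt (Real.pi / (1 / (4 * H ^ 2))) ≤ 4 * H := by
    rw [Real.sqrt_le_left (by positivity), div_div_eq_mul_div, div_one]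
    nlinarith [Real.pi_lt_four, sq_nonneg H]
  have hoff : 1 + ((Finset.Icc 1 N).card : ℝ) *
      Real.exp (-((1 / (2 * N) : ℝ) ^ 2 / (4 * (1 / (4 * H ^ 2))))) ≤ 2 := by
    rw [Nat.card_Icc, Nat.add_sub_cancel,
      show -((1 / (2 * N) : ℝ) ^ 2 / (4 * (1 / (4 * H ^ 2)))) = -(H / N) ^ 2 / 4 by
        field_simp
        norm_num]
    linarith
  calc _ ≤ 4 * H * 2 * ∑ n ∈ Finset.Icc 1 N, r n ^ 2 := by gcongr
    _ = 8 * H * ∑ n ∈ Finset.Icc 1 N, r n ^ 2 := by ring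

lemma sum_sq_mul_log_le (r : ℕ → ℝ) (N : ℕ) : ∑ n ∈ Finset.Icc 1 N, (r n * Real.log n) ^ 2 ≤
    Real.log N ^ 2 * ∑ n ∈ Finset.Icc 1 N, r n ^ 2 := by
  rw [Finset.mul_sum]
  refine Finset.sum_le_sum fun n hn ↦ ?_
  rw [Finset.mem_Icc] at hn
  have hn1 : (1 : ℝ) ≤ n := Nat.one_le_cast.mpr hn.1
  have : 0 ≤ Real.log n := Real.log_nonneg hn1
  rw [mul_pow, mul_comm]
  gcongr
  exact hn.2

lemma exists_card_ordinates_le : ∃ C : ℝ, 1 ≤ C ∧ ∀ (Y : ℝ) (Z : Finset ℂ), 4 ≤ Y →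
    (∀ ρ ∈ Z, riemannZeta ρ = 0 ∧ 1 / 2 ≤ ρ.re ∧ 4 ≤ ρ.im ∧ ρ.im ≤ Y) → ∀ u : ℝ,
      (({γ ∈ Z.image im | |γ - u| ≤ 1 / 2} : Finset ℝ).card : ℝ) ≤ C * Real.log (Y + 1) := by
  classical
  obtain ⟨C, hC1, hC⟩ := exists_card_zeros_le
  refine ⟨C, hC1, fun Y Z hY hZ u ↦ ?_⟩
  rw [Finset.filter_image]
  rcases ({ρ ∈ Z | |ρ.im - u| ≤ 1 / 2} : Finset ℂ).eq_empty_or_nonempty with hempty | ⟨ρ₀, hρ₀⟩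
  · rw [hempty, Finset.image_empty, Finset.card_empty, Nat.cast_zero]
    exact mul_nonneg (by linarith) (Real.log_nonneg (by linarith))
  rw [Finset.mem_filter, abs_le] at hρ₀
  obtain ⟨_, _, h4, hρY⟩ := hZ ρ₀ hρ₀.1
  have hu : 3 ≤ u := by linarith [hρ₀.2.2]
  have huY : u ≤ Y + 1 := by linarith [hρ₀.2.1]
  have hcard := hC u hu {ρ ∈ Z | |ρ.im - u| ≤ 1 / 2} fun ρ hρ ↦ by
    rw [Finset.mem_filter] at hρ
    exact ⟨(hZ ρ hρ.1).1, (hZ ρ hρ.1).2.1, hρ.2⟩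
  refine (Nat.cast_le.mpr Finset.card_image_le).trans (hcard.trans ?_)
  gcongr

lemma exists_sum_gaussian_mul_sq_norm_resonator_le : ∃ C : ℝ, 1 ≤ C ∧
    ∀ (r : ℕ → ℝ) (N : ℕ) (H T Y : ℝ) (Z : Finset ℂ), 1 ≤ H →
      N * Real.exp (-(H / N) ^ 2 / 4) ≤ 1 → 4 ≤ Y →
      (∀ ρ ∈ Z, riemannZeta ρ = 0 ∧ ρ.re = 1 / 2 ∧ 4 ≤ ρ.im ∧ ρ.im ≤ Y) →
      ∑ ρ ∈ Z, Real.exp (-(ρ.im - T) ^ 2 / (2 * H ^ 2)) * ‖resonator r N ρ.im‖ ^ 2 ≤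
        C * Real.log (Y + 1) * H * (2 + Real.log N ^ 2) * ∑ n ∈ Finset.Icc 1 N, r n ^ 2 := by
  obtain ⟨C, hC1, hC⟩ := exists_card_ordinates_le
  refine ⟨16 * C, by linarith, fun r N H T Y Z hH hN hY hZ ↦ ?_⟩
  have hH0 : 0 < H := one_pos.trans_le hH
  have hinj : InjOn im (Z : Set ℂ) := fun x hx y hy hxy ↦
    Complex.ext ((hZ x hx).2.1.trans (hZ y hy).2.1.symm) hxy
  have hcount := hC Y Z hY fun ρ hρ ↦ ⟨(hZ ρ hρ).1, (hZ ρ hρ).2.1.ge, (hZ ρ hρ).2.2⟩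
  have hβ : 1 / (4 * H ^ 2) ≤ 1 := by
    rw [div_le_one (by positivity)]
    nlinarith
  have hsieve := sum_gaussian_mul_sq_norm_trigPoly_le (Finset.Icc 1 N) r (fun n ↦ Real.log n)
    (T := T) (by positivity) hβ (Z.image im) hcount
  rw [Finset.sum_image hinj] at hsieve
  have hweight (γ : ℝ) : -(γ - T) ^ 2 / (2 * H ^ 2) =
      -(2 * (1 / (4 * H ^ 2))) * (γ - T) ^ 2 := by
    field_simp
    norm_num
  simp only [hweight]
  refine hsieve.trans ?_
  set S := ∑ n ∈ Finset.Icc 1 N, r n ^ 2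
  have hF := integral_sq_norm_resonator_mul_gaussian_le r T hH0 hN
  have hG := (integral_sq_norm_resonator_mul_gaussian_le (fun n ↦ r n * Real.log n) T hH0 hN).trans
    (mul_le_mul_of_nonneg_left (sum_sq_mul_log_le r N) (by positivity))
  have hM : 0 ≤ C * Real.log (Y + 1) :=
    mul_nonneg (by linarith) (Real.log_nonneg (by linarith))
  unfold resonator at hF hG
  calc _ ≤ 2 * (C * Real.log (Y + 1)) * (2 * (8 * H * S)) +
        2 * (C * Real.log (Y + 1)) * (8 * H * (Real.log N ^ 2 * S)) := by gcongr
    _ = _ := by ring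

/-! ### The resonator kernel -/

/-- The Dirichlet polynomial `∑ n ≤ N, r n * n ^ (-z)`; on the imaginary axis it is
`resonator r N`. -/
noncomputable def dirichletPoly (r : ℕ → ℝ) (N : ℕ) (z : ℂ) : ℂ :=
  ∑ n ∈ Finset.Icc 1 N, (r n : ℂ) * cexp (-(z * Real.log n))

lemma resonator_eq_dirichletPoly (r : ℕ → ℝ) (N : ℕ) (u : ℝ) :
    resonator r N u = dirichletPoly r N (u * I) := by
  unfold resonator trigPoly dirichletPoly
  refine Finset.sum_congr rfl fun n _ ↦ ?_
  congr 3
  ring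

lemma conj_dirichletPoly (r : ℕ → ℝ) (N : ℕ) (z : ℂ) :
    (starRingEnd ℂ) (dirichletPoly r N z) = dirichletPoly r N ((starRingEnd ℂ) z) := by
  simp only [dirichletPoly, map_sum, map_mul, conj_ofReal, ← exp_conj, map_neg]

lemma differentiable_dirichletPoly (r : ℕ → ℝ) (N : ℕ) : Differentiable ℂ (dirichletPoly r N) := by
  unfold dirichletPoly
  fun_prop

lemma norm_dirichletPoly_le_sum {r : ℕ → ℝ} (hr : ∀ n, |r n| ≤ 1) (N : ℕ) (z : ℂ) :
    ‖dirichletPoly r N z‖ ≤ ∑ n ∈ Finset.Icc 1 N, (n : ℝ) ^ (-z.re) := by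
  refine norm_sum_le_of_le _ fun n hn ↦ ?_
  rw [norm_mul, norm_real, Real.norm_eq_abs, norm_exp, neg_re, re_mul_ofReal,
    Real.rpow_def_of_pos (Nat.cast_pos.mpr (Finset.mem_Icc.mp hn).1), mul_neg,
    mul_comm (Real.log n)]
  exact mul_le_of_le_one_left (Real.exp_pos _).le (hr n)

lemma norm_dirichletPoly_le {r : ℕ → ℝ} (hr : ∀ n, |r n| ≤ 1) (N : ℕ) {z : ℂ} {a : ℝ}
    (ha : 0 ≤ a) (hz : -a ≤ z.re) : ‖dirichletPoly r N z‖ ≤ (N : ℝ) ^ (1 + a) := by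
  have hterm : ∀ n ∈ Finset.Icc 1 N, (n : ℝ) ^ (-z.re) ≤ (N : ℝ) ^ a := fun n hn ↦ by
    rw [Finset.mem_Icc] at hn
    calc (n : ℝ) ^ (-z.re) ≤ (n : ℝ) ^ a :=
          Real.rpow_le_rpow_of_exponent_le (Nat.one_le_cast.mpr hn.1) (by linarith)
      _ ≤ (N : ℝ) ^ a := Real.rpow_le_rpow n.cast_nonneg (Nat.cast_le.mpr hn.2) ha
  refine (norm_dirichletPoly_le_sum hr N z).trans ((Finset.sum_le_sum hterm).trans_eq ?_)
  rw [Finset.sum_const, Nat.card_Icc, Nat.add_sub_cancel, nsmul_eq_mul,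
    Real.rpow_add_of_nonneg N.cast_nonneg zero_le_one ha, Real.rpow_one]

/-- The entire function `exp ((s - 1/2 - iT)² / H²) A(s - 1/2) A(1/2 - s)`, with `A` the Dirichlet
polynomial of `r`. On the critical line it is a Gaussian of width `H` around height `T` times the
squared modulus of the resonator. -/
noncomputable def resonatorKernel (r : ℕ → ℝ) (N : ℕ) (H T : ℝ) (s : ℂ) : ℂ :=
  cexp ((s - 1 / 2 - T * I) ^ 2 / H ^ 2) *
    (dirichletPoly r N (s - 1 / 2) * dirichletPoly r N (1 / 2 - s))

lemma differentiable_resonatorKernel (r : ℕ → ℝ) (N : ℕ) (H T : ℝ) :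
    Differentiable ℂ (resonatorKernel r N H T) := by
  unfold resonatorKernel
  have hpoly := differentiable_dirichletPoly r N
  fun_prop

lemma resonatorKernel_of_re_eq_half (r : ℕ → ℝ) (N : ℕ) (H T : ℝ) {ρ : ℂ} (hρ : ρ.re = 1 / 2) :
    resonatorKernel r N H T ρ =
      ((Real.exp (-(ρ.im - T) ^ 2 / H ^ 2) * ‖resonator r N ρ.im‖ ^ 2 : ℝ) : ℂ) := by
  have hsub : ρ - 1 / 2 = ρ.im * I := by
    apply Complex.ext <;> simp [hρ]
  have hrefl : 1 / 2 - ρ = (starRingEnd ℂ) (ρ.im * I : ℂ) := by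
    apply Complex.ext <;> simp [hρ]
  have hexponent :
      (ρ.im * I - T * I : ℂ) ^ 2 / H ^ 2 = ((-(ρ.im - T) ^ 2 / H ^ 2 : ℝ) : ℂ) := by
    push_cast
    rw [← sub_mul, mul_pow, I_sq, mul_neg_one]
  unfold resonatorKernel
  rw [hsub, hrefl, ← conj_dirichletPoly, ← resonator_eq_dirichletPoly, mul_conj,
    normSq_eq_norm_sq, hexponent, ofReal_mul, ofReal_exp]

lemma norm_gaussian_weight_le {H T : ℝ} (hH : 5 / 2 ≤ H) {s : ℂ} (hs2 : -2 ≤ s.re)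
    (hs3 : s.re ≤ 3) :
    ‖cexp ((s - 1 / 2 - T * I) ^ 2 / H ^ 2)‖ ≤ 3 * Real.exp (-(s.im - T) ^ 2 / H ^ 2) := by
  have hre : ((s - 1 / 2 - T * I) ^ 2 / H ^ 2 : ℂ).re =
      (s.re - 1 / 2) ^ 2 / H ^ 2 + -(s.im - T) ^ 2 / H ^ 2 := by
    rw [← ofReal_pow, div_ofReal_re, ← add_div, sq, mul_re]
    congr 1
    simp
    ring
  rw [norm_exp, hre, Real.exp_add]
  refine mul_le_mul_of_nonneg_right ?_ (Real.exp_pos _).le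
  have hle : (s.re - 1 / 2) ^ 2 / H ^ 2 ≤ 1 := by
    rw [div_le_one (by positivity)]
    nlinarith
  exact (Real.exp_le_exp.mpr hle).trans (by linarith [Real.exp_one_lt_d9])

lemma norm_resonatorKernel_le {r : ℕ → ℝ} (hr : ∀ n, |r n| ≤ 1) (N : ℕ) {H T : ℝ}
    (hH : 5 / 2 ≤ H) {s : ℂ} (hs2 : -2 ≤ s.re) (hs3 : s.re ≤ 3) :
    ‖resonatorKernel r N H T s‖ ≤ 3 * N ^ 8 * Real.exp (-(s.im - T) ^ 2 / H ^ 2) := by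
  have hpoly (z : ℂ) (hz : -3 ≤ z.re) : ‖dirichletPoly r N z‖ ≤ N ^ 4 := by
    refine (norm_dirichletPoly_le hr N (by norm_num) hz).trans_eq ?_
    norm_num
  unfold resonatorKernel
  rw [norm_mul, norm_mul]
  calc _ ≤ 3 * Real.exp (-(s.im - T) ^ 2 / H ^ 2) * (N ^ 4 * N ^ 4) := by
        gcongr
        · exact norm_gaussian_weight_le hH hs2 hs3
        · exact hpoly _ (by simp; linarith)
        · exact hpoly _ (by simp; linarith)
    _ = _ := by ring

lemma integrable_resonatorKernel_vertical {r : ℕ → ℝ} (hr : ∀ n, |r n| ≤ 1) (N : ℕ) {H : ℝ}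
    (T : ℝ) (hH : 5 / 2 ≤ H) {σ : ℝ} (hσ2 : -2 ≤ σ) (hσ3 : σ ≤ 3) :
    Integrable fun t : ℝ ↦ resonatorKernel r N H T (σ + t * I) := by
  have hβ : 0 < 1 / H ^ 2 := by positivity
  refine Integrable.mono' ((integrable_gaussian_sub hβ T).const_mul (3 * N ^ 8))
    ((differentiable_resonatorKernel r N H T).continuous.comp
      (by fun_prop)).aestronglyMeasurable (Eventually.of_forall fun t ↦ ?_)
  refine (norm_resonatorKernel_le hr N hH (by simpa) (by simpa)).trans_eq ?_
  simp only [add_im, ofReal_im, mul_im, ofReal_re, I_im, I_re]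
  congr 2
  ring

/-! ### The main term on the line `re s = 3` -/

section

open ArithmeticFunction ArithmeticFunction.Moebius LSeries.notation

/-- The quadratic form `∑ μ(n) n^(-1/2) r(h) r(hn)` over `n, h, hn ≤ N`. It is the main term of the
sum of the residues of `resonatorKernel r N H T s / ζ(s)` over the zeros of `ζ`. -/
noncomputable def resonatorForm (r : ℕ → ℝ) (N : ℕ) : ℝ :=
  ∑ n ∈ Finset.Icc 1 N, ∑ h ∈ Finset.Icc 1 N, ∑ k ∈ Finset.Icc 1 N,
    if k = h * n then (μ n : ℝ) / Real.sqrt n * (r h * r k) else 0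

lemma cexp_shifted_gaussian_eq {H : ℝ} (hH : 0 < H) (T l t : ℝ) :
    cexp ((5 / 2 + t * I - T * I) ^ 2 / H ^ 2 + (5 / 2 + t * I) * l) =
      cexp (-((1 / H ^ 2 : ℝ) : ℂ) * (t - T) ^ 2 + ((5 / H ^ 2 + l : ℝ) : ℂ) * t * I) *
        cexp (25 / (4 * H ^ 2) - 5 * T / H ^ 2 * I + 5 * l / 2) := by
  have hH' : (H : ℂ) ≠ 0 := ofReal_ne_zero.mpr hH.ne'
  rw [← Complex.exp_add]
  congr 1
  push_cast
  field_simp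
  ring_nf
  rw [I_sq]
  ring

lemma integrable_cexp_shifted_gaussian {H : ℝ} (hH : 0 < H) (T l : ℝ) :
    Integrable fun t : ℝ ↦
      cexp ((5 / 2 + t * I - T * I) ^ 2 / H ^ 2 + (5 / 2 + t * I) * l) := by
  simp only [cexp_shifted_gaussian_eq hH]
  exact (integrable_cexp_gaussian (by positivity) T _).mul_const _

lemma integral_cexp_shifted_gaussian {H : ℝ} (hH : 0 < H) (T l : ℝ) :
    ∫ t : ℝ, cexp ((5 / 2 + t * I - T * I) ^ 2 / H ^ 2 + (5 / 2 + t * I) * l) =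
      (Real.sqrt Real.pi * H : ℝ) * cexp (T * l * I - H ^ 2 * l ^ 2 / 4) := by
  have hH' : (H : ℂ) ≠ 0 := ofReal_ne_zero.mpr hH.ne'
  simp only [cexp_shifted_gaussian_eq hH]
  rw [integral_mul_const, integral_cexp_gaussian (by positivity), mul_assoc, ← Complex.exp_add]
  congr 2
  · rw [div_div_eq_mul_div, div_one, Real.sqrt_mul Real.pi_pos.le, Real.sqrt_sq hH.le]
  · push_cast
    field_simp
    ring

lemma norm_integral_cexp_shifted_gaussian {H : ℝ} (hH : 0 < H) (T l : ℝ) :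
    ‖∫ t : ℝ, cexp ((5 / 2 + t * I - T * I) ^ 2 / H ^ 2 + (5 / 2 + t * I) * l)‖ =
      Real.sqrt Real.pi * H * Real.exp (-(H ^ 2 * l ^ 2 / 4)) := by
  rw [integral_cexp_shifted_gaussian hH, norm_mul, norm_real, norm_exp, Real.norm_of_nonneg]
  · congr 2
    rw [show (T * l * I - H ^ 2 * l ^ 2 / 4 : ℂ) =
      ((-(H ^ 2 * l ^ 2 / 4) : ℝ) : ℂ) + ((T * l : ℝ) : ℂ) * I by push_cast; ring]
    simp only [add_re, ofReal_re, re_ofReal_mul, I_re, mul_zero, add_zero]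
  · positivity

lemma one_div_le_abs_log_sub_log_sub_log {N h k n : ℕ} (hh : 0 < h) (hk : 0 < k) (hn : 0 < n)
    (hkN : k ≤ N) (hne : k ≠ h * n) :
    1 / (2 * N : ℝ) ≤ |Real.log k - Real.log h - Real.log n| := by
  rw [sub_sub, ← Real.log_mul (by positivity) (by positivity), ← Nat.cast_mul]
  exact one_div_le_abs_log_sub_log hk (Nat.mul_pos hh hn) hkN hne

lemma exp_neg_sq_log_le_sq_div {N h k n : ℕ} {H : ℝ} (hh : 0 < h) (hk : 0 < k) (hn : 0 < n)
    (hkN : k ≤ N) (hne : k ≠ h * n) (hH : 32 * N ≤ H ^ 2) :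
    Real.exp (-(H ^ 2 * (Real.log k - Real.log h - Real.log n) ^ 2 / 8)) ≤ (N / n : ℝ) ^ 2 := by
  have hk' : (0 : ℝ) < k := Nat.cast_pos.mpr hk
  have hn' : (0 : ℝ) < n := Nat.cast_pos.mpr hn
  have hN' : (0 : ℝ) < N := Nat.cast_pos.mpr (hk.trans_le hkN)
  have hgap := one_div_le_abs_log_sub_log_sub_log hh hk hn hkN hne
  set l := Real.log k - Real.log h - Real.log n
  rcases le_or_gt n N with hnN | hnN
  · have hone : (1 : ℝ) ≤ N / n := (one_le_div₀ hn').mpr (Nat.cast_le.mpr hnN)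
    calc Real.exp (-(H ^ 2 * l ^ 2 / 8)) ≤ 1 :=
          Real.exp_le_one_iff.mpr (neg_nonpos.mpr (by positivity))
      _ ≤ (N / n : ℝ) ^ 2 := one_le_pow₀ hone
  · have hlog : Real.log n - Real.log N ≤ -l := by
      linarith [Real.log_le_log hk' (Nat.cast_le.mpr hkN),
        Real.log_nonneg (Nat.one_le_cast (α := ℝ).mpr hh)]
    have habs : |l| = -l := abs_of_neg (by
      linarith [Real.log_lt_log hN' (Nat.cast_lt.mpr hnN)])
    have hlarge : 16 ≤ H ^ 2 * |l| := calc
      (16 : ℝ) = 32 * N * (1 / (2 * N)) := by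
        field_simp
        norm_num
      _ ≤ H ^ 2 * |l| := by gcongr
    have hsq : 16 * |l| ≤ H ^ 2 * l ^ 2 := by
      rw [← sq_abs l, sq |l|, ← mul_assoc]
      gcongr
    rw [← Real.exp_log (div_pos hN' hn'), ← Real.exp_nat_mul, Real.exp_le_exp,
      Real.log_div hN'.ne' hn'.ne']
    push_cast
    linarith

/- One half of the exponent gives the decay in `H / N`, the other half the summability in `n`. -/
lemma exp_neg_sq_log_le {N h k n : ℕ} {H : ℝ} (hh : 0 < h) (hk : 0 < k) (hn : 0 < n)
    (hkN : k ≤ N) (hne : k ≠ h * n) (hH : 32 * N ≤ H ^ 2) :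
    Real.exp (-(H ^ 2 * (Real.log k - Real.log h - Real.log n) ^ 2 / 4)) ≤
      Real.exp (-(H / N) ^ 2 / 32) * (N / n) ^ 2 := by
  have hsummable := exp_neg_sq_log_le_sq_div hh hk hn hkN hne hH
  have hgap := one_div_le_abs_log_sub_log_sub_log hh hk hn hkN hne
  set l := Real.log k - Real.log h - Real.log n
  have hdecay : (H / N) ^ 2 / 32 ≤ H ^ 2 * l ^ 2 / 8 := calc
    (H / N) ^ 2 / 32 = H ^ 2 * (1 / (2 * N : ℝ)) ^ 2 / 8 := by
      field_simp
      ring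
    _ ≤ H ^ 2 * |l| ^ 2 / 8 := by gcongr
    _ = H ^ 2 * l ^ 2 / 8 := by rw [sq_abs]
  calc Real.exp (-(H ^ 2 * l ^ 2 / 4))
      = Real.exp (-(H ^ 2 * l ^ 2 / 8)) * Real.exp (-(H ^ 2 * l ^ 2 / 8)) := by
        rw [← Real.exp_add]
        ring_nf
    _ ≤ Real.exp (-(H / N) ^ 2 / 32) * (N / n) ^ 2 := by
        gcongr
        linarith

lemma term_moebius_half_add {n : ℕ} (hn : 0 < n) (z : ℂ) :
    LSeries.term ↗μ (1 / 2 + z) n =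
      ((μ n : ℝ) / Real.sqrt n : ℝ) * cexp (-(z * Real.log n)) := by
  have hsqrt : (Real.sqrt n : ℂ) = cexp (1 / 2 * Real.log n) := by
    rw [Real.sqrt_eq_rpow, Real.rpow_def_of_pos (Nat.cast_pos.mpr hn)]
    push_cast
    ring_nf
  rw [LSeries.term_of_ne_zero hn.ne', cpow_def_of_ne_zero (Nat.cast_ne_zero.mpr hn.ne'),
    ← natCast_log, ofReal_div, hsqrt, div_mul_eq_mul_div, mul_div_assoc, div_eq_mul_inv,
    ← Complex.exp_neg, ← Complex.exp_sub, ofReal_intCast]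
  ring_nf

lemma resonatorKernel_half_add (r : ℕ → ℝ) (N : ℕ) (H T : ℝ) (z : ℂ) :
    resonatorKernel r N H T (1 / 2 + z) =
      ∑ h ∈ Finset.Icc 1 N, ∑ k ∈ Finset.Icc 1 N, ((r h * r k : ℝ) : ℂ) *
        cexp ((z - T * I) ^ 2 / H ^ 2 + z * (Real.log k - Real.log h : ℝ)) := by
  unfold resonatorKernel dirichletPoly
  rw [show 1 / 2 + z - 1 / 2 = z by ring, show 1 / 2 - (1 / 2 + z) = -z by ring,
    Finset.sum_mul_sum, Finset.mul_sum]
  refine Finset.sum_congr rfl fun h _ ↦ ?_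
  rw [Finset.mul_sum]
  refine Finset.sum_congr rfl fun k _ ↦ ?_
  rw [show (z - T * I) ^ 2 / H ^ 2 + z * (Real.log k - Real.log h : ℝ) =
      (z - T * I) ^ 2 / H ^ 2 + -(z * Real.log h) + -(-z * Real.log k) by push_cast; ring,
    Complex.exp_add, Complex.exp_add]
  push_cast
  ring

lemma resonatorKernel_mul_term_moebius (r : ℕ → ℝ) (N : ℕ) (H T t : ℝ) {n : ℕ} (hn : 0 < n) :
    resonatorKernel r N H T (3 + t * I) * LSeries.term ↗μ (3 + t * I) n =
      ∑ h ∈ Finset.Icc 1 N, ∑ k ∈ Finset.Icc 1 N, ((μ n : ℝ) / Real.sqrt n * (r h * r k) : ℝ) *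
        cexp ((5 / 2 + t * I - T * I) ^ 2 / H ^ 2 +
          (5 / 2 + t * I) * (Real.log k - Real.log h - Real.log n : ℝ)) := by
  rw [show (3 + t * I : ℂ) = 1 / 2 + (5 / 2 + t * I) by ring, term_moebius_half_add hn,
    resonatorKernel_half_add, Finset.sum_mul]
  refine Finset.sum_congr rfl fun h _ ↦ ?_
  rw [Finset.sum_mul]
  refine Finset.sum_congr rfl fun k _ ↦ ?_
  rw [mul_mul_mul_comm, ← Complex.exp_add, mul_comm (ofReal _), ← ofReal_mul]
  congr 2
  push_cast
  ring

lemma resonatorKernel_div_riemannZeta_eq_tsum (r : ℕ → ℝ) (N : ℕ) (H T t : ℝ) :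
    resonatorKernel r N H T (3 + t * I) / riemannZeta (3 + t * I) =
      ∑' n, resonatorKernel r N H T (3 + t * I) * LSeries.term ↗μ (3 + t * I) n := by
  have hre : 1 < (3 + t * I : ℂ).re := by simp
  have hinv := LSeries_zeta_mul_Lseries_moebius hre
  rw [LSeries_zeta_eq_riemannZeta hre] at hinv
  rw [tsum_mul_left, div_eq_mul_inv, inv_eq_of_mul_eq_one_right hinv, LSeries]

lemma norm_div_riemannZeta_le (z : ℂ) {s : ℂ} (hs : 2 ≤ s.re) :
    ‖z / riemannZeta s‖ ≤ 2 * ‖z‖ := by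
  have hzeta := half_le_norm_riemannZeta hs
  rw [norm_div, div_le_iff₀ (by linarith)]
  nlinarith [norm_nonneg z]

lemma integrable_resonatorKernel_div_riemannZeta {r : ℕ → ℝ} (hr : ∀ n, |r n| ≤ 1) (N : ℕ)
    {H : ℝ} (T : ℝ) (hH : 5 / 2 ≤ H) :
    Integrable fun t : ℝ ↦ resonatorKernel r N H T (3 + t * I) / riemannZeta (3 + t * I) := by
  have hK := integrable_resonatorKernel_vertical hr N T hH (σ := 3) (by norm_num) le_rfl
  have hcont : Continuous fun t : ℝ ↦
      resonatorKernel r N H T (3 + t * I) / riemannZeta (3 + t * I) := by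
    refine ((differentiable_resonatorKernel r N H T).continuous.comp (by fun_prop)).div
      (continuous_iff_continuousAt.mpr fun t ↦ ?_)
      fun t ↦ riemannZeta_ne_zero_of_one_lt_re (by simp)
    exact ContinuousAt.comp (f := fun t : ℝ ↦ (3 + t * I : ℂ))
      (differentiableAt_riemannZeta fun h ↦ by simpa using congrArg re h).continuousAt
      (by fun_prop)
  push_cast at hK
  exact (hK.norm.const_mul 2).mono' hcont.aestronglyMeasurable
    (Eventually.of_forall fun t ↦ norm_div_riemannZeta_le _ (by norm_num))

lemma integrable_resonatorKernel_mul_term_moebius (r : ℕ → ℝ) (N : ℕ) {H : ℝ} (hH : 0 < H) (T : ℝ)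
    (n : ℕ) : Integrable fun t : ℝ ↦
      resonatorKernel r N H T (3 + t * I) * LSeries.term ↗μ (3 + t * I) n := by
  rcases Nat.eq_zero_or_pos n with rfl | hn
  · simp
  simp only [resonatorKernel_mul_term_moebius r N H T _ hn]
  exact integrable_finsetSum _ fun h _ ↦ integrable_finsetSum _ fun k _ ↦
    (integrable_cexp_shifted_gaussian hH T _).const_mul _

lemma integral_resonatorKernel_mul_term_moebius (r : ℕ → ℝ) (N : ℕ) {H : ℝ} (hH : 0 < H) (T : ℝ)
    {n : ℕ} (hn : 0 < n) :
    ∫ t : ℝ, resonatorKernel r N H T (3 + t * I) * LSeries.term ↗μ (3 + t * I) n =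
      ∑ h ∈ Finset.Icc 1 N, ∑ k ∈ Finset.Icc 1 N, ((μ n : ℝ) / Real.sqrt n * (r h * r k) : ℝ) *
        ∫ t : ℝ, cexp ((5 / 2 + t * I - T * I) ^ 2 / H ^ 2 +
          (5 / 2 + t * I) * (Real.log k - Real.log h - Real.log n : ℝ)) := by
  have hint (c l : ℝ) : Integrable fun t : ℝ ↦
      (c : ℂ) * cexp ((5 / 2 + t * I - T * I) ^ 2 / H ^ 2 + (5 / 2 + t * I) * l) :=
    (integrable_cexp_shifted_gaussian hH T l).const_mul _
  simp only [resonatorKernel_mul_term_moebius r N H T _ hn]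
  rw [integral_finsetSum _ fun h _ ↦ integrable_finsetSum _ fun k _ ↦ hint _ _]
  refine Finset.sum_congr rfl fun h _ ↦ ?_
  rw [integral_finsetSum _ fun k _ ↦ hint _ _]
  exact Finset.sum_congr rfl fun k _ ↦ integral_const_mul _ _

lemma abs_moebius_div_sqrt_mul_le_one {r : ℕ → ℝ} (hr : ∀ n, |r n| ≤ 1) {n : ℕ} (hn : 0 < n)
    (h k : ℕ) : |(μ n : ℝ) / Real.sqrt n * (r h * r k)| ≤ 1 := by
  have hmoebius : |(μ n : ℝ)| ≤ 1 := by exact_mod_cast abs_moebius_le_one (n := n)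
  have hsqrt : 1 ≤ Real.sqrt n := Real.one_le_sqrt.mpr (Nat.one_le_cast.mpr hn)
  rw [abs_mul, abs_mul, abs_div, abs_of_nonneg (Real.sqrt_nonneg _)]
  exact mul_le_one₀ (div_le_one_of_le₀ (hmoebius.trans hsqrt) (Real.sqrt_nonneg _))
    (by positivity) (mul_le_one₀ (hr h) (abs_nonneg _) (hr k))

lemma norm_const_mul_integral_cexp_shifted_gaussian_sub_le {N n h k : ℕ} {H : ℝ} (hH : 0 < H)
    (hNH : 32 * N ≤ H ^ 2) (T : ℝ) (hn : 0 < n) (hh : 0 < h) (hk : k ∈ Finset.Icc 1 N) {c : ℝ}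
    (hc : |c| ≤ 1) :
    ‖(c : ℂ) * (∫ t : ℝ, cexp ((5 / 2 + t * I - T * I) ^ 2 / H ^ 2 +
      (5 / 2 + t * I) * (Real.log k - Real.log h - Real.log n : ℝ))) -
        (Real.sqrt Real.pi * H * (if k = h * n then c else 0) : ℝ)‖ ≤
      Real.sqrt Real.pi * H * (Real.exp (-(H / N) ^ 2 / 32) * (N / n) ^ 2) := by
  rw [Finset.mem_Icc] at hk
  split_ifs with hkn
  · have hlog : Real.log k - Real.log h - Real.log n = 0 := by
      rw [hkn, Nat.cast_mul, Real.log_mul (by positivity) (by positivity)]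
      ring
    rw [hlog, integral_cexp_shifted_gaussian hH, ofReal_mul (_ * _), mul_comm (c : ℂ)]
    simp only [ofReal_zero, mul_zero, zero_mul, zero_pow two_ne_zero, zero_div,
      Complex.exp_zero, mul_one, sub_self, norm_zero]
    positivity
  · rw [mul_zero, ofReal_zero, sub_zero, norm_mul, norm_integral_cexp_shifted_gaussian hH,
      norm_real, Real.norm_eq_abs]
    refine (mul_le_of_le_one_left (by positivity) hc).trans ?_
    gcongr
    exact exp_neg_sq_log_le hh hk.1 hn hk.2 hkn hNH

lemma norm_integral_resonatorKernel_mul_term_moebius_sub_le {r : ℕ → ℝ} (hr : ∀ n, |r n| ≤ 1)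
    {N : ℕ} {H : ℝ} (hH : 0 < H) (hNH : 32 * N ≤ H ^ 2) (T : ℝ) {n : ℕ} (hn : 0 < n) :
    ‖(∫ t : ℝ, resonatorKernel r N H T (3 + t * I) * LSeries.term ↗μ (3 + t * I) n) -
      (Real.sqrt Real.pi * H * ∑ h ∈ Finset.Icc 1 N, ∑ k ∈ Finset.Icc 1 N,
        if k = h * n then (μ n : ℝ) / Real.sqrt n * (r h * r k) else 0 : ℝ)‖ ≤
      Real.sqrt Real.pi * H * Real.exp (-(H / N) ^ 2 / 32) * N ^ 4 * (1 / (n : ℝ) ^ 2) := by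
  rw [integral_resonatorKernel_mul_term_moebius r N hH T hn]
  simp only [Finset.mul_sum, ofReal_sum, ← Finset.sum_sub_distrib]
  calc _ ≤ ∑ _h ∈ Finset.Icc 1 N, ∑ _k ∈ Finset.Icc 1 N,
        Real.sqrt Real.pi * H * (Real.exp (-(H / N) ^ 2 / 32) * (N / n) ^ 2) :=
      norm_sum_le_of_le _ fun h hh ↦ norm_sum_le_of_le _ fun k hk ↦
        norm_const_mul_integral_cexp_shifted_gaussian_sub_le hH hNH T hn (Finset.mem_Icc.mp hh).1
          hk (abs_moebius_div_sqrt_mul_le_one hr hn h k)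
    _ = _ := by
      simp only [Finset.sum_const, Nat.card_Icc, nsmul_eq_mul, Nat.add_sub_cancel]
      ring

lemma sum_sum_ite_eq_mul_eq_zero {N n : ℕ} (hn : n ∉ Finset.Icc 1 N) (f : ℕ → ℕ → ℝ) :
    ∑ h ∈ Finset.Icc 1 N, ∑ k ∈ Finset.Icc 1 N, (if k = h * n then f h k else 0) = 0 := by
  refine Finset.sum_eq_zero fun h hh ↦ Finset.sum_eq_zero fun k hk ↦ if_neg ?_
  rintro rfl
  rw [Finset.mem_Icc] at hh hk hn
  have : n ≤ h * n := Nat.le_mul_of_pos_left n hh.1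
  have : n ≠ 0 := right_ne_zero_of_mul (by omega : h * n ≠ 0)
  omega

lemma hasSum_integral_resonatorKernel_mul_term_moebius {r : ℕ → ℝ} (hr : ∀ n, |r n| ≤ 1) (N : ℕ)
    {H : ℝ} (T : ℝ) (hH : 5 / 2 ≤ H) :
    HasSum (fun n ↦ ∫ t : ℝ, resonatorKernel r N H T (3 + t * I) *
        LSeries.term ↗μ (3 + t * I) n)
      (∫ t : ℝ, resonatorKernel r N H T (3 + t * I) / riemannZeta (3 + t * I)) := by
  have hK := integrable_resonatorKernel_vertical hr N T hH (σ := 3) (by norm_num) le_rfl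
  push_cast at hK
  have hterm := integrable_resonatorKernel_mul_term_moebius r N (by linarith : 0 < H) T
  simp only [resonatorKernel_div_riemannZeta_eq_tsum]
  refine hasSum_integral_of_summable_integral_norm hterm ?_
  refine Summable.of_nonneg_of_le (fun n ↦ integral_nonneg fun t ↦ norm_nonneg _) (fun n ↦ ?_)
    ((Real.summable_one_div_nat_pow.mpr one_lt_two).mul_right
      (∫ t : ℝ, ‖resonatorKernel r N H T (3 + t * I)‖))
  rw [← integral_const_mul]
  refine integral_mono (hterm n).norm (hK.norm.const_mul _) fun t ↦ ?_
  rw [norm_mul, mul_comm]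
  gcongr
  exact norm_term_moebius_le (by norm_num) n

lemma norm_integral_resonatorKernel_div_riemannZeta_sub_le {r : ℕ → ℝ} (hr : ∀ n, |r n| ≤ 1)
    {N : ℕ} {H : ℝ} (T : ℝ) (hH : 5 / 2 ≤ H) (hNH : 32 * N ≤ H ^ 2) :
    ‖(∫ t : ℝ, resonatorKernel r N H T (3 + t * I) / riemannZeta (3 + t * I)) -
      (Real.sqrt Real.pi * H * resonatorForm r N : ℝ)‖ ≤
      4 * H * N ^ 4 * Real.exp (-(H / N) ^ 2 / 32) := by
  have hH0 : 0 < H := by linarith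
  have hform : HasSum (fun n ↦ ∑ h ∈ Finset.Icc 1 N, ∑ k ∈ Finset.Icc 1 N,
      if k = h * n then (μ n : ℝ) / Real.sqrt n * (r h * r k) else 0) (resonatorForm r N) :=
    hasSum_sum_of_ne_finset_zero fun n hn ↦ sum_sum_ite_eq_mul_eq_zero hn _
  have hdiff := (hasSum_integral_resonatorKernel_mul_term_moebius hr N T hH).sub
    (hasSum_ofReal.mpr (hform.mul_left (Real.sqrt Real.pi * H)))
  rw [← hdiff.tsum_eq]
  refine (tsum_of_norm_bounded (hasSum_zeta_two.mul_left
    (Real.sqrt Real.pi * H * Real.exp (-(H / N) ^ 2 / 32) * N ^ 4)) fun n ↦ ?_).trans ?_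
  · rcases Nat.eq_zero_or_pos n with rfl | hn
    · simp
    · exact norm_integral_resonatorKernel_mul_term_moebius_sub_le hr hH0 hNH T hn
  · have hsqrt : Real.sqrt Real.pi ≤ 2 := by
      rw [Real.sqrt_le_left (by norm_num)]
      linarith [Real.pi_lt_four]
    have hzeta : Real.pi ^ 2 / 6 ≤ 2 := by nlinarith [Real.pi_lt_d2, Real.pi_pos]
    calc _ ≤ 2 * H * Real.exp (-(H / N) ^ 2 / 32) * N ^ 4 * 2 := by gcongr
      _ = _ := by ring

end

/-! ### The vertical edges -/

lemma integral_exp_half_gaussian_le {H : ℝ} (hH : 0 < H) (T : ℝ) :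
    ∫ t : ℝ, Real.exp (-(1 / (2 * H ^ 2)) * (t - T) ^ 2) ≤ 3 * H := by
  rw [integral_gaussian_sub, Real.sqrt_le_left (by positivity), div_div_eq_mul_div, div_one]
  nlinarith [sq_nonneg H, Real.pi_lt_four]

lemma norm_setIntegral_le_of_norm_le_gaussian {f : ℝ → ℂ} {A H T : ℝ} (hA : 0 ≤ A) (hH : 0 < H)
    {S : Set ℝ} (hS : MeasurableSet S)
    (hf : ∀ t ∈ S, ‖f t‖ ≤ A * Real.exp (-(1 / (2 * H ^ 2)) * (t - T) ^ 2)) :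
    ‖∫ t in S, f t‖ ≤ 3 * H * A := by
  have hint : Integrable fun t : ℝ ↦ A * Real.exp (-(1 / (2 * H ^ 2)) * (t - T) ^ 2) :=
    (integrable_gaussian_sub (by positivity) T).const_mul _
  calc ‖∫ t in S, f t‖ ≤ ∫ t in S, A * Real.exp (-(1 / (2 * H ^ 2)) * (t - T) ^ 2) :=
        norm_integral_le_of_norm_le hint.integrableOn ((ae_restrict_mem hS).mono hf)
    _ ≤ ∫ t, A * Real.exp (-(1 / (2 * H ^ 2)) * (t - T) ^ 2) :=
        setIntegral_le_integral hint (Eventually.of_forall fun t ↦ by positivity)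
    _ = A * ∫ t, Real.exp (-(1 / (2 * H ^ 2)) * (t - T) ^ 2) := integral_const_mul _ _
    _ ≤ A * (3 * H) := by gcongr; exact integral_exp_half_gaussian_le hH T
    _ = 3 * H * A := mul_comm _ _

lemma exp_gaussian_le_half_gaussian (H T t : ℝ) :
    Real.exp (-(t - T) ^ 2 / H ^ 2) ≤ Real.exp (-(1 / (2 * H ^ 2)) * (t - T) ^ 2) := by
  rw [Real.exp_le_exp, neg_div, neg_mul, neg_le_neg_iff, one_div_mul_eq_div, mul_comm 2, ← div_div]
  exact half_le_self (by positivity)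

lemma exp_gaussian_le_of_sq_le {H T t : ℝ} (hH : 0 < H) (ht : (T / 2) ^ 2 ≤ (t - T) ^ 2) :
    Real.exp (-(t - T) ^ 2 / H ^ 2) ≤
      Real.exp (-(T / H) ^ 2 / 8) * Real.exp (-(1 / (2 * H ^ 2)) * (t - T) ^ 2) := by
  rw [← Real.exp_add, Real.exp_le_exp,
    show -(T / H) ^ 2 / 8 + -(1 / (2 * H ^ 2)) * (t - T) ^ 2 =
      -(T ^ 2 / 8 + (t - T) ^ 2 / 2) / H ^ 2 by field_simp; ring]
  gcongr
  nlinarith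

lemma norm_integral_right_sub_le {r : ℕ → ℝ} (hr : ∀ n, |r n| ≤ 1) {N : ℕ} {H T t₀ t₁ : ℝ}
    (hH : 5 / 2 ≤ H) (hNH : 32 * N ≤ H ^ 2) (hT : 0 ≤ T) (ht₀ : t₀ ≤ T / 2) (ht₁ : 2 * T ≤ t₁) :
    ‖(∫ t in t₀..t₁, resonatorKernel r N H T (3 + t * I) / riemannZeta (3 + t * I)) -
      (Real.sqrt Real.pi * H * resonatorForm r N : ℝ)‖ ≤
      4 * H * N ^ 4 * Real.exp (-(H / N) ^ 2 / 32) +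
        18 * N ^ 8 * H * Real.exp (-(T / H) ^ 2 / 8) := by
  have hH0 : 0 < H := by linarith
  have hint := integrable_resonatorKernel_div_riemannZeta hr N T hH
  have hmain := norm_integral_resonatorKernel_div_riemannZeta_sub_le hr T hH hNH
  set f : ℝ → ℂ := fun t ↦ resonatorKernel r N H T (3 + t * I) / riemannZeta (3 + t * I)
  have hbound : ∀ t ∈ (Ioc t₀ t₁)ᶜ, ‖f t‖ ≤ 6 * N ^ 8 * Real.exp (-(T / H) ^ 2 / 8) *
      Real.exp (-(1 / (2 * H ^ 2)) * (t - T) ^ 2) := fun t ht ↦ by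
    have hkernel := norm_resonatorKernel_le hr N (T := T) hH (s := 3 + t * I)
      (by norm_num) (by norm_num)
    have hfar : (T / 2) ^ 2 ≤ (t - T) ^ 2 := by
      rw [mem_compl_iff, mem_Ioc, not_and_or, not_lt, not_le] at ht
      rcases ht with h | h <;> nlinarith
    have him : (3 + t * I : ℂ).im = t := by simp
    rw [him] at hkernel
    calc ‖f t‖ ≤ 2 * (3 * N ^ 8 * Real.exp (-(t - T) ^ 2 / H ^ 2)) :=
          (norm_div_riemannZeta_le _ (by norm_num)).trans (by gcongr)
      _ ≤ 2 * (3 * N ^ 8 * (Real.exp (-(T / H) ^ 2 / 8) *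
            Real.exp (-(1 / (2 * H ^ 2)) * (t - T) ^ 2))) := by
          gcongr
          exact exp_gaussian_le_of_sq_le hH0 hfar
      _ = _ := by ring
  have htail := norm_setIntegral_le_of_norm_le_gaussian (by positivity) hH0
    measurableSet_Ioc.compl hbound
  rw [intervalIntegral.integral_of_le (by linarith),
    eq_sub_of_add_eq (integral_add_compl measurableSet_Ioc hint), sub_right_comm]
  refine (norm_sub_le _ _).trans (add_le_add hmain (htail.trans_eq ?_))
  ring

lemma norm_dirichletPoly_le_two {r : ℕ → ℝ} (hr : ∀ n, |r n| ≤ 1) (N : ℕ) {z : ℂ}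
    (hz : 2 ≤ z.re) : ‖dirichletPoly r N z‖ ≤ 2 := by
  have hterm : ∀ n ∈ Finset.Icc 1 N, (n : ℝ) ^ (-z.re) ≤ 1 / (n : ℝ) ^ 2 := fun n hn ↦ by
    rw [one_div, ← Real.rpow_natCast, ← Real.rpow_neg n.cast_nonneg]
    refine Real.rpow_le_rpow_of_exponent_le
      (Nat.one_le_cast.mpr (Finset.mem_Icc.mp hn).1) (neg_le_neg ?_)
    exact_mod_cast hz
  calc ‖dirichletPoly r N z‖ ≤ ∑ n ∈ Finset.Icc 1 N, 1 / (n : ℝ) ^ 2 :=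
        (norm_dirichletPoly_le_sum hr N z).trans (Finset.sum_le_sum hterm)
    _ ≤ Real.pi ^ 2 / 6 :=
        hasSum_zeta_two.tsum_eq ▸ hasSum_zeta_two.summable.sum_le_tsum _ fun n _ ↦ by positivity
    _ ≤ 2 := by nlinarith [Real.pi_lt_d2, Real.pi_pos]

/- On `re s = -2` the factor `A(1/2 - s)` of the kernel is bounded, and only the other one grows. -/
lemma norm_resonatorKernel_neg_two_le {r : ℕ → ℝ} (hr : ∀ n, |r n| ≤ 1) (N : ℕ) {H : ℝ}
    (hH : 5 / 2 ≤ H) (T t : ℝ) :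
    ‖resonatorKernel r N H T (-2 + t * I)‖ ≤
      6 * (N : ℝ) ^ (7 / 2 : ℝ) * Real.exp (-(t - T) ^ 2 / H ^ 2) := by
  have hweight := norm_gaussian_weight_le (T := T) hH (s := -2 + t * I) (by simp) (by norm_num)
  have him : (-2 + t * I : ℂ).im = t := by simp
  rw [him] at hweight
  have hgrow : ‖dirichletPoly r N (-2 + t * I - 1 / 2)‖ ≤ (N : ℝ) ^ (7 / 2 : ℝ) := by
    refine (norm_dirichletPoly_le hr N (a := 5 / 2) (by norm_num) (by norm_num)).trans_eq ?_
    norm_num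
  have hbounded : ‖dirichletPoly r N (1 / 2 - (-2 + t * I))‖ ≤ 2 :=
    norm_dirichletPoly_le_two hr N (by norm_num)
  unfold resonatorKernel
  rw [norm_mul, norm_mul]
  calc _ ≤ (3 * Real.exp (-(t - T) ^ 2 / H ^ 2)) * ((N : ℝ) ^ (7 / 2 : ℝ) * 2) := by gcongr
    _ = _ := by ring

lemma exists_mul_rpow_le_norm_riemannZeta : ∃ k : ℝ, 0 < k ∧ ∀ t : ℝ, 1 ≤ t →
    k * t ^ (5 / 2 : ℝ) ≤ ‖riemannZeta (-2 + t * I)‖ := by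
  obtain ⟨k, hk, hle⟩ := exists_mul_pow_five_le_sq_norm_riemannZeta
  refine ⟨Real.sqrt k, Real.sqrt_pos.mpr hk, fun t ht ↦ ?_⟩
  refine (pow_le_pow_iff_left₀ (by positivity) (norm_nonneg _) two_ne_zero).mp ?_
  have hsq : (t ^ (5 / 2 : ℝ)) ^ 2 = t ^ 5 := by
    rw [← Real.rpow_mul_natCast (by linarith), ← Real.rpow_natCast]
    norm_num
  rw [mul_pow, Real.sq_sqrt hk.le, hsq]
  exact hle t ht

section

variable {r : ℕ → ℝ} (hr : ∀ n, |r n| ≤ 1) (N : ℕ) {H T k t : ℝ} (hH : 5 / 2 ≤ H) (hT : 0 < T)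
  (hk : 0 < k) (hzeta : k * t ^ (5 / 2 : ℝ) ≤ ‖riemannZeta (-2 + t * I)‖)

include hr hH hT hk hzeta

lemma norm_resonatorKernel_neg_two_div_le_of_le_half (ht : 1 ≤ t) (htT : t ≤ T / 2) :
    ‖resonatorKernel r N H T (-2 + t * I) / riemannZeta (-2 + t * I)‖ ≤
      36 / k * (N ^ 8 * Real.exp (-(T / H) ^ 2 / 8)) *
        Real.exp (-(1 / (2 * H ^ 2)) * (t - T) ^ 2) := by
  have hone : k ≤ ‖riemannZeta (-2 + t * I)‖ :=
    (le_mul_of_one_le_right hk.le (Real.one_le_rpow ht (by norm_num))).trans hzeta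
  have hkernel := norm_resonatorKernel_le hr N (T := T) hH (s := -2 + t * I)
    (by simp) (by norm_num)
  have him : (-2 + t * I : ℂ).im = t := by simp
  rw [him] at hkernel
  rw [norm_div, div_le_iff₀ (hk.trans_le hone)]
  set g := Real.exp (-(1 / (2 * H ^ 2)) * (t - T) ^ 2)
  calc _ ≤ 36 * N ^ 8 * (Real.exp (-(T / H) ^ 2 / 8) * g) := by
        refine hkernel.trans ?_
        gcongr
        · norm_num
        · exact exp_gaussian_le_of_sq_le (by linarith) (by nlinarith)
    _ = 36 / k * (N ^ 8 * Real.exp (-(T / H) ^ 2 / 8)) * g * k := by field_simp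
    _ ≤ _ := by gcongr

lemma norm_resonatorKernel_neg_two_div_le_of_half_le (htT : T / 2 ≤ t) :
    ‖resonatorKernel r N H T (-2 + t * I) / riemannZeta (-2 + t * I)‖ ≤
      36 / k * ((N : ℝ) ^ (7 / 2 : ℝ) / T ^ (5 / 2 : ℝ)) *
        Real.exp (-(1 / (2 * H ^ 2)) * (t - T) ^ 2) := by
  have hpow : T ^ (5 / 2 : ℝ) / 6 ≤ t ^ (5 / 2 : ℝ) := by
    have htwo : (2 : ℝ) ^ (5 / 2 : ℝ) ≤ 6 := by
      rw [← pow_le_pow_iff_left₀ (by positivity) (by norm_num) two_ne_zero,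
        ← Real.rpow_mul_natCast (by norm_num)]
      norm_num
    calc T ^ (5 / 2 : ℝ) / 6 ≤ T ^ (5 / 2 : ℝ) / 2 ^ (5 / 2 : ℝ) := by gcongr
      _ = (T / 2) ^ (5 / 2 : ℝ) := (Real.div_rpow hT.le zero_le_two _).symm
      _ ≤ t ^ (5 / 2 : ℝ) := by gcongr
  have hlower : k * (T ^ (5 / 2 : ℝ) / 6) ≤ ‖riemannZeta (-2 + t * I)‖ :=
    (mul_le_mul_of_nonneg_left hpow hk.le).trans hzeta
  rw [norm_div, div_le_iff₀ (lt_of_lt_of_le (by positivity) hlower)]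
  set g := Real.exp (-(1 / (2 * H ^ 2)) * (t - T) ^ 2)
  calc _ ≤ 6 * (N : ℝ) ^ (7 / 2 : ℝ) * g :=
        (norm_resonatorKernel_neg_two_le hr N hH T t).trans
          (by gcongr; exact exp_gaussian_le_half_gaussian H T t)
    _ = 36 / k * ((N : ℝ) ^ (7 / 2 : ℝ) / T ^ (5 / 2 : ℝ)) * g *
          (k * (T ^ (5 / 2 : ℝ) / 6)) := by
        field_simp
        ring
    _ ≤ _ := by gcongr

end

lemma exists_norm_integral_left_le : ∃ C : ℝ, 0 < C ∧
    ∀ (r : ℕ → ℝ) (N : ℕ) (H T t₀ t₁ : ℝ), (∀ n, |r n| ≤ 1) → 5 / 2 ≤ H → 0 < T → 1 ≤ t₀ →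
      t₀ ≤ t₁ →
      ‖∫ t in t₀..t₁, resonatorKernel r N H T (-2 + t * I) / riemannZeta (-2 + t * I)‖ ≤
        C * H * (N ^ 8 * Real.exp (-(T / H) ^ 2 / 8) +
          (N : ℝ) ^ (7 / 2 : ℝ) / T ^ (5 / 2 : ℝ)) := by
  obtain ⟨k, hk, hzeta⟩ := exists_mul_rpow_le_norm_riemannZeta
  refine ⟨108 / k, by positivity, fun r N H T t₀ t₁ hr hH hT ht₀ ht₀₁ ↦ ?_⟩
  set E := Real.exp (-(T / H) ^ 2 / 8)
  have hbound : ∀ t ∈ Ioc t₀ t₁,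
      ‖resonatorKernel r N H T (-2 + t * I) / riemannZeta (-2 + t * I)‖ ≤
        36 / k * (N ^ 8 * E + (N : ℝ) ^ (7 / 2 : ℝ) / T ^ (5 / 2 : ℝ)) *
          Real.exp (-(1 / (2 * H ^ 2)) * (t - T) ^ 2) := fun t ht ↦ by
    have ht1 : 1 ≤ t := ht₀.trans ht.1.le
    rcases le_total t (T / 2) with htT | htT
    · refine (norm_resonatorKernel_neg_two_div_le_of_le_half hr N hH hT hk (hzeta t ht1) ht1
        htT).trans ?_
      gcongr
      exact le_add_of_nonneg_right (by positivity)
    · refine (norm_resonatorKernel_neg_two_div_le_of_half_le hr N hH hT hk (hzeta t ht1)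
        htT).trans ?_
      gcongr
      exact le_add_of_nonneg_left (by positivity)
  rw [intervalIntegral.integral_of_le ht₀₁]
  refine (norm_setIntegral_le_of_norm_le_gaussian (by positivity) (by linarith)
    measurableSet_Ioc hbound).trans_eq ?_
  ring

/-! ### Lower bound for the sum over the zeros -/

lemma norm_integral_horizontal_le {r : ℕ → ℝ} (hr : ∀ n, |r n| ≤ 1) (N : ℕ) {H T t m : ℝ}
    (hH : 5 / 2 ≤ H) (hm : 0 < m) (hzeta : ∀ σ ∈ Icc (-2 : ℝ) 3, m ≤ ‖riemannZeta (σ + t * I)‖) :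
    ‖∫ σ in (-2 : ℝ)..3, resonatorKernel r N H T (σ + t * I) / riemannZeta (σ + t * I)‖ ≤
      15 * N ^ 8 * (Real.exp (-(t - T) ^ 2 / H ^ 2) / m) := by
  have hbound : ∀ σ ∈ uIoc (-2 : ℝ) 3,
      ‖resonatorKernel r N H T (σ + t * I) / riemannZeta (σ + t * I)‖ ≤
        3 * N ^ 8 * Real.exp (-(t - T) ^ 2 / H ^ 2) / m := fun σ hσ ↦ by
    rw [uIoc_of_le (by norm_num)] at hσ
    have hkernel := norm_resonatorKernel_le hr N (T := T) hH (s := σ + t * I)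
      (by simpa using hσ.1.le) (by simpa using hσ.2)
    have him : ((σ : ℂ) + t * I).im = t := by simp
    rw [him] at hkernel
    rw [norm_div]
    gcongr
    exact hzeta σ ⟨hσ.1.le, hσ.2⟩
  refine (intervalIntegral.norm_integral_le_of_norm_le_const hbound).trans_eq ?_
  norm_num
  ring

lemma exists_finset_zeros_rect {T₀ t₀ t₁ : ℝ} (hT₀ : T₀ ≤ t₀)
    (hline : ∀ ρ : ℂ, riemannZeta ρ = 0 → T₀ ≤ ρ.im → ρ.re = 1 / 2)
    (hbot : ∀ σ ∈ Icc (-2 : ℝ) 3, riemannZeta (σ + t₀ * I) ≠ 0)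
    (htop : ∀ σ ∈ Icc (-2 : ℝ) 3, riemannZeta (σ + t₁ * I) ≠ 0) :
    ∃ Z : Finset ℂ, (∀ ρ ∈ Z, riemannZeta ρ = 0 ∧ ρ.re = 1 / 2 ∧ t₀ < ρ.im ∧ ρ.im < t₁) ∧
      ∀ s ∈ Icc (-2 : ℝ) 3 ×ℂ Icc t₀ t₁, riemannZeta s = 0 → s ∈ Z := by
  have hfin : ((Icc (-2 : ℝ) 3 ×ℂ Icc t₀ t₁) ∩ riemannZetaZeros).Finite :=
    (isCompact_Icc.reProdIm isCompact_Icc).inter_riemannZetaZeros_finite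
  have hmem (ρ : ℂ) : ρ ∈ hfin.toFinset ↔
      ρ ∈ Icc (-2 : ℝ) 3 ×ℂ Icc t₀ t₁ ∧ riemannZeta ρ = 0 := by simp [riemannZetaZeros]
  refine ⟨hfin.toFinset, fun ρ hρ ↦ ?_, fun s hs hzero ↦ (hmem s).mpr ⟨hs, hzero⟩⟩
  obtain ⟨⟨hre, him⟩, hzero⟩ := (hmem ρ).mp hρ
  rw [mem_preimage] at hre him
  refine ⟨hzero, hline ρ hzero (hT₀.trans him.1), him.1.lt_of_ne fun h ↦ hbot ρ.re hre ?_,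
    him.2.lt_of_ne fun h ↦ htop ρ.re hre ?_⟩
  · rw [h, re_add_im, hzero]
  · rw [← h, re_add_im, hzero]

lemma norm_integral_right_le_of_rectIntegral_eq {f : ℂ → ℂ} {a b c d : ℝ} {S : ℂ}
    (h : rectIntegral f a b c d = 2 * Real.pi * I * S) :
    ‖∫ y : ℝ in c..d, f (b + y * I)‖ ≤
      2 * Real.pi * ‖S‖ + ‖∫ x : ℝ in a..b, f (x + c * I)‖ + ‖∫ x : ℝ in a..b, f (x + d * I)‖ +
        ‖∫ y : ℝ in c..d, f (a + y * I)‖ := by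
  unfold rectIntegral at h
  set right := ∫ y : ℝ in c..d, f (b + y * I)
  set left := ∫ y : ℝ in c..d, f (a + y * I)
  set bot := ∫ x : ℝ in a..b, f (x + c * I)
  set top := ∫ x : ℝ in a..b, f (x + d * I)
  have hIright : I * right = 2 * Real.pi * I * S - bot + top + I * left := by
    linear_combination h
  calc ‖right‖ = ‖I * right‖ := by simp
    _ ≤ ‖2 * Real.pi * I * S‖ + ‖bot‖ + ‖top‖ + ‖I * left‖ := by
        rw [hIright]
        exact (norm_add_le _ _).trans <| add_le_add_left ((norm_add_le _ _).trans <|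
          add_le_add_left (norm_sub_le _ _) _) _
    _ = _ := by simp [abs_of_pos Real.pi_pos]

lemma resonatorForm_le_sum_zeros_add_edges (r : ℕ → ℝ) (N : ℕ) (H T : ℝ) {t₀ t₁ : ℝ}
    (ht₀ : 0 < t₀) (ht₀₁ : t₀ ≤ t₁) {Z : Finset ℂ}
    (hZ : ∀ ρ ∈ Z, riemannZeta ρ = 0 ∧ ρ.re = 1 / 2 ∧ t₀ < ρ.im ∧ ρ.im < t₁)
    (hsimple : ∀ ρ ∈ Z, deriv riemannZeta ρ ≠ 0)
    (hall : ∀ s ∈ Icc (-2 : ℝ) 3 ×ℂ Icc t₀ t₁, riemannZeta s = 0 → s ∈ Z) :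
    Real.sqrt Real.pi * H * resonatorForm r N ≤
      2 * Real.pi * ∑ ρ ∈ Z, Real.exp (-(ρ.im - T) ^ 2 / H ^ 2) *
          ‖resonator r N ρ.im‖ ^ 2 / ‖deriv riemannZeta ρ‖ +
        ‖∫ σ in (-2 : ℝ)..3, resonatorKernel r N H T (σ + t₀ * I) / riemannZeta (σ + t₀ * I)‖ +
        ‖∫ σ in (-2 : ℝ)..3, resonatorKernel r N H T (σ + t₁ * I) / riemannZeta (σ + t₁ * I)‖ +
        ‖∫ t in t₀..t₁, resonatorKernel r N H T (-2 + t * I) / riemannZeta (-2 + t * I)‖ +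
        ‖(∫ t in t₀..t₁, resonatorKernel r N H T (3 + t * I) / riemannZeta (3 + t * I)) -
          (Real.sqrt Real.pi * H * resonatorForm r N : ℝ)‖ := by
  have hresidue := rectIntegral_div_eq_sum (U := {1}ᶜ) isOpen_compl_singleton (by norm_num) ht₀₁
    (fun s hs hs1 ↦ by
      have him : t₀ ≤ s.im := hs.2.1
      rw [mem_singleton_iff.mp hs1, one_im] at him
      linarith)
    differentiableOn_riemannZeta_compl (differentiable_resonatorKernel r N H T).differentiableOn
    (fun ρ hρ ↦ by
      obtain ⟨hzero, hre, hlo, hhi⟩ := hZ ρ hρ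
      exact ⟨hzero, hsimple ρ hρ, by rw [hre]; norm_num, by rw [hre]; norm_num, hlo, hhi⟩) hall
  have hsum : ‖∑ ρ ∈ Z, resonatorKernel r N H T ρ / deriv riemannZeta ρ‖ ≤
      ∑ ρ ∈ Z, Real.exp (-(ρ.im - T) ^ 2 / H ^ 2) * ‖resonator r N ρ.im‖ ^ 2 /
        ‖deriv riemannZeta ρ‖ := by
    refine norm_sum_le_of_le Z fun ρ hρ ↦ ?_
    rw [norm_div, resonatorKernel_of_re_eq_half _ _ _ _ (hZ ρ hρ).2.1, norm_real,
      Real.norm_of_nonneg (by positivity)]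
  have hedges := norm_integral_right_le_of_rectIntegral_eq hresidue
  push_cast at hedges
  set right := ∫ t : ℝ in t₀..t₁, resonatorKernel r N H T (3 + t * I) / riemannZeta (3 + t * I)
  have hform : Real.sqrt Real.pi * H * resonatorForm r N ≤
      ‖right‖ + ‖right - (Real.sqrt Real.pi * H * resonatorForm r N : ℝ)‖ := by
    refine (le_abs_self _).trans ?_
    rw [← Real.norm_eq_abs, ← norm_real]
    simpa using norm_sub_le right (right - (Real.sqrt Real.pi * H * resonatorForm r N : ℝ))
  have := mul_le_mul_of_nonneg_left hsum Real.two_pi_pos.le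
  linarith

lemma eventually_mul_pow_mul_exp_le {A B : ℝ} (hA : 0 ≤ A) (k : ℕ) :
    ∀ᶠ X : ℕ in atTop,
      A * (X : ℝ) ^ k * Real.exp (-(X : ℝ) ^ 2 / 32) + B / (X : ℝ) ^ 2 ≤ 1 := by
  have hlim : Tendsto (fun x : ℝ ↦ A * Real.exp 8 * (x ^ k * Real.exp (-x)) + B / x ^ 2)
      atTop (𝓝 0) := by
    simpa using ((Real.tendsto_pow_mul_exp_neg_atTop_nhds_zero k).const_mul (A * Real.exp 8)).add
      ((tendsto_const_nhds (x := B)).div_atTop (tendsto_pow_atTop two_ne_zero))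
  filter_upwards [(hlim.comp tendsto_natCast_atTop_atTop).eventually_le_const zero_lt_one]
    with X hX
  refine le_trans ?_ hX
  have hexp : Real.exp (-(X : ℝ) ^ 2 / 32) ≤ Real.exp 8 * Real.exp (-(X : ℝ)) := by
    rw [← Real.exp_add, Real.exp_le_exp]
    nlinarith [sq_nonneg ((X : ℝ) - 16)]
  simp only [Function.comp_apply]
  calc _ ≤ A * (X : ℝ) ^ k * (Real.exp 8 * Real.exp (-(X : ℝ))) + B / (X : ℝ) ^ 2 := by gcongr
    _ = _ := by ring

lemma exp_gaussian_bottom_le {x t : ℝ} (hx : 1 ≤ x) (ht : t ≤ x ^ 12 / 2) :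
    Real.exp (-(t - x ^ 12) ^ 2 / (x ^ 9) ^ 2) ≤ Real.exp (-x ^ 2 / 32) := by
  have hfar : (x ^ 12 / 2) ^ 2 ≤ (t - x ^ 12) ^ 2 := by
    nlinarith [pow_pos (zero_lt_one.trans_le hx) 12]
  have hpow : x ^ 20 ≤ x ^ 24 := pow_le_pow_right₀ hx (by norm_num)
  rw [Real.exp_le_exp, div_le_iff₀ (by positivity)]
  nlinarith [pow_pos (zero_lt_one.trans_le hx) 24]

lemma exp_gaussian_top_div_le {x t K : ℝ} (hx : 4 ≤ x) (hK : 0 ≤ K) (hKx : 192 * K ≤ x)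
    (ht : x ^ 24 ≤ t) :
    Real.exp (-(t - x ^ 12) ^ 2 / (x ^ 9) ^ 2) /
      Real.exp (-(K * x ^ 24 * Real.log (x ^ 24))) ≤ Real.exp (-x ^ 2 / 32) := by
  have hx1 : 1 ≤ x := by linarith
  have hdist : x ^ 24 / 2 ≤ t - x ^ 12 := by
    have : 2 * x ^ 12 ≤ x ^ 12 * x ^ 12 := by
      gcongr
      linarith [le_self_pow₀ hx1 (show 12 ≠ 0 by norm_num)]
    linarith
  have hfar : x ^ 30 / 4 ≤ (t - x ^ 12) ^ 2 / (x ^ 9) ^ 2 := by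
    rw [le_div_iff₀ (by positivity)]
    calc x ^ 30 / 4 * (x ^ 9) ^ 2 = (x ^ 24 / 2) ^ 2 := by ring
      _ ≤ (t - x ^ 12) ^ 2 := by gcongr
  have hlog : K * x ^ 24 * Real.log (x ^ 24) ≤ x ^ 30 / 8 := by
    have hlogx : Real.log x ≤ x := (Real.log_le_sub_one_of_pos (by linarith)).trans (by linarith)
    rw [Real.log_pow]
    calc K * x ^ 24 * ((24 : ℕ) * Real.log x) ≤ K * x ^ 24 * ((24 : ℕ) * x) := by gcongr
      _ = 192 * K * x ^ 25 / 8 := by push_cast; ring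
      _ ≤ x ^ 5 * x ^ 25 / 8 := by
          gcongr
          exact hKx.trans (le_self_pow₀ hx1 (by norm_num))
      _ = _ := by ring
  have hpow : x ^ 2 ≤ x ^ 30 := pow_le_pow_right₀ hx1 (by norm_num)
  rw [← Real.exp_sub, Real.exp_le_exp, neg_div]
  have : 0 ≤ x ^ 30 := by positivity
  linarith

section

variable {r : ℕ → ℝ} (hr : ∀ n, |r n| ≤ 1) {X : ℕ} (hX : 4 ≤ X)

include hX

lemma five_half_le_natCast_pow_nine : 5 / 2 ≤ (X : ℝ) ^ 9 := by
  have hx : (4 : ℝ) ≤ X := Nat.ofNat_le_cast.mpr hX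
  have := le_self_pow₀ (show (1 : ℝ) ≤ X by linarith) (show 9 ≠ 0 by norm_num)
  linarith

include hr

lemma norm_integral_right_sub_le_of_pow {t₀ t₁ : ℝ} (ht₀ : t₀ ≤ (X : ℝ) ^ 12 / 2)
    (ht₁ : (X : ℝ) ^ 24 ≤ t₁) :
    ‖(∫ t in t₀..t₁, resonatorKernel r (X ^ 8) (X ^ 9 : ℝ) (X ^ 12 : ℝ) (3 + t * I) /
        riemannZeta (3 + t * I)) -
      (Real.sqrt Real.pi * X ^ 9 * resonatorForm r (X ^ 8) : ℝ)‖ ≤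
      22 * X ^ 64 * Real.exp (-(X : ℝ) ^ 2 / 32) * X ^ 9 := by
  have hx : (4 : ℝ) ≤ X := Nat.ofNat_le_cast.mpr hX
  have hx1 : (1 : ℝ) ≤ X := by linarith
  have hcross : 32 * ((X ^ 8 : ℕ) : ℝ) ≤ ((X : ℝ) ^ 9) ^ 2 := by
    have h32 : 32 ≤ (X : ℝ) ^ 10 := by
      linarith [pow_le_pow_left₀ (by norm_num) hx 10]
    push_cast
    calc 32 * (X : ℝ) ^ 8 ≤ X ^ 10 * X ^ 8 := by gcongr
      _ = _ := by ring
  have htop : 2 * (X : ℝ) ^ 12 ≤ t₁ := by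
    refine le_trans ?_ ht₁
    calc 2 * (X : ℝ) ^ 12 ≤ X ^ 12 * X ^ 12 := by
          gcongr
          linarith [le_self_pow₀ hx1 (show 12 ≠ 0 by norm_num)]
      _ = _ := by ring
  refine (norm_integral_right_sub_le hr (five_half_le_natCast_pow_nine hX) hcross (by positivity)
    ht₀ htop).trans ?_
  have hHN : (X : ℝ) ^ 9 / (X ^ 8 : ℕ) = X := by push_cast; field_simp
  have hTH : (X : ℝ) ^ 12 / X ^ 9 = X ^ 3 := by field_simp
  have hexp : Real.exp (-((X : ℝ) ^ 3) ^ 2 / 8) ≤ Real.exp (-(X : ℝ) ^ 2 / 32) := by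
    rw [Real.exp_le_exp]
    nlinarith [pow_le_pow_right₀ hx1 (show 2 ≤ 6 by norm_num), sq_nonneg (X : ℝ)]
  have hpow : (X : ℝ) ^ 32 ≤ X ^ 64 := pow_le_pow_right₀ hx1 (by norm_num)
  rw [hHN, hTH]
  set E := Real.exp (-(X : ℝ) ^ 2 / 32)
  push_cast
  calc _ ≤ 4 * (X : ℝ) ^ 9 * (X ^ 8) ^ 4 * E + 18 * (X ^ 8) ^ 8 * X ^ 9 * E := by gcongr
    _ = (4 * (X : ℝ) ^ 32 + 18 * X ^ 64) * E * X ^ 9 := by ring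
    _ ≤ (4 * (X : ℝ) ^ 64 + 18 * X ^ 64) * E * X ^ 9 := by gcongr
    _ = _ := by ring

lemma norm_integral_bottom_le {t₀ m : ℝ} (ht₀ : t₀ ≤ (X : ℝ) ^ 12 / 2) (hm : 0 < m)
    (hzeta : ∀ σ ∈ Icc (-2 : ℝ) 3, m ≤ ‖riemannZeta (σ + t₀ * I)‖) :
    ‖∫ σ in (-2 : ℝ)..3, resonatorKernel r (X ^ 8) (X ^ 9 : ℝ) (X ^ 12 : ℝ) (σ + t₀ * I) /
        riemannZeta (σ + t₀ * I)‖ ≤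
      15 / m * X ^ 64 * Real.exp (-(X : ℝ) ^ 2 / 32) * X ^ 9 := by
  have hx1 : (1 : ℝ) ≤ X := Nat.one_le_cast.mpr (by lia)
  refine (norm_integral_horizontal_le hr _ (five_half_le_natCast_pow_nine hX) hm hzeta).trans ?_
  set E := Real.exp (-(X : ℝ) ^ 2 / 32)
  push_cast
  calc _ ≤ 15 * ((X : ℝ) ^ 8) ^ 8 * (E / m) := by
        gcongr
        exact exp_gaussian_bottom_le hx1 ht₀
    _ = 15 / m * X ^ 64 * E := by ring
    _ ≤ _ := le_mul_of_one_le_right (by positivity) (one_le_pow₀ hx1)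

lemma norm_integral_top_le {t₁ K : ℝ} (hK : 0 ≤ K) (hKX : 192 * K ≤ X) (ht₁ : (X : ℝ) ^ 24 ≤ t₁)
    (hzeta : ∀ σ ∈ Icc (-2 : ℝ) 3,
      Real.exp (-(K * X ^ 24 * Real.log (X ^ 24))) ≤ ‖riemannZeta (σ + t₁ * I)‖) :
    ‖∫ σ in (-2 : ℝ)..3, resonatorKernel r (X ^ 8) (X ^ 9 : ℝ) (X ^ 12 : ℝ) (σ + t₁ * I) /
        riemannZeta (σ + t₁ * I)‖ ≤
      15 * X ^ 64 * Real.exp (-(X : ℝ) ^ 2 / 32) * X ^ 9 := by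
  have hx : (4 : ℝ) ≤ X := Nat.ofNat_le_cast.mpr hX
  refine (norm_integral_horizontal_le hr _ (five_half_le_natCast_pow_nine hX) (Real.exp_pos _)
    hzeta).trans ?_
  set E := Real.exp (-(X : ℝ) ^ 2 / 32)
  push_cast
  calc _ ≤ 15 * ((X : ℝ) ^ 8) ^ 8 * E := by
        gcongr
        exact exp_gaussian_top_div_le hx hK hKX ht₁
    _ = 15 * X ^ 64 * E := by ring
    _ ≤ _ := le_mul_of_one_le_right (by positivity) (one_le_pow₀ (by linarith))

end

lemma exists_norm_integral_left_le_of_pow : ∃ C : ℝ, 0 < C ∧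
    ∀ (r : ℕ → ℝ) (X : ℕ) (t₀ t₁ : ℝ), (∀ n, |r n| ≤ 1) → 4 ≤ X → 1 ≤ t₀ → t₀ ≤ t₁ →
      ‖∫ t in t₀..t₁, resonatorKernel r (X ^ 8) (X ^ 9 : ℝ) (X ^ 12 : ℝ) (-2 + t * I) /
          riemannZeta (-2 + t * I)‖ ≤
        (C * X ^ 64 * Real.exp (-(X : ℝ) ^ 2 / 32) + C / X ^ 2) * X ^ 9 := by
  obtain ⟨C, hC, hleft⟩ := exists_norm_integral_left_le
  refine ⟨C, hC, fun r X t₀ t₁ hr hX ht₀ ht₀₁ ↦ ?_⟩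
  have hx1 : (1 : ℝ) ≤ X := Nat.one_le_cast.mpr (by lia)
  have hx0 : (0 : ℝ) < X := by linarith
  refine (hleft r (X ^ 8) (X ^ 9) (X ^ 12) t₀ t₁ hr (five_half_le_natCast_pow_nine hX)
    (by positivity) ht₀ ht₀₁).trans ?_
  have hTH : (X : ℝ) ^ 12 / X ^ 9 = X ^ 3 := by field_simp
  have hexp : Real.exp (-((X : ℝ) ^ 3) ^ 2 / 8) ≤ Real.exp (-(X : ℝ) ^ 2 / 32) := by
    rw [Real.exp_le_exp]
    nlinarith [pow_le_pow_right₀ hx1 (show 2 ≤ 6 by norm_num), sq_nonneg (X : ℝ)]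
  have hratio : ((X ^ 8 : ℕ) : ℝ) ^ (7 / 2 : ℝ) / ((X : ℝ) ^ 12) ^ (5 / 2 : ℝ) = 1 / X ^ 2 := by
    have hnum : ((X : ℝ) ^ 8) ^ (7 / 2 : ℝ) = X ^ 28 := by
      rw [← Real.rpow_natCast_mul hx0.le, ← Real.rpow_natCast]
      norm_num
    have hden : ((X : ℝ) ^ 12) ^ (5 / 2 : ℝ) = X ^ 30 := by
      rw [← Real.rpow_natCast_mul hx0.le, ← Real.rpow_natCast]
      norm_num
    push_cast
    rw [hnum, hden]
    field_simp
  rw [hTH, hratio]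
  set E := Real.exp (-(X : ℝ) ^ 2 / 32)
  push_cast
  calc _ ≤ C * (X : ℝ) ^ 9 * ((X ^ 8) ^ 8 * E + 1 / X ^ 2) := by gcongr
    _ = _ := by ring

lemma exists_zeros_resonatorForm_le {T₀ : ℝ}
    (hline : ∀ ρ : ℂ, riemannZeta ρ = 0 → T₀ ≤ ρ.im → ρ.re = 1 / 2)
    (hsimple : ∀ ρ : ℂ, riemannZeta ρ = 0 → T₀ ≤ ρ.im → deriv riemannZeta ρ ≠ 0) :
    ∀ᶠ X : ℕ in atTop, ∀ r : ℕ → ℝ, (∀ n, |r n| ≤ 1) → ∃ Z : Finset ℂ,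
      (∀ ρ ∈ Z, riemannZeta ρ = 0 ∧ ρ.re = 1 / 2 ∧ T₀ ≤ ρ.im ∧ ρ.im ≤ (X : ℝ) ^ 24 + 1) ∧
      Real.sqrt Real.pi * (X : ℝ) ^ 9 * resonatorForm r (X ^ 8) - (X : ℝ) ^ 9 ≤
        2 * Real.pi * ∑ ρ ∈ Z, Real.exp (-(ρ.im - (X : ℝ) ^ 12) ^ 2 / ((X : ℝ) ^ 9) ^ 2) *
          ‖resonator r (X ^ 8) ρ.im‖ ^ 2 / ‖deriv riemannZeta ρ‖ := by
  obtain ⟨K, hK1, hheight⟩ := exists_height_riemannZeta_ge T₀ hsimple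
  obtain ⟨C, hC, hleft⟩ := exists_norm_integral_left_le_of_pow
  set τ := max 10 (T₀ + 7)
  obtain ⟨t₀, ht₀, hbot⟩ := hheight τ (le_max_left _ _) (le_max_right _ _)
  set m := Real.exp (-(K * τ * Real.log τ))
  have hm : 0 < m := Real.exp_pos _
  have ht₀10 : 10 ≤ t₀ := (le_max_left _ _).trans ht₀.1
  have ht₀T : T₀ + 7 ≤ t₀ := (le_max_right _ _).trans ht₀.1
  filter_upwards [eventually_mul_pow_mul_exp_le (A := 22 + C + 15 / m + 15) (B := C)
    (by positivity) 64, eventually_ge_atTop 4,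
    tendsto_natCast_atTop_atTop.eventually_ge_atTop (192 * K),
    tendsto_natCast_atTop_atTop.eventually_ge_atTop (2 * t₀)] with X hsmall hX hKX ht₀X r hr
  have hx1 : (1 : ℝ) ≤ X := Nat.one_le_cast.mpr (by lia)
  have hpow {k : ℕ} (hk : k ≠ 0) : (X : ℝ) ≤ X ^ k := le_self_pow₀ hx1 hk
  have ht₀12 : t₀ ≤ (X : ℝ) ^ 12 / 2 := by linarith [hpow (show 12 ≠ 0 by norm_num)]
  have hX24 : 2 * t₀ ≤ (X : ℝ) ^ 24 := ht₀X.trans (hpow (by norm_num))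
  obtain ⟨t₁, ht₁, htop⟩ := hheight ((X : ℝ) ^ 24) (by linarith) (by linarith)
  have ht₀₁ : t₀ ≤ t₁ := by linarith [ht₁.1]
  obtain ⟨Z, hZ, hall⟩ := exists_finset_zeros_rect (by linarith) hline
    (fun σ hσ ↦ norm_pos_iff.mp (hm.trans_le (hbot σ hσ)))
    (fun σ hσ ↦ norm_pos_iff.mp ((Real.exp_pos _).trans_le (htop σ hσ)))
  refine ⟨Z, fun ρ hρ ↦ ?_, ?_⟩
  · obtain ⟨hzero, hre, hlo, hhi⟩ := hZ ρ hρ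
    exact ⟨hzero, hre, by linarith, by linarith [ht₁.2]⟩
  have hform := resonatorForm_le_sum_zeros_add_edges r (X ^ 8) (X ^ 9) (X ^ 12) (by linarith)
    ht₀₁ hZ (fun ρ hρ ↦ hsimple ρ (hZ ρ hρ).1 (by linarith [(hZ ρ hρ).2.2.1])) hall
  have hrightE := norm_integral_right_sub_le_of_pow hr hX ht₀12 ht₁.1
  have hleftE := hleft r X t₀ t₁ hr hX (by linarith) ht₀₁
  have hbotE := norm_integral_bottom_le hr hX ht₀12 hm hbot
  have htopE := norm_integral_top_le hr hX (by linarith) hKX ht₁.1 htop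
  have herror := mul_le_mul_of_nonneg_right hsmall (show 0 ≤ (X : ℝ) ^ 9 by positivity)
  linarith

/-! ### Sums over primes -/

/-- The partial sum over the primes up to `n` in Mertens' first theorem. -/
noncomputable def mertensSum (n : ℕ) : ℝ :=
  ∑ p ∈ Finset.Ioc 0 n with p.Prime, Real.log p / p

lemma log_factorial_eq_sum (n : ℕ) : Real.log (n.factorial : ℝ) =
    ∑ p ∈ Finset.Ioc 0 n with p.Prime, (padicValNat p n.factorial : ℝ) * Real.log p := by
  have hsupport : n.factorial.factorization.support ⊆ {p ∈ Finset.Ioc 0 n | p.Prime} :=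
    fun p hp ↦ by
      rw [Nat.support_factorization, Nat.mem_primeFactors] at hp
      rw [Finset.mem_filter, Finset.mem_Ioc]
      exact ⟨⟨hp.1.pos, (Nat.Prime.dvd_factorial hp.1).mp hp.2.1⟩, hp.1⟩
  rw [Real.log_nat_eq_sum_factorization, Finsupp.sum, Finset.sum_subset hsupport
    fun p _ hp ↦ by rw [Finsupp.notMem_support_iff.mp hp, Nat.cast_zero, zero_mul]]
  refine Finset.sum_congr rfl fun p hp ↦ ?_
  rw [Nat.factorization_def _ (Finset.mem_filter.mp hp).2]

lemma div_le_padicValNat_factorial_add_one (n : ℕ) {p : ℕ} (hp : p.Prime) :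
    (n : ℝ) / p ≤ padicValNat p n.factorial + 1 := by
  have : Fact p.Prime := ⟨hp⟩
  have hfirst : n / p ≤ padicValNat p n.factorial := by
    rw [padicValNat_factorial (b := Nat.log p n + 2) (by lia)]
    simpa using Finset.single_le_sum (f := fun i ↦ n / p ^ i)
      (s := Finset.Ico 1 (Nat.log p n + 2)) (fun _ _ ↦ Nat.zero_le _) (show 1 ∈ _ by simp)
  calc (n : ℝ) / p ≤ ((n / p : ℕ) : ℝ) + 1 := by
        rw [← Nat.floor_div_eq_div (K := ℝ)]
        exact (Nat.lt_floor_add_one _).le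
    _ ≤ _ := by gcongr

lemma padicValNat_factorial_le_div {n : ℕ} (hn : n ≠ 0) {p : ℕ} (hp : p.Prime) :
    (padicValNat p n.factorial : ℝ) ≤ n / (p - 1) := by
  have : Fact p.Prime := ⟨hp⟩
  have hp1 : (1 : ℝ) < p := Nat.one_lt_cast.mpr hp.one_lt
  have hle : (((p - 1) * padicValNat p n.factorial : ℕ) : ℝ) ≤ n :=
    Nat.cast_le.mpr (sub_one_mul_padicValNat_factorial_lt_of_ne_zero p hn).le
  rw [Nat.cast_mul, Nat.cast_sub hp.one_le, Nat.cast_one] at hle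
  rw [le_div_iff₀ (by linarith)]
  linarith

lemma mertensSum_le {n : ℕ} (hn : n ≠ 0) : mertensSum n ≤ Real.log n + Real.log 4 := by
  have htheta := Chebyshev.theta_le_log4_mul_x (x := n) (by positivity)
  rw [Chebyshev.theta, Nat.floor_natCast] at htheta
  have hmertens : n * mertensSum n ≤
      Real.log (n.factorial : ℝ) + ∑ p ∈ Finset.Ioc 0 n with p.Prime, Real.log p := by
    rw [log_factorial_eq_sum, mertensSum, Finset.mul_sum, ← Finset.sum_add_distrib]
    refine Finset.sum_le_sum fun p hp ↦ ?_
    have : 0 ≤ Real.log p := Real.log_natCast_nonneg p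
    calc n * (Real.log p / p) = n / p * Real.log p := by ring
      _ ≤ (padicValNat p n.factorial + 1) * Real.log p := by
          gcongr
          exact div_le_padicValNat_factorial_add_one n (Finset.mem_filter.mp hp).2
      _ = _ := by ring
  have hfactorial : Real.log (n.factorial : ℝ) ≤ n * Real.log n := by
    rw [← Real.log_pow]
    exact Real.log_le_log (by positivity) (by exact_mod_cast Nat.factorial_le_pow n)
  refine le_of_mul_le_mul_left (a := (n : ℝ)) ?_ (by positivity)
  linarith

lemma log_div_mul_sub_one_le {x : ℝ} (hx : 2 ≤ x) :
    Real.log x / (x * (x - 1)) ≤ 4 * (x ^ (3 / 2 : ℝ))⁻¹ := by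
  have hx0 : 0 < x := by linarith
  have hsqrt : 0 < Real.sqrt x := Real.sqrt_pos.mpr hx0
  have hlog : Real.log x ≤ 2 * Real.sqrt x := by
    have hhalf : Real.log x = 2 * Real.log (Real.sqrt x) := by
      rw [Real.log_sqrt hx0.le]
      ring
    linarith [Real.log_le_sub_one_of_pos hsqrt]
  have hpow : x ^ (3 / 2 : ℝ) = x * Real.sqrt x := by
    rw [show (3 / 2 : ℝ) = 1 + 1 / 2 by norm_num, Real.rpow_add hx0, Real.rpow_one,
      Real.sqrt_eq_rpow]
  rw [hpow, ← div_eq_mul_inv, div_le_div_iff₀ (by nlinarith) (by positivity)]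
  calc Real.log x * (x * Real.sqrt x) ≤ 2 * Real.sqrt x * (x * Real.sqrt x) := by gcongr
    _ = 2 * x * Real.sqrt x ^ 2 := by ring
    _ = 2 * x * x := by rw [Real.sq_sqrt hx0.le]
    _ ≤ 4 * (x * (x - 1)) := by nlinarith

lemma log_factorial_le_mul_mertensSum_add {n : ℕ} (hn : n ≠ 0) :
    Real.log (n.factorial : ℝ) ≤ n * (mertensSum n + ∑' m : ℕ, 4 * ((m : ℝ) ^ (3 / 2 : ℝ))⁻¹) := by
  have hsum : Summable fun m : ℕ ↦ 4 * ((m : ℝ) ^ (3 / 2 : ℝ))⁻¹ :=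
    (Real.summable_nat_rpow_inv.mpr (by norm_num)).mul_left 4
  have hfinite : Real.log (n.factorial : ℝ) ≤
      n * (mertensSum n +
        ∑ p ∈ Finset.Ioc 0 n with p.Prime, 4 * ((p : ℝ) ^ (3 / 2 : ℝ))⁻¹) := by
    rw [log_factorial_eq_sum, mertensSum, ← Finset.sum_add_distrib, Finset.mul_sum]
    refine Finset.sum_le_sum fun p hp ↦ ?_
    have hprime := (Finset.mem_filter.mp hp).2
    have hp2 : (2 : ℝ) ≤ p := Nat.ofNat_le_cast.mpr hprime.two_le
    have : 0 ≤ Real.log p := Real.log_natCast_nonneg p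
    calc _ ≤ n / (p - 1) * Real.log p := by
          gcongr
          exact padicValNat_factorial_le_div hn hprime
      _ = n * (Real.log p / p + Real.log p / (p * (p - 1))) := by
          have : (p : ℝ) - 1 ≠ 0 := by linarith
          field_simp
          ring
      _ ≤ _ := by
          gcongr
          exact log_div_mul_sub_one_le hp2
  refine hfinite.trans ?_
  gcongr
  exact hsum.sum_le_tsum _ fun m _ ↦ by positivity

lemma exists_log_le_mertensSum :
    ∃ C : ℝ, 0 ≤ C ∧ ∀ n : ℕ, n ≠ 0 → Real.log n - C ≤ mertensSum n := by
  refine ⟨1 + ∑' m : ℕ, 4 * ((m : ℝ) ^ (3 / 2 : ℝ))⁻¹,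
    add_nonneg zero_le_one (tsum_nonneg fun m ↦ by positivity), fun n hn ↦ ?_⟩
  have hupper := log_factorial_le_mul_mertensSum_add hn
  have hstirling := Stirling.le_log_factorial_stirling hn
  have hlogn : 0 ≤ Real.log n := Real.log_natCast_nonneg n
  have hlogpi : 0 ≤ Real.log (2 * Real.pi) := Real.log_nonneg (by linarith [Real.pi_gt_three])
  refine le_of_mul_le_mul_left (a := (n : ℝ)) ?_ (by positivity)
  linarith

/-- The primes `p` with `u < log p ≤ v`; the range of `p` is measured on a logarithmic scale because
the resonator is supported on products of such primes. -/
noncomputable def primesBetween (u v : ℝ) : Finset ℕ :=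
  {p ∈ Finset.Ioc ⌊Real.exp u⌋₊ ⌊Real.exp v⌋₊ | p.Prime}

lemma mem_primesBetween {u v : ℝ} {p : ℕ} :
    p ∈ primesBetween u v ↔ p.Prime ∧ u < Real.log p ∧ Real.log p ≤ v := by
  rw [primesBetween, Finset.mem_filter, Finset.mem_Ioc, and_comm]
  refine and_congr_right fun hp ↦ ?_
  have hp0 : (0 : ℝ) < p := Nat.cast_pos.mpr hp.pos
  rw [Nat.floor_lt (Real.exp_pos u).le, Nat.le_floor_iff (Real.exp_pos v).le,
    Real.lt_log_iff_exp_lt hp0, Real.log_le_iff_le_exp hp0]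

lemma sum_primesBetween_add {M : Type*} [AddCommMonoid M] (F : ℕ → M) {u v w : ℝ} (huv : u ≤ v)
    (hvw : v ≤ w) :
    ∑ p ∈ primesBetween u w, F p =
      ∑ p ∈ primesBetween u v, F p + ∑ p ∈ primesBetween v w, F p := by
  simp only [primesBetween, Finset.sum_filter]
  exact (Finset.sum_Ioc_consecutive _ (Nat.floor_le_floor (Real.exp_le_exp.mpr huv))
    (Nat.floor_le_floor (Real.exp_le_exp.mpr hvw))).symm

lemma exists_le_sum_primesBetween_log_div : ∃ C : ℝ, 0 ≤ C ∧ ∀ u v : ℝ, 0 ≤ u → u ≤ v →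
    v - u - C ≤ ∑ p ∈ primesBetween u v, Real.log p / p := by
  obtain ⟨C, hC0, hlower⟩ := exists_log_le_mertensSum
  refine ⟨C + Real.log 2 + Real.log 4, by positivity, fun u v hu huv ↦ ?_⟩
  have hfloor : ⌊Real.exp u⌋₊ ≤ ⌊Real.exp v⌋₊ := Nat.floor_le_floor (Real.exp_le_exp.mpr huv)
  have honeu : 1 ≤ ⌊Real.exp u⌋₊ := Nat.le_floor (by simpa using Real.one_le_exp hu)
  have honev : (1 : ℝ) ≤ ⌊Real.exp v⌋₊ := Nat.one_le_cast.mpr (honeu.trans hfloor)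
  have hsplit : mertensSum ⌊Real.exp v⌋₊ =
      mertensSum ⌊Real.exp u⌋₊ + ∑ p ∈ primesBetween u v, Real.log p / p := by
    simp only [mertensSum, primesBetween, Finset.sum_filter]
    rw [Finset.sum_Ioc_consecutive _ (Nat.zero_le _) hfloor]
  have hupperu := mertensSum_le (n := ⌊Real.exp u⌋₊) (by lia)
  have hlowerv := hlower ⌊Real.exp v⌋₊ (by lia)
  have hlogu : Real.log ⌊Real.exp u⌋₊ ≤ u := by
    rw [Real.log_le_iff_le_exp (Nat.cast_pos.mpr honeu)]
    exact Nat.floor_le (Real.exp_pos u).le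
  have hlogv : v ≤ Real.log 2 + Real.log ⌊Real.exp v⌋₊ := by
    rw [← Real.log_mul (by norm_num) (by linarith), Real.le_log_iff_exp_le (by linarith)]
    linarith [Nat.lt_floor_add_one (Real.exp v)]
  linarith

/-- The sum of `1 / (p log p)` over the primes with `u < log p ≤ v`. -/
noncomputable def invLogSum (u v : ℝ) : ℝ := ∑ p ∈ primesBetween u v, 1 / (p * Real.log p)

lemma exists_div_sq_le_invLogSum : ∃ C : ℝ, 0 ≤ C ∧ ∀ u v : ℝ, 0 < u → u ≤ v →
    (v - u - C) / v ^ 2 ≤ invLogSum u v := by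
  obtain ⟨C, hC, hlower⟩ := exists_le_sum_primesBetween_log_div
  refine ⟨C, hC, fun u v hu huv ↦ ?_⟩
  have hv : 0 < v := hu.trans_le huv
  rw [div_le_iff₀ (by positivity), invLogSum, Finset.sum_mul]
  refine (hlower u v hu.le huv).trans (Finset.sum_le_sum fun p hp ↦ ?_)
  obtain ⟨hprime, hlo, hhi⟩ := mem_primesBetween.mp hp
  have hp0 : (0 : ℝ) < p := Nat.cast_pos.mpr hprime.pos
  have hlog : 0 < Real.log p := hu.trans hlo
  rw [div_mul_eq_mul_div, one_mul, div_le_div_iff₀ hp0 (by positivity)]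
  calc Real.log p * (p * Real.log p) = p * Real.log p ^ 2 := by ring
    _ ≤ p * v ^ 2 := by gcongr
    _ = _ := by ring

/- Partial summation with the geometric scale `u, q u, q² u, …` in place of an integral. -/
lemma exists_geometric_le_invLogSum : ∃ C : ℝ, 0 ≤ C ∧ ∀ q u : ℝ, 1 ≤ q → 0 < u → ∀ K : ℕ,
    (1 - q⁻¹ ^ K) / (q * u) - C * K / u ^ 2 ≤ invLogSum u (q ^ K * u) := by
  obtain ⟨C, hC, hblock⟩ := exists_div_sq_le_invLogSum
  refine ⟨C, hC, fun q u hq hu K ↦ ?_⟩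
  have : 0 < q := by linarith
  induction K with
  | zero =>
    have : 0 ≤ invLogSum u (q ^ 0 * u) := Finset.sum_nonneg fun p _ ↦
      one_div_nonneg.mpr (mul_nonneg p.cast_nonneg (Real.log_natCast_nonneg p))
    simpa using this
  | succ K ih =>
    have hqK : 1 ≤ q ^ K := one_le_pow₀ hq
    have hw : 0 < q ^ K * u := by positivity
    have hwq : q ^ K * u ≤ q ^ (K + 1) * u := by gcongr; lia
    have hsplit : invLogSum u (q ^ (K + 1) * u) =
        invLogSum u (q ^ K * u) + invLogSum (q ^ K * u) (q ^ (K + 1) * u) :=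
      sum_primesBetween_add _ (le_mul_of_one_le_left hu.le hqK) hwq
    have hlast := hblock _ _ hw hwq
    have herror : C / (q ^ (K + 1) * u) ^ 2 ≤ C / u ^ 2 := by
      gcongr
      exact le_mul_of_one_le_left hu.le (one_le_pow₀ hq)
    have hexpand : (q ^ (K + 1) * u - q ^ K * u - C) / (q ^ (K + 1) * u) ^ 2 =
        (1 - q⁻¹ ^ (K + 1)) / (q * u) - (1 - q⁻¹ ^ K) / (q * u) -
          C / (q ^ (K + 1) * u) ^ 2 := by
      simp only [inv_pow]
      field_simp
      ring
    rw [hsplit]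
    push_cast
    rw [mul_add_one, add_div]
    linarith

lemma exists_le_invLogSum {ε : ℝ} (hε : 0 < ε) :
    ∃ B : ℝ, 1 ≤ B ∧ ∀ᶠ u : ℝ in atTop, (1 - ε) / u ≤ invLogSum u (B * u) := by
  obtain ⟨C, _, hgeometric⟩ := exists_geometric_le_invLogSum
  set q : ℝ := 1 + ε / 2 with hq
  have hq1 : 1 < q := by linarith
  obtain ⟨K, hK⟩ := exists_pow_lt_of_lt_one (show 0 < ε / 4 by positivity)
    (inv_lt_one_of_one_lt₀ hq1)
  refine ⟨q ^ K, one_le_pow₀ hq1.le, ?_⟩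
  filter_upwards [eventually_gt_atTop (0 : ℝ), eventually_ge_atTop (C * K / (ε / 4))]
    with u hu hCu
  have herror : C * K / u ^ 2 ≤ ε / 4 / u := by
    rw [div_le_iff₀ (by positivity)] at hCu
    rw [div_le_div_iff₀ (by positivity) hu]
    nlinarith
  have hmain : (1 - 3 * ε / 4) / u ≤ (1 - q⁻¹ ^ K) / (q * u) := by
    rw [← div_div]
    gcongr
    rw [le_div_iff₀ (by linarith)]
    calc (1 - 3 * ε / 4) * q ≤ 1 - ε / 4 := by rw [hq]; nlinarith [sq_nonneg ε]
      _ ≤ _ := by linarith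
  calc (1 - ε) / u = (1 - 3 * ε / 4) / u - ε / 4 / u := by ring
    _ ≤ (1 - q⁻¹ ^ K) / (q * u) - C * K / u ^ 2 := by gcongr
    _ ≤ _ := hgeometric q u hq1.le hu K

/-! ### Multiplicative resonators -/

lemma sum_le_sum_of_injOn {ι κ : Type*} {s : Finset ι} {t : Finset κ} {f : ι → ℝ} {g : κ → ℝ}
    (e : ι → κ) (hinj : InjOn e s) (hmaps : ∀ i ∈ s, e i ∈ t) (hle : ∀ i ∈ s, f i ≤ g (e i))
    (hg : ∀ k ∈ t, 0 ≤ g k) : ∑ i ∈ s, f i ≤ ∑ k ∈ t, g k := by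
  classical
  calc ∑ i ∈ s, f i ≤ ∑ i ∈ s, g (e i) := Finset.sum_le_sum hle
    _ = ∑ k ∈ s.image e, g k := (Finset.sum_image hinj).symm
    _ ≤ ∑ k ∈ t, g k := Finset.sum_le_sum_of_subset_of_nonneg
        (Finset.image_subset_iff.mpr hmaps) fun k hk _ ↦ hg k hk

lemma squarefree_prod_primes {A : Finset ℕ} (hA : ∀ p ∈ A, p.Prime) :
    Squarefree (∏ p ∈ A, p) :=
  Finset.squarefree_prod_of_pairwise_isCoprime
    (fun p hp q hq hpq ↦ Nat.coprime_iff_isRelPrime.mp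
      ((Nat.coprime_primes (hA p hp) (hA q hq)).mpr hpq))
    fun p hp ↦ (hA p hp).squarefree

section

open ArithmeticFunction ArithmeticFunction.Moebius

lemma resonatorForm_eq_sum_filter (r : ℕ → ℝ) (N : ℕ) :
    resonatorForm r N = ∑ x ∈ Finset.Icc 1 N ×ˢ Finset.Icc 1 N with x.2 * x.1 ≤ N,
      (μ x.1 : ℝ) / Real.sqrt x.1 * (r x.2 * r (x.2 * x.1)) := by
  rw [resonatorForm, Finset.sum_filter, Finset.sum_product]
  refine Finset.sum_congr rfl fun n hn ↦ Finset.sum_congr rfl fun h hh ↦ ?_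
  have hpos : 1 ≤ h * n := Nat.mul_pos (Finset.mem_Icc.mp hh).1 (Finset.mem_Icc.mp hn).1
  simp [hpos]

/-- The coefficients `μ(n) ∏_{p ∣ n} f(p)`, supported on products of primes in `P`. The values of
the resonator are taken from this family. -/
noncomputable def moebiusWeight (P : Finset ℕ) (f : ℕ → ℝ) (n : ℕ) : ℝ :=
  if n.primeFactors ⊆ P then (μ n : ℝ) * ∏ p ∈ n.primeFactors, f p else 0

variable {P : Finset ℕ} {f : ℕ → ℝ}

lemma moebiusWeight_one : moebiusWeight P f 1 = 1 := by simp [moebiusWeight]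

lemma abs_moebiusWeight_le_one (hf0 : ∀ p ∈ P, 0 ≤ f p) (hf1 : ∀ p ∈ P, f p ≤ 1) (n : ℕ) :
    |moebiusWeight P f n| ≤ 1 := by
  unfold moebiusWeight
  split_ifs with hn
  · have hprod : 0 ≤ ∏ p ∈ n.primeFactors, f p := Finset.prod_nonneg fun p hp ↦ hf0 p (hn hp)
    rw [abs_mul, abs_of_nonneg hprod]
    exact mul_le_one₀ (mod_cast abs_moebius_le_one) hprod
      (Finset.prod_le_one (fun p hp ↦ hf0 p (hn hp)) fun p hp ↦ hf1 p (hn hp))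
  · simp

lemma moebiusWeight_prod (hP : ∀ p ∈ P, p.Prime) {A : Finset ℕ} (hA : A ⊆ P) :
    moebiusWeight P f (∏ p ∈ A, p) = (μ (∏ p ∈ A, p) : ℝ) * ∏ p ∈ A, f p := by
  rw [moebiusWeight, Nat.primeFactors_prod fun p hp ↦ hP p (hA hp), if_pos hA]

lemma squarefree_and_subset_of_moebiusWeight_ne_zero {n : ℕ} (hn : moebiusWeight P f n ≠ 0) :
    Squarefree n ∧ n.primeFactors ⊆ P := by
  rw [moebiusWeight, ite_ne_right_iff] at hn
  exact ⟨moebius_ne_zero_iff_squarefree.mp (Int.cast_ne_zero.mp (left_ne_zero_of_mul hn.2)), hn.1⟩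

lemma sum_moebiusWeight_sq_le (N : ℕ) :
    ∑ n ∈ Finset.Icc 1 N, moebiusWeight P f n ^ 2 ≤ ∏ p ∈ P, (1 + f p ^ 2) := by
  have hfilter : ∑ n ∈ Finset.Icc 1 N with Squarefree n ∧ n.primeFactors ⊆ P,
      moebiusWeight P f n ^ 2 = ∑ n ∈ Finset.Icc 1 N, moebiusWeight P f n ^ 2 :=
    Finset.sum_filter_of_ne fun n _ hn ↦
      squarefree_and_subset_of_moebiusWeight_ne_zero (ne_zero_pow two_ne_zero hn)
  rw [← hfilter, Finset.prod_one_add]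
  refine sum_le_sum_of_injOn Nat.primeFactors (fun a ha b hb hab ↦ ?_)
    (fun n hn ↦ Finset.mem_powerset.mpr (Finset.mem_filter.mp hn).2.2) (fun n hn ↦ ?_)
    fun A _ ↦ Finset.prod_nonneg fun p _ ↦ sq_nonneg _
  · rw [← Nat.prod_primeFactors_of_squarefree (Finset.mem_filter.mp ha).2.1, hab,
      Nat.prod_primeFactors_of_squarefree (Finset.mem_filter.mp hb).2.1]
  · obtain ⟨-, hsq, hsub⟩ := Finset.mem_filter.mp hn
    have hmu : (μ n : ℝ) ^ 2 = 1 := mod_cast moebius_sq_eq_one_of_squarefree hsq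
    rw [moebiusWeight, if_pos hsub, mul_pow, hmu, one_mul, Finset.prod_pow]

lemma moebius_mul_moebiusWeight_nonneg (hf : ∀ p ∈ P, 0 ≤ f p) (n h : ℕ) :
    0 ≤ (μ n : ℝ) / Real.sqrt n * (moebiusWeight P f h * moebiusWeight P f (h * n)) := by
  by_cases hzero : moebiusWeight P f h * moebiusWeight P f (h * n) = 0
  · rw [hzero, mul_zero]
  have hsub := (squarefree_and_subset_of_moebiusWeight_ne_zero (left_ne_zero_of_mul hzero)).2
  obtain ⟨hsq, hsub'⟩ :=
    squarefree_and_subset_of_moebiusWeight_ne_zero (right_ne_zero_of_mul hzero)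
  have hprod : 0 ≤ ∏ p ∈ h.primeFactors, f p := Finset.prod_nonneg fun p hp ↦ hf p (hsub hp)
  have hprod' : 0 ≤ ∏ p ∈ (h * n).primeFactors, f p :=
    Finset.prod_nonneg fun p hp ↦ hf p (hsub' hp)
  rw [moebiusWeight, moebiusWeight, if_pos hsub, if_pos hsub',
    isMultiplicative_moebius.map_mul_of_coprime (Nat.coprime_of_squarefree_mul hsq)]
  calc (0 : ℝ) ≤ (μ n : ℝ) ^ 2 * (μ h : ℝ) ^ 2 / Real.sqrt n *
        ((∏ p ∈ h.primeFactors, f p) * ∏ p ∈ (h * n).primeFactors, f p) := by positivity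
    _ = _ := by push_cast; ring

lemma moebius_mul_moebiusWeight_prod (hP : ∀ p ∈ P, p.Prime) {A D : Finset ℕ} (hA : A ⊆ P)
    (hD : D ⊆ A) :
    (μ (∏ p ∈ A \ D, p) : ℝ) / Real.sqrt (∏ p ∈ A \ D, p : ℕ) *
        (moebiusWeight P f (∏ p ∈ D, p) * moebiusWeight P f (∏ p ∈ A, p)) =
      (∏ p ∈ D, f p ^ 2) * ∏ p ∈ A \ D, (f p / Real.sqrt p) := by
  have hprime : ∀ p ∈ A, p.Prime := fun p hp ↦ hP p (hA hp)
  have hmul : (∏ p ∈ A \ D, p) * ∏ p ∈ D, p = ∏ p ∈ A, p := Finset.prod_sdiff hD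
  have hcoprime : Nat.Coprime (∏ p ∈ A \ D, p) (∏ p ∈ D, p) :=
    Nat.coprime_of_squarefree_mul (hmul ▸ squarefree_prod_primes hprime)
  have hmu : (μ (∏ p ∈ A, p) : ℝ) = μ (∏ p ∈ A \ D, p) * μ (∏ p ∈ D, p) := by
    rw [← hmul, isMultiplicative_moebius.map_mul_of_coprime hcoprime, Int.cast_mul]
  have hmuD : (μ (∏ p ∈ D, p) : ℝ) ^ 2 = 1 := mod_cast
    moebius_sq_eq_one_of_squarefree (squarefree_prod_primes fun p hp ↦ hprime p (hD hp))
  have hmuAD : (μ (∏ p ∈ A \ D, p) : ℝ) ^ 2 = 1 := mod_cast moebius_sq_eq_one_of_squarefree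
    (squarefree_prod_primes fun p hp ↦ hprime p (Finset.sdiff_subset hp))
  rw [moebiusWeight_prod hP (hD.trans hA), moebiusWeight_prod hP hA, hmu, Nat.cast_prod,
    Real.sqrt_prod _ fun p _ ↦ p.cast_nonneg, Finset.prod_div_distrib,
    ← Finset.prod_sdiff (f := f) hD, Finset.prod_pow]
  linear_combination (∏ p ∈ D, f p) ^ 2 * (∏ p ∈ A \ D, f p) / (∏ p ∈ A \ D, Real.sqrt p) *
    ((μ (∏ p ∈ A \ D, p) : ℝ) ^ 2 * hmuD + hmuAD)

lemma eq_of_prod_primes_eq {A B : Finset ℕ} (hA : ∀ p ∈ A, p.Prime) (hB : ∀ p ∈ B, p.Prime)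
    (h : ∏ p ∈ A, p = ∏ p ∈ B, p) : A = B := by
  rw [← Nat.primeFactors_prod hA, h, Nat.primeFactors_prod hB]

/- Expanding the product over `A` chooses the subset `D` of the primes dividing `h`, the others
dividing `n`; all terms of the form not obtained in this way are nonnegative. -/
lemma sum_prod_le_resonatorForm (hP : ∀ p ∈ P, p.Prime) (hf : ∀ p ∈ P, 0 ≤ f p) (N : ℕ) :
    ∑ A ∈ P.powerset with ∏ p ∈ A, p ≤ N, ∏ p ∈ A, (f p ^ 2 + f p / Real.sqrt p) ≤
      resonatorForm (moebiusWeight P f) N := by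
  have hexpand : ∑ A ∈ P.powerset with ∏ p ∈ A, p ≤ N, ∏ p ∈ A, (f p ^ 2 + f p / Real.sqrt p) =
      ∑ x ∈ ({A ∈ P.powerset | ∏ p ∈ A, p ≤ N}).sigma Finset.powerset,
        (∏ p ∈ x.2, f p ^ 2) * ∏ p ∈ x.1 \ x.2, (f p / Real.sqrt p) := by
    rw [Finset.sum_sigma]
    exact Finset.sum_congr rfl fun A _ ↦ Finset.prod_add _ _ _
  have hmem {A D : Finset ℕ}
      (hx : ⟨A, D⟩ ∈ ({A ∈ P.powerset | ∏ p ∈ A, p ≤ N}).sigma Finset.powerset) :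
      A ⊆ P ∧ D ⊆ A ∧ ∏ p ∈ A, p ≤ N := by
    simp only [Finset.mem_sigma, Finset.mem_filter, Finset.mem_powerset] at hx
    exact ⟨hx.1.1, hx.2, hx.1.2⟩
  have hpos {A : Finset ℕ} (hA : A ⊆ P) : 0 < ∏ p ∈ A, p :=
    Finset.prod_pos fun p hp ↦ (hP p (hA hp)).pos
  have hmul {A D : Finset ℕ} (hD : D ⊆ A) : (∏ p ∈ D, p) * ∏ p ∈ A \ D, p = ∏ p ∈ A, p := by
    rw [mul_comm, Finset.prod_sdiff hD]
  rw [hexpand, resonatorForm_eq_sum_filter]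
  refine sum_le_sum_of_injOn (fun x ↦ (∏ p ∈ x.1 \ x.2, p, ∏ p ∈ x.2, p)) ?_ ?_ ?_
    fun x _ ↦ moebius_mul_moebiusWeight_nonneg hf _ _
  · rintro ⟨A, D⟩ hx ⟨A', D'⟩ hx' heq
    obtain ⟨hA, hD, -⟩ := hmem hx
    obtain ⟨hA', hD', -⟩ := hmem hx'
    obtain ⟨hdiff, hprod⟩ := Prod.mk.inj heq
    obtain rfl : D = D' := eq_of_prod_primes_eq (fun p hp ↦ hP p (hA (hD hp)))
      (fun p hp ↦ hP p (hA' (hD' hp))) hprod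
    have hsdiff : A \ D = A' \ D := eq_of_prod_primes_eq
      (fun p hp ↦ hP p (hA (Finset.sdiff_subset hp)))
      (fun p hp ↦ hP p (hA' (Finset.sdiff_subset hp))) hdiff
    rw [← Finset.sdiff_union_of_subset hD, hsdiff, Finset.sdiff_union_of_subset hD']
  · rintro ⟨A, D⟩ hx
    obtain ⟨hA, hD, hle⟩ := hmem hx
    have hposD := hpos (hD.trans hA)
    have hposAD := hpos (Finset.sdiff_subset.trans hA : A \ D ⊆ P)
    have hle' := (hmul hD).trans_le hle
    simp only [Finset.mem_filter, Finset.mem_product, Finset.mem_Icc]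
    exact ⟨⟨⟨hposAD, (Nat.le_mul_of_pos_left _ hposD).trans hle'⟩, hposD,
      (Nat.le_mul_of_pos_right _ hposAD).trans hle'⟩, hle'⟩
  · rintro ⟨A, D⟩ hx
    obtain ⟨hA, hD, -⟩ := hmem hx
    dsimp only
    rw [hmul hD, moebius_mul_moebiusWeight_prod hP hA hD]

end

/- Rankin's trick: the weight `exp (α (log ∏ p - log N))` is at least `1` where `∏ p > N`. -/
lemma prod_one_add_sub_le_sum_prod {P : Finset ℕ} {w : ℕ → ℝ} (hP : ∀ p ∈ P, p.Prime)
    (hw : ∀ p ∈ P, 0 ≤ w p) {N : ℕ} (hN : 1 ≤ N) {α : ℝ} (hα : 0 ≤ α) :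
    ∏ p ∈ P, (1 + w p) -
        Real.exp (-(α * Real.log N)) * ∏ p ∈ P, (1 + w p * Real.exp (α * Real.log p)) ≤
      ∑ A ∈ P.powerset with ∏ p ∈ A, p ≤ N, ∏ p ∈ A, w p := by
  have hnonneg {A : Finset ℕ} (hA : A ⊆ P) : 0 ≤ ∏ p ∈ A, w p :=
    Finset.prod_nonneg fun p hp ↦ hw p (hA hp)
  have hterm {A : Finset ℕ} : ∏ p ∈ A, (w p * Real.exp (α * Real.log p)) =
      (∏ p ∈ A, w p) * Real.exp (α * ∑ p ∈ A, Real.log p) := by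
    rw [Finset.prod_mul_distrib, ← Real.exp_sum, ← Finset.mul_sum]
  have htail : ∑ A ∈ P.powerset with ¬ ∏ p ∈ A, p ≤ N, ∏ p ∈ A, w p ≤
      Real.exp (-(α * Real.log N)) *
        ∑ A ∈ P.powerset, ∏ p ∈ A, (w p * Real.exp (α * Real.log p)) := by
    rw [Finset.mul_sum]
    refine (Finset.sum_le_sum fun A hA ↦ ?_).trans (Finset.sum_le_sum_of_subset_of_nonneg
      (Finset.filter_subset _ _) fun A hA _ ↦ ?_)
    · rw [Finset.mem_filter, Finset.mem_powerset, not_le] at hA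
      have hlog : Real.log N ≤ ∑ p ∈ A, Real.log p := by
        rw [← Real.log_prod fun p hp ↦ Nat.cast_ne_zero.mpr (hP p (hA.1 hp)).ne_zero,
          ← Nat.cast_prod]
        exact Real.log_le_log (Nat.cast_pos.mpr hN) (Nat.cast_le.mpr hA.2.le)
      rw [hterm, mul_left_comm, ← Real.exp_add]
      refine le_mul_of_one_le_right (hnonneg hA.1) (Real.one_le_exp ?_)
      nlinarith
    · rw [hterm]
      have := hnonneg (Finset.mem_powerset.mp hA)
      positivity
  rw [Finset.prod_one_add, Finset.prod_one_add,
    ← Finset.sum_filter_add_sum_filter_not P.powerset (fun A ↦ ∏ p ∈ A, p ≤ N)]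
  linarith

/-! ### The choice of the resonator -/

lemma exp_mul_one_add_le {ε s t : ℝ} (hε1 : ε ≤ 1) (hs : s ∈ Icc 0 ε) (ht : t ∈ Icc 0 ε) :
    Real.exp ((1 - 2 * ε) * t) * (1 + s) ≤ 1 + (s + t) := by
  obtain ⟨hs0, hs⟩ := hs
  obtain ⟨ht0, ht⟩ := ht
  have : 0 ≤ ε := hs0.trans hs
  set x := (1 - ε) * t
  have hx0 : 0 ≤ x := mul_nonneg (by linarith) ht0
  have hxε : x ≤ ε := by nlinarith
  have hexp : Real.exp (x - x ^ 2) ≤ 1 + x := by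
    rw [← Real.le_log_iff_exp_le (by linarith)]
    refine le_trans ?_ (Real.one_sub_inv_le_log_of_pos (by linarith))
    rw [show 1 - (1 + x)⁻¹ = x / (1 + x) by field_simp; ring, le_div_iff₀ (by linarith)]
    nlinarith [pow_nonneg hx0 3]
  have hexponent : (1 - 2 * ε) * t ≤ x - x ^ 2 := by
    have : x * (1 - ε) ≤ x * (1 - x) := by gcongr
    have : 0 ≤ ε ^ 2 * t := by positivity
    nlinarith
  calc Real.exp ((1 - 2 * ε) * t) * (1 + s) ≤ (1 + x) * (1 + s) := by
        gcongr
        exact (Real.exp_le_exp.mpr hexponent).trans hexp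
    _ = 1 + s + t * ((1 - ε) * (1 + s)) := by ring
    _ ≤ 1 + s + t * 1 := by gcongr; nlinarith
    _ = 1 + (s + t) := by ring

lemma exp_mul_prod_one_add_le {ι : Type*} {P : Finset ι} {ε : ℝ} (hε1 : ε ≤ 1) {s t : ι → ℝ}
    (hs : ∀ i ∈ P, s i ∈ Icc 0 ε) (ht : ∀ i ∈ P, t i ∈ Icc 0 ε) :
    Real.exp ((1 - 2 * ε) * ∑ i ∈ P, t i) * ∏ i ∈ P, (1 + s i) ≤ ∏ i ∈ P, (1 + (s i + t i)) := by
  rw [Finset.mul_sum, Real.exp_sum, ← Finset.prod_mul_distrib]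
  refine Finset.prod_le_prod (fun i hi ↦ ?_) fun i hi ↦ exp_mul_one_add_le hε1 (hs i hi) (ht i hi)
  have := (hs i hi).1
  positivity

lemma one_add_mul_exp_le {w x κ : ℝ} (hw : 0 ≤ w) (hx : 0 ≤ x) (hκ : Real.exp x ≤ κ) :
    1 + w * Real.exp x ≤ (1 + w) * Real.exp (w * (x * κ)) := by
  have hexp : Real.exp x ≤ 1 + x * κ := by
    have : Real.exp x * (1 - x) ≤ Real.exp x * Real.exp (-x) := by
      gcongr
      linarith [Real.add_one_le_exp (-x)]
    rw [← Real.exp_add, add_neg_cancel, Real.exp_zero] at this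
    linarith [mul_le_mul_of_nonneg_left hκ hx]
  have hκ0 : 0 ≤ x * κ := mul_nonneg hx ((Real.exp_pos x).le.trans hκ)
  calc 1 + w * Real.exp x ≤ 1 + w * (1 + x * κ) := by gcongr
    _ ≤ 1 + w * (1 + x * κ) + w * (w * (x * κ)) := le_add_of_nonneg_right (by positivity)
    _ = (1 + w) * (w * (x * κ) + 1) := by ring
    _ ≤ (1 + w) * Real.exp (w * (x * κ)) := by gcongr; exact Real.add_one_le_exp _

lemma prod_one_add_mul_exp_le {ι : Type*} {P : Finset ι} {w x : ι → ℝ} {κ : ℝ}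
    (hw : ∀ i ∈ P, 0 ≤ w i) (hx : ∀ i ∈ P, 0 ≤ x i) (hκ : ∀ i ∈ P, Real.exp (x i) ≤ κ) :
    ∏ i ∈ P, (1 + w i * Real.exp (x i)) ≤
      (∏ i ∈ P, (1 + w i)) * Real.exp ((∑ i ∈ P, w i * x i) * κ) := by
  rw [Finset.sum_mul, Real.exp_sum, ← Finset.prod_mul_distrib]
  refine Finset.prod_le_prod (fun i hi ↦ ?_) fun i hi ↦ ?_
  · have := hw i hi
    positivity
  · rw [mul_assoc]
    exact one_add_mul_exp_le (hw i hi) (hx i hi) (hκ i hi)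

lemma half_prod_one_add_le_sum_prod {P : Finset ℕ} {w : ℕ → ℝ} (hP : ∀ p ∈ P, p.Prime)
    (hw : ∀ p ∈ P, 0 ≤ w p) {N : ℕ} (hN : 1 ≤ N) {α κ : ℝ} (hα : 0 ≤ α)
    (hκ : ∀ p ∈ P, Real.exp (α * Real.log p) ≤ κ)
    (hsum : Real.log 2 + α * κ * ∑ p ∈ P, w p * Real.log p ≤ α * Real.log N) :
    1 / 2 * ∏ p ∈ P, (1 + w p) ≤ ∑ A ∈ P.powerset with ∏ p ∈ A, p ≤ N, ∏ p ∈ A, w p := by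
  have hrankin := prod_one_add_sub_le_sum_prod hP hw hN hα
  have hprod : 0 ≤ ∏ p ∈ P, (1 + w p) := Finset.prod_nonneg fun p hp ↦ by linarith [hw p hp]
  have hshift : (∑ p ∈ P, w p * (α * Real.log p)) * κ = α * κ * ∑ p ∈ P, w p * Real.log p := by
    rw [Finset.sum_mul, Finset.mul_sum]
    exact Finset.sum_congr rfl fun p _ ↦ by ring
  have htail : Real.exp (-(α * Real.log N)) * ∏ p ∈ P, (1 + w p * Real.exp (α * Real.log p)) ≤
      1 / 2 * ∏ p ∈ P, (1 + w p) := by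
    calc _ ≤ Real.exp (-(α * Real.log N)) * ((∏ p ∈ P, (1 + w p)) *
          Real.exp ((∑ p ∈ P, w p * (α * Real.log p)) * κ)) := by
          gcongr
          exact prod_one_add_mul_exp_le hw
            (fun p _ ↦ mul_nonneg hα (Real.log_natCast_nonneg p)) hκ
      _ = Real.exp (-(α * Real.log N) + α * κ * ∑ p ∈ P, w p * Real.log p) *
          ∏ p ∈ P, (1 + w p) := by
          rw [hshift, Real.exp_add]
          ring
      _ ≤ Real.exp (-Real.log 2) * ∏ p ∈ P, (1 + w p) := by gcongr; linarith
      _ = 1 / 2 * ∏ p ∈ P, (1 + w p) := by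
          rw [Real.exp_neg, Real.exp_log two_pos, one_div]
  linarith

lemma half_exp_mul_sum_sq_le_resonatorForm {P : Finset ℕ} {f : ℕ → ℝ} {ε : ℝ}
    (hP : ∀ p ∈ P, p.Prime) (hε1 : ε ≤ 1) (hf : ∀ p ∈ P, f p ∈ Icc 0 ε) {N : ℕ} (hN : 1 ≤ N)
    {α κ : ℝ} (hα : 0 ≤ α) (hκ : ∀ p ∈ P, Real.exp (α * Real.log p) ≤ κ)
    (hsum : Real.log 2 + α * κ * ∑ p ∈ P, (f p ^ 2 + f p / Real.sqrt p) * Real.log p ≤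
      α * Real.log N) :
    1 / 2 * Real.exp ((1 - 2 * ε) * ∑ p ∈ P, f p / Real.sqrt p) *
        ∑ n ∈ Finset.Icc 1 N, moebiusWeight P f n ^ 2 ≤
      resonatorForm (moebiusWeight P f) N := by
  have hf0 : ∀ p ∈ P, 0 ≤ f p := fun p hp ↦ (hf p hp).1
  have hsq : ∀ p ∈ P, f p ^ 2 ∈ Icc 0 ε := fun p hp ↦
    ⟨sq_nonneg _, (pow_le_of_le_one (hf0 p hp) ((hf p hp).2.trans hε1) two_ne_zero).trans
      (hf p hp).2⟩
  have hdiv : ∀ p ∈ P, f p / Real.sqrt p ∈ Icc 0 ε := fun p hp ↦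
    ⟨div_nonneg (hf0 p hp) (Real.sqrt_nonneg _), (div_le_self (hf0 p hp)
      (Real.one_le_sqrt.mpr (Nat.one_le_cast.mpr (hP p hp).one_le))).trans (hf p hp).2⟩
  calc _ ≤ 1 / 2 * Real.exp ((1 - 2 * ε) * ∑ p ∈ P, f p / Real.sqrt p) *
        ∏ p ∈ P, (1 + f p ^ 2) := by gcongr; exact sum_moebiusWeight_sq_le N
    _ ≤ 1 / 2 * ∏ p ∈ P, (1 + (f p ^ 2 + f p / Real.sqrt p)) := by
      rw [mul_assoc]
      gcongr
      exact exp_mul_prod_one_add_le hε1 hsq hdiv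
    _ ≤ _ := half_prod_one_add_le_sum_prod hP
      (fun p hp ↦ add_nonneg (hsq p hp).1 (hdiv p hp).1) hN hα hκ hsum
    _ ≤ _ := sum_prod_le_resonatorForm hP hf0 N

lemma sum_primesBetween_one_div_le {u v : ℝ} (hv : 0 ≤ v) :
    ∑ p ∈ primesBetween u v, 1 / (p : ℝ) ≤ 1 + v := by
  have hharmonic := harmonic_floor_le_one_add_log (Real.exp v) (Real.one_le_exp hv)
  rw [harmonic_eq_sum_Icc, Real.log_exp] at hharmonic
  push_cast at hharmonic
  refine le_trans ?_ hharmonic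
  simp only [one_div]
  refine Finset.sum_le_sum_of_subset_of_nonneg (fun p hp ↦ ?_) fun _ _ _ ↦ by positivity
  rw [primesBetween, Finset.mem_filter, Finset.mem_Ioc] at hp
  exact Finset.mem_Icc.mpr ⟨hp.2.one_le, hp.1.2⟩

/-- The weight `L / (√p log p)` that Soundararajan's resonator gives to the prime `p`. -/
noncomputable def resonatorWeight (L : ℝ) (p : ℕ) : ℝ := L / (Real.sqrt p * Real.log p)

lemma resonatorWeight_nonneg {L : ℝ} (hL : 0 ≤ L) (p : ℕ) : 0 ≤ resonatorWeight L p :=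
  div_nonneg hL (mul_nonneg (Real.sqrt_nonneg _) (Real.log_natCast_nonneg p))

lemma resonatorWeight_sq (L : ℝ) (p : ℕ) :
    resonatorWeight L p ^ 2 = L ^ 2 / (p * Real.log p ^ 2) := by
  rw [resonatorWeight, div_pow, mul_pow, Real.sq_sqrt p.cast_nonneg]

lemma resonatorWeight_div_sqrt (L : ℝ) (p : ℕ) :
    resonatorWeight L p / Real.sqrt p = L * (1 / (p * Real.log p)) := by
  rw [resonatorWeight, div_div, mul_right_comm, Real.mul_self_sqrt p.cast_nonneg, mul_one_div]

lemma sum_resonatorWeight_div_sqrt (L u v : ℝ) :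
    ∑ p ∈ primesBetween u v, resonatorWeight L p / Real.sqrt p = L * invLogSum u v := by
  simp only [resonatorWeight_div_sqrt, invLogSum, Finset.mul_sum]

lemma sum_resonatorWeight_mul_log {L u v : ℝ} (hu : 0 ≤ u) :
    ∑ p ∈ primesBetween u v,
        (resonatorWeight L p ^ 2 + resonatorWeight L p / Real.sqrt p) * Real.log p =
      L ^ 2 * invLogSum u v + L * ∑ p ∈ primesBetween u v, 1 / (p : ℝ) := by
  rw [invLogSum, Finset.mul_sum, Finset.mul_sum, ← Finset.sum_add_distrib]
  refine Finset.sum_congr rfl fun p hp ↦ ?_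
  obtain ⟨hprime, hlog, -⟩ := mem_primesBetween.mp hp
  have : (p : ℝ) ≠ 0 := Nat.cast_ne_zero.mpr hprime.ne_zero
  have : Real.log p ≠ 0 := (hu.trans_lt hlog).ne'
  rw [resonatorWeight_sq, resonatorWeight_div_sqrt]
  field_simp

lemma resonatorWeight_mem_Icc {ε u v L : ℝ} (hε : 0 ≤ ε) (hu : 0 ≤ u) (hεu : 1 ≤ ε ^ 2 * u)
    (hL0 : 0 ≤ L) (hL : L ^ 2 ≤ Real.exp u * u) {p : ℕ} (hp : p ∈ primesBetween u v) :
    resonatorWeight L p ∈ Icc 0 ε := by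
  obtain ⟨hprime, hlog, -⟩ := mem_primesBetween.mp hp
  have hp0 : (0 : ℝ) < p := Nat.cast_pos.mpr hprime.pos
  have hlog0 : 0 < Real.log p := hu.trans_lt hlog
  refine ⟨resonatorWeight_nonneg hL0 p,
    (pow_le_pow_iff_left₀ (resonatorWeight_nonneg hL0 p) hε two_ne_zero).mp ?_⟩
  rw [resonatorWeight_sq, div_le_iff₀ (by positivity)]
  calc L ^ 2 ≤ 1 * (Real.exp u * u) := by rwa [one_mul]
    _ ≤ ε ^ 2 * u * (Real.exp u * u) := by gcongr
    _ = ε ^ 2 * (Real.exp u * u ^ 2) := by ring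
    _ ≤ ε ^ 2 * (p * Real.log p ^ 2) := by
      gcongr
      exact ((Real.lt_log_iff_exp_lt hp0).mp hlog).le

lemma sum_resonatorWeight_mul_log_le {ε B u L : ℝ} (hB : 0 ≤ B) (hu : 0 ≤ u)
    (hL : L ^ 2 ≤ Real.exp u * u) (hLS : L ^ 2 * invLogSum u (B * u) = (1 - ε) * Real.exp u)
    (hsmall : Real.sqrt (Real.exp u * u) * (1 + B * u) ≤ ε ^ 2 / 2 * Real.exp u) :
    ∑ p ∈ primesBetween u (B * u),
        (resonatorWeight L p ^ 2 + resonatorWeight L p / Real.sqrt p) * Real.log p ≤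
      (1 - ε + ε ^ 2 / 2) * Real.exp u := by
  have : L * ∑ p ∈ primesBetween u (B * u), 1 / (p : ℝ) ≤
      Real.sqrt (Real.exp u * u) * (1 + B * u) := by
    gcongr
    · exact Real.le_sqrt_of_sq_le hL
    · exact sum_primesBetween_one_div_le (by positivity)
  rw [sum_resonatorWeight_mul_log hu, hLS]
  linarith

lemma exists_sq_mul_eq_and_mul_sqrt_le {δ ℓ u S : ℝ} (hδ : 0 < δ) (hℓ : 0 ≤ ℓ) (hu : 0 < u)
    (hS : δ / u ≤ S) :
    ∃ L : ℝ, 0 ≤ L ∧ L ^ 2 ≤ ℓ * u ∧ L ^ 2 * S = δ * ℓ ∧ δ * Real.sqrt (ℓ / u) ≤ L * S := by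
  have hS0 : 0 < S := (div_pos hδ hu).trans_le hS
  have hLS : Real.sqrt (δ * ℓ / S) ^ 2 * S = δ * ℓ := by
    rw [Real.sq_sqrt (by positivity), div_mul_cancel₀ _ hS0.ne']
  refine ⟨Real.sqrt (δ * ℓ / S), Real.sqrt_nonneg _, le_of_mul_le_mul_right ?_ hS0, hLS, ?_⟩
  · rw [hLS, mul_assoc, mul_comm]
    gcongr
    rwa [← div_le_iff₀' hu]
  · refine (pow_le_pow_iff_left₀ (by positivity) (by positivity) two_ne_zero).mp ?_
    calc (δ * Real.sqrt (ℓ / u)) ^ 2 = δ * ℓ * (δ / u) := by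
          rw [mul_pow, Real.sq_sqrt (by positivity)]
          ring
      _ ≤ δ * ℓ * S := by gcongr
      _ = Real.sqrt (δ * ℓ / S) ^ 2 * S * S := by rw [hLS]
      _ = (Real.sqrt (δ * ℓ / S) * S) ^ 2 := by ring

lemma exp_mul_sum_le_resonatorForm {ε B u : ℝ} {N : ℕ} (hε0 : 0 < ε) (hε : ε ≤ 1 / 6)
    (hB : 1 ≤ B) (hN : 1 ≤ N) (hu0 : 0 < u) (hu : Real.log N = Real.exp u)
    (hS : (1 - ε) / u ≤ invLogSum u (B * u)) (hεu : 1 ≤ ε ^ 2 * u)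
    (hsmall : Real.sqrt (Real.exp u * u) * (1 + B * u) ≤ ε ^ 2 / 2 * Real.exp u)
    (htail : Real.log 2 ≤ Real.log (1 + ε) / B / u * Real.exp u * (ε ^ 2 / 4))
    (hhalf : Real.log 2 ≤ 3 * ε * Real.sqrt (Real.exp u / u)) :
    ∃ r : ℕ → ℝ, (∀ n, |r n| ≤ 1) ∧ r 1 = 1 ∧
      Real.exp ((1 - 6 * ε) * Real.sqrt (Real.exp u / u)) * ∑ n ∈ Finset.Icc 1 N, r n ^ 2 ≤
        resonatorForm r N := by
  obtain ⟨L, hL0, hL, hLS, hmain⟩ := exists_sq_mul_eq_and_mul_sqrt_le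
    (show 0 < 1 - ε by linarith) (Real.exp_pos u).le hu0 hS
  have hmem : ∀ p ∈ primesBetween u (B * u), resonatorWeight L p ∈ Icc 0 ε := fun p hp ↦
    resonatorWeight_mem_Icc hε0.le hu0.le hεu hL0 hL hp
  have hlogε : 0 < Real.log (1 + ε) := Real.log_pos (by linarith)
  set α := Real.log (1 + ε) / B / u with hα
  refine ⟨moebiusWeight (primesBetween u (B * u)) (resonatorWeight L),
    abs_moebiusWeight_le_one (fun p hp ↦ (hmem p hp).1)
      fun p hp ↦ (hmem p hp).2.trans (by linarith),
    moebiusWeight_one, le_trans ?_ (half_exp_mul_sum_sq_le_resonatorForm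
      (fun p hp ↦ (mem_primesBetween.mp hp).1) (by linarith) hmem hN (α := α) (κ := 1 + ε)
      (by positivity) (fun p hp ↦ ?_) ?_)⟩
  · gcongr
    have htwo : (1 / 2 : ℝ) = Real.exp (-Real.log 2) := by
      rw [Real.exp_neg, Real.exp_log two_pos, one_div]
    rw [sum_resonatorWeight_div_sqrt, htwo, ← Real.exp_add, Real.exp_le_exp]
    have := mul_le_mul_of_nonneg_left hmain (show 0 ≤ 1 - 2 * ε by linarith)
    have : 0 ≤ ε ^ 2 * Real.sqrt (Real.exp u / u) := by positivity
    linarith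
  · rw [← Real.le_log_iff_exp_le (by linarith)]
    calc α * Real.log p ≤ α * (B * u) := by gcongr; exact (mem_primesBetween.mp hp).2.2
      _ = Real.log (1 + ε) := by rw [hα]; field_simp
  · have hweights := sum_resonatorWeight_mul_log_le (by linarith) hu0.le hL hLS hsmall
    have hcoeff : (1 + ε) * (1 - ε + ε ^ 2 / 2) ≤ 1 - ε ^ 2 / 4 := by nlinarith [sq_nonneg ε]
    rw [hu]
    calc _ ≤ α * Real.exp u * (ε ^ 2 / 4) +
          α * (1 + ε) * ((1 - ε + ε ^ 2 / 2) * Real.exp u) := by gcongr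
      _ = α * Real.exp u * (ε ^ 2 / 4 + (1 + ε) * (1 - ε + ε ^ 2 / 2)) := by ring
      _ ≤ α * Real.exp u * (ε ^ 2 / 4 + (1 - ε ^ 2 / 4)) := by gcongr
      _ = α * Real.exp u := by ring

lemma eventually_mul_log_pow_le (K : ℝ) (n : ℕ) :
    ∀ᶠ x : ℝ in atTop, K * Real.log x ^ n ≤ x := by
  have hlittle := (Real.isLittleO_pow_log_id_atTop (n := n)).def (c := (|K| + 1)⁻¹) (by positivity)
  filter_upwards [hlittle, eventually_ge_atTop 1] with x hx hx1
  have hlog := Real.log_nonneg hx1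
  rw [id, Real.norm_of_nonneg (by positivity), Real.norm_of_nonneg (by linarith),
    le_inv_mul_iff₀ (by positivity)] at hx
  refine le_trans ?_ hx
  gcongr
  linarith [le_abs_self K]

lemma sqrt_mul_mul_one_add_le {ε B u ℓ : ℝ} (hε : 0 < ε) (hB : 1 ≤ B) (hu : 1 ≤ u) (hℓ : 0 ≤ ℓ)
    (hgrowth : 16 * B ^ 2 / ε ^ 4 * u ^ 3 ≤ ℓ) :
    Real.sqrt (ℓ * u) * (1 + B * u) ≤ ε ^ 2 / 2 * ℓ := by
  have hBu : 1 + B * u ≤ 2 * B * u := by nlinarith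
  have hBu0 : 0 ≤ 1 + B * u := by positivity
  rw [div_mul_eq_mul_div, div_le_iff₀ (by positivity)] at hgrowth
  rw [← Real.sqrt_sq hBu0, ← Real.sqrt_mul (by positivity)]
  refine Real.sqrt_le_iff.mpr ⟨by positivity, ?_⟩
  calc ℓ * u * (1 + B * u) ^ 2 ≤ ℓ * u * (2 * B * u) ^ 2 := by gcongr
    _ = ℓ * (16 * B ^ 2 * u ^ 3) / 4 := by ring
    _ ≤ ℓ * (ℓ * ε ^ 4) / 4 := by gcongr
    _ = (ε ^ 2 / 2 * ℓ) ^ 2 := by ring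

lemma eventually_resonator_parameters {ε B : ℝ} (hε : 0 < ε) (hB : 1 ≤ B) :
    ∀ᶠ ℓ : ℝ in atTop, Real.sqrt (ℓ * Real.log ℓ) * (1 + B * Real.log ℓ) ≤ ε ^ 2 / 2 * ℓ ∧
      Real.log 2 ≤ Real.log (1 + ε) / B / Real.log ℓ * ℓ * (ε ^ 2 / 4) ∧
      Real.log 2 ≤ 3 * ε * Real.sqrt (ℓ / Real.log ℓ) := by
  have hlogε : 0 < Real.log (1 + ε) := Real.log_pos (by linarith)
  filter_upwards [Real.tendsto_log_atTop.eventually_ge_atTop 1, eventually_ge_atTop 0,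
    eventually_mul_log_pow_le (16 * B ^ 2 / ε ^ 4) 3,
    eventually_mul_log_pow_le (4 * B * Real.log 2 / (Real.log (1 + ε) * ε ^ 2)) 1,
    eventually_mul_log_pow_le ((Real.log 2 / (3 * ε)) ^ 2) 1] with ℓ hu hℓ hcube htail hhalf
  have hu0 : 0 < Real.log ℓ := by linarith
  rw [pow_one] at htail hhalf
  refine ⟨sqrt_mul_mul_one_add_le hε hB hu hℓ hcube, ?_, ?_⟩
  · rw [div_mul_eq_mul_div, div_le_iff₀ (by positivity)] at htail
    rw [div_div, div_mul_eq_mul_div, div_mul_eq_mul_div, le_div_iff₀ (by positivity)]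
    linarith
  · rw [← div_le_iff₀' (by positivity)]
    exact Real.le_sqrt_of_sq_le ((le_div_iff₀ hu0).mpr hhalf)

/-- The size `√(log y / log log y)` of the exponent in the extreme values of `ζ'`. -/
noncomputable def sqrtLogDivLogLog (y : ℝ) : ℝ :=
  Real.sqrt (Real.log y / Real.log (Real.log y))

lemma exists_resonator_le_resonatorForm {a : ℝ} (ha : a < 1) : ∀ᶠ N : ℕ in atTop, ∃ r : ℕ → ℝ,
    (∀ n, |r n| ≤ 1) ∧ r 1 = 1 ∧
    Real.exp (a * sqrtLogDivLogLog N) * ∑ n ∈ Finset.Icc 1 N, r n ^ 2 ≤ resonatorForm r N := by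
  obtain ⟨ε, hε0, hε⟩ := exists_between (show 0 < min ((1 - a) / 6) (1 / 6) by
    rw [lt_min_iff]; constructor <;> linarith)
  obtain ⟨hεa, hε6⟩ := lt_min_iff.mp hε
  obtain ⟨B, hB, hS⟩ := exists_le_invLogSum hε0
  have hlog : Tendsto (fun N : ℕ ↦ Real.log N) atTop atTop :=
    Real.tendsto_log_atTop.comp tendsto_natCast_atTop_atTop
  have hloglog : Tendsto (fun N : ℕ ↦ Real.log (Real.log N)) atTop atTop :=
    Real.tendsto_log_atTop.comp hlog
  filter_upwards [hloglog.eventually hS, hloglog.eventually_ge_atTop (1 / ε ^ 2),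
    hloglog.eventually_gt_atTop 0, hlog.eventually (eventually_resonator_parameters hε0 hB),
    eventually_ge_atTop 1, hlog.eventually_gt_atTop 0]
    with N hS hεu hu0 ⟨hsmall, htail, hhalf⟩ hN hℓ
  have hexp : Real.exp (Real.log (Real.log N)) = Real.log N := Real.exp_log hℓ
  rw [div_le_iff₀' (by positivity)] at hεu
  obtain ⟨r, hr, hr1, hform⟩ := exp_mul_sum_le_resonatorForm hε0 hε6.le hB hN hu0 hexp.symm hS hεu
    (by rwa [hexp]) (by rwa [hexp]) (by rwa [hexp])
  rw [hexp] at hform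
  refine ⟨r, hr, hr1, le_trans ?_ hform⟩
  rw [sqrtLogDivLogLog]
  gcongr
  linarith

/-! ### Small values of the derivative at the zeros -/

lemma mul_sqrt_div_log_le {c d x y : ℝ} (hc : 0 ≤ c) (hd : 0 ≤ d) (hx : 1 < x) (hxy : x ≤ y)
    (h : c ^ 2 * y ≤ d ^ 2 * x) :
    c * Real.sqrt (y / Real.log y) ≤ d * Real.sqrt (x / Real.log x) := by
  have : 0 < Real.log x := Real.log_pos hx
  rw [← Real.sqrt_sq hc, ← Real.sqrt_sq hd, ← Real.sqrt_mul (by positivity),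
    ← Real.sqrt_mul (by positivity), ← mul_div_assoc, ← mul_div_assoc]
  gcongr

lemma eventually_mul_pow_lt_exp_mul_sqrt {d : ℝ} (hd : 0 < d) (C : ℝ) (n : ℕ) :
    ∀ᶠ x : ℝ in atTop, C * x ^ n < Real.exp (d * Real.sqrt (x / Real.log x)) := by
  filter_upwards [eventually_mul_log_pow_le (((n + 1 : ℕ) / d) ^ 2) 3, eventually_gt_atTop 1,
    eventually_gt_atTop C] with x hlog hx hxC
  have hx0 : 0 < x := by linarith
  have hlog0 : 0 < Real.log x := Real.log_pos hx
  have hexponent : (n + 1 : ℕ) * Real.log x ≤ d * Real.sqrt (x / Real.log x) := by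
    rw [← div_le_iff₀' hd]
    refine Real.le_sqrt_of_sq_le ((le_div_iff₀ hlog0).mpr (le_trans (le_of_eq ?_) hlog))
    ring
  calc C * x ^ n < x * x ^ n := by gcongr
    _ = Real.exp ((n + 1 : ℕ) * Real.log x) := by
      rw [Real.exp_nat_mul, Real.exp_log hx0, pow_succ']
    _ ≤ _ := Real.exp_le_exp.mpr hexponent

lemma eventually_mul_exp_sqrt_lt {c a κ β : ℝ} (hc : 0 ≤ c) (hκ : 1 ≤ κ) (hβ : 0 ≤ β)
    (hca : c * Real.sqrt κ < a) (C : ℝ) (n : ℕ) :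
    ∀ᶠ x : ℝ in atTop,
      C * x ^ n * Real.exp (c * Real.sqrt ((κ * x + β) / Real.log (κ * x + β))) <
        Real.exp (a * Real.sqrt (x / Real.log x)) := by
  obtain ⟨d, hcd, hda⟩ := exists_between hca
  have hd : 0 ≤ d := le_trans (by positivity) hcd.le
  have hsq : 0 < d ^ 2 - c ^ 2 * κ := by
    rw [← Real.sq_sqrt (zero_le_one.trans hκ), ← mul_pow, sub_pos]
    gcongr
  filter_upwards [eventually_mul_pow_lt_exp_mul_sqrt (sub_pos.mpr hda) C n,
    eventually_gt_atTop 1, eventually_ge_atTop (c ^ 2 * β / (d ^ 2 - c ^ 2 * κ))]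
    with x hpow hx hβx
  rw [div_le_iff₀ hsq] at hβx
  have hexponent : c * Real.sqrt ((κ * x + β) / Real.log (κ * x + β)) ≤
      d * Real.sqrt (x / Real.log x) :=
    mul_sqrt_div_log_le hc hd hx (by nlinarith) (by linarith)
  calc _ < Real.exp ((a - d) * Real.sqrt (x / Real.log x)) *
        Real.exp (d * Real.sqrt (x / Real.log x)) :=
        mul_lt_mul hpow (Real.exp_le_exp.mpr hexponent) (Real.exp_pos _) (Real.exp_pos _).le
    _ = Real.exp (a * Real.sqrt (x / Real.log x)) := by
      rw [← Real.exp_add, ← add_mul, sub_add_cancel]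

/- The ratio `3 / 2` of `log X ^ 12` and `log X ^ 8` is the source of the constant `√(2 / 3)`. -/
lemma eventually_mul_exp_sqrtLogDivLogLog_lt {c a : ℝ} (hc : 0 ≤ c)
    (hca : c * Real.sqrt (3 / 2) < a) (C : ℝ) :
    ∀ᶠ X : ℕ in atTop,
      C * Real.log (X ^ 8 : ℕ) ^ 3 * Real.exp (c * sqrtLogDivLogLog (2 * X ^ 12)) <
        Real.exp (a * sqrtLogDivLogLog (X ^ 8 : ℕ)) := by
  have hlog : Tendsto (fun X : ℕ ↦ Real.log (X ^ 8 : ℕ)) atTop atTop :=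
    Real.tendsto_log_atTop.comp (tendsto_natCast_atTop_atTop.comp (tendsto_pow_atTop (by simp)))
  filter_upwards [hlog.eventually (eventually_mul_exp_sqrt_lt hc (by norm_num)
    (Real.log_nonneg one_le_two) hca C 3), eventually_gt_atTop 0] with X hX hX0
  have hlogT : Real.log (2 * (X : ℝ) ^ 12) = 3 / 2 * Real.log (X ^ 8 : ℕ) + Real.log 2 := by
    rw [Nat.cast_pow, Real.log_mul two_ne_zero (by positivity), Real.log_pow, Real.log_pow]
    push_cast
    ring
  rwa [sqrtLogDivLogLog, sqrtLogDivLogLog, hlogT]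

lemma sqrtLogDivLogLog_le_sqrtLogDivLogLog {y z : ℝ} (hy : Real.exp (Real.exp 1) ≤ y)
    (hyz : y ≤ z) : sqrtLogDivLogLog y ≤ sqrtLogDivLogLog z := by
  have hy0 : 0 < y := (Real.exp_pos _).trans_le hy
  have hlogy : Real.exp 1 ≤ Real.log y := (Real.le_log_iff_exp_le hy0).mpr hy
  have hlog : Real.log y ≤ Real.log z := Real.log_le_log hy0 hyz
  have hlogy0 : 0 < Real.log y := (Real.exp_pos _).trans_le hlogy
  have hloglogy : 1 ≤ Real.log (Real.log y) := (Real.le_log_iff_exp_le hlogy0).mpr hlogy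
  have hloglog : Real.log (Real.log y) ≤ Real.log (Real.log z) := Real.log_le_log hlogy0 hlog
  have hanti := Real.log_div_self_antitoneOn hlogy (hlogy.trans hlog) hlog
  dsimp only at hanti
  refine Real.sqrt_le_sqrt ?_
  rw [div_le_div_iff₀ (by linarith) (by linarith)]
  rw [div_le_div_iff₀ (by linarith) hlogy0] at hanti
  linarith

lemma sqrtLogDivLogLog_le_sqrt_div {γ : ℝ} (hγ : Real.exp (Real.exp 1) ≤ γ)
    (hγ' : 128 ^ 2 ≤ γ) : sqrtLogDivLogLog γ ≤ Real.sqrt γ / 8 := by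
  have hγ0 : 0 < γ := (Real.exp_pos _).trans_le hγ
  have hlog : Real.exp 1 ≤ Real.log γ := (Real.le_log_iff_exp_le hγ0).mpr hγ
  have hlog0 : 0 < Real.log γ := (Real.exp_pos _).trans_le hlog
  have hsqrt : 128 ≤ Real.sqrt γ := Real.le_sqrt_of_sq_le hγ'
  have hlog_le : Real.log γ ≤ (Real.sqrt γ / 8) ^ 2 := by
    have hhalf : Real.log γ = 2 * Real.log (Real.sqrt γ) := by
      rw [Real.log_sqrt hγ0.le]
      ring
    nlinarith [Real.log_le_sub_one_of_pos (show 0 < Real.sqrt γ by linarith)]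
  exact Real.sqrt_le_iff.mpr ⟨by positivity,
    (div_le_self hlog0.le ((Real.le_log_iff_exp_le hlog0).mpr hlog)).trans hlog_le⟩

lemma sqrt_div_le_sq_sub_div {X γ : ℝ} (hX : 0 < X) (hγ : 2 * X ^ 12 ≤ γ) :
    Real.sqrt γ / 8 ≤ (γ - X ^ 12) ^ 2 / (2 * (X ^ 9) ^ 2) := by
  have hX12 : 0 < X ^ 12 := by positivity
  have hsqrt : X ^ 6 ≤ Real.sqrt γ := Real.le_sqrt_of_sq_le (by linarith)
  rw [le_div_iff₀ (by positivity)]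
  calc Real.sqrt γ / 8 * (2 * (X ^ 9) ^ 2) = Real.sqrt γ * (X ^ 6) ^ 3 / 4 := by ring
    _ ≤ Real.sqrt γ * Real.sqrt γ ^ 3 / 4 := by gcongr
    _ = (Real.sqrt γ ^ 2 / 2) ^ 2 := by ring
    _ = (γ / 2) ^ 2 := by rw [Real.sq_sqrt (by linarith)]
    _ ≤ (γ - X ^ 12) ^ 2 := by
      gcongr
      · linarith
      · linarith

/- For `γ > 2 X ^ 12` half of the Gaussian absorbs the exponential. -/
lemma exp_gaussian_mul_exp_sqrtLogDivLogLog_le {c X γ : ℝ} (hc0 : 0 ≤ c) (hc1 : c ≤ 1)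
    (hX : 128 ≤ X) (hγ : Real.exp (Real.exp 1) ≤ γ) :
    Real.exp (-(γ - X ^ 12) ^ 2 / (X ^ 9) ^ 2) * Real.exp (c * sqrtLogDivLogLog γ) ≤
      Real.exp (c * sqrtLogDivLogLog (2 * X ^ 12)) *
        Real.exp (-(γ - X ^ 12) ^ 2 / (2 * (X ^ 9) ^ 2)) := by
  have hX0 : 0 < X := by linarith
  have hdouble : -(γ - X ^ 12) ^ 2 / (X ^ 9) ^ 2 =
      2 * -((γ - X ^ 12) ^ 2 / (2 * (X ^ 9) ^ 2)) := by
    field_simp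
  rw [neg_div (2 * (X ^ 9) ^ 2), hdouble, ← Real.exp_add, ← Real.exp_add, Real.exp_le_exp]
  rcases le_total γ (2 * X ^ 12) with hle | hge
  · have hmono := mul_le_mul_of_nonneg_left (sqrtLogDivLogLog_le_sqrtLogDivLogLog hγ hle) hc0
    have : 0 ≤ (γ - X ^ 12) ^ 2 / (2 * (X ^ 9) ^ 2) := by positivity
    linarith
  · have hγ' : 128 ^ 2 ≤ γ := by
      calc (128 : ℝ) ^ 2 ≤ X ^ 2 := by gcongr
        _ ≤ X ^ 12 := pow_le_pow_right₀ (by linarith) (by norm_num)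
        _ ≤ γ := by linarith [pow_pos hX0 12]
    have hfar : c * sqrtLogDivLogLog γ ≤ (γ - X ^ 12) ^ 2 / (2 * (X ^ 9) ^ 2) :=
      (mul_le_of_le_one_left (Real.sqrt_nonneg _) hc1).trans
        ((sqrtLogDivLogLog_le_sqrt_div hγ hγ').trans (sqrt_div_le_sq_sub_div hX0 hge))
    have : 0 ≤ c * sqrtLogDivLogLog (2 * X ^ 12) := mul_nonneg hc0 (Real.sqrt_nonneg _)
    linarith

lemma four_le_exp_exp_one : 4 ≤ Real.exp (Real.exp 1) := by
  have : 2 ≤ Real.exp 1 := by linarith [Real.add_one_le_exp 1]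
  nlinarith [Real.quadratic_le_exp_of_nonneg (Real.exp_pos 1).le]

lemma eventually_gaussian_sieve_parameters : ∀ᶠ X : ℕ in atTop,
    ((X ^ 8 : ℕ) : ℝ) * Real.exp (-((X : ℝ) ^ 9 / (X ^ 8 : ℕ)) ^ 2 / 4) ≤ 1 ∧
      Real.log ((X : ℝ) ^ 24 + 1 + 1) * (2 + Real.log (X ^ 8 : ℕ) ^ 2) ≤
        8 * Real.log (X ^ 8 : ℕ) ^ 3 := by
  filter_upwards [eventually_mul_pow_mul_exp_le (A := 1) (B := 0) zero_le_one 8,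
    eventually_ge_atTop 3] with X hexp hX
  have hX3 : (3 : ℝ) ≤ X := Nat.ofNat_le_cast.mpr hX
  have hX0 : (0 : ℝ) < X := by linarith
  have hlogX : 1 ≤ Real.log X :=
    (Real.le_log_iff_exp_le hX0).mpr (Real.exp_one_lt_three.le.trans hX3)
  have hlogN : Real.log (X ^ 8 : ℕ) = 8 * Real.log X := by
    rw [Nat.cast_pow, Real.log_pow, Nat.cast_ofNat]
  have hlogY : Real.log ((X : ℝ) ^ 24 + 1 + 1) ≤ 4 * Real.log (X ^ 8 : ℕ) := by
    have hpow : (X : ℝ) ^ 24 + 1 + 1 ≤ X ^ 25 := by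
      have : (1 : ℝ) ≤ X ^ 24 := one_le_pow₀ (by linarith)
      rw [pow_succ _ 24]
      nlinarith
    refine (Real.log_le_log (by positivity) hpow).trans ?_
    rw [Real.log_pow, hlogN]
    push_cast
    linarith
  constructor
  · rw [one_mul, zero_div, add_zero] at hexp
    rw [Nat.cast_pow, show (X : ℝ) ^ 9 / X ^ 8 = X by field_simp]
    refine le_trans ?_ hexp
    gcongr ?_ * Real.exp ?_
    linarith [sq_nonneg (X : ℝ)]
  · calc _ ≤ 4 * Real.log (X ^ 8 : ℕ) * (Real.log (X ^ 8 : ℕ) ^ 2 + Real.log (X ^ 8 : ℕ) ^ 2) := by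
          gcongr
          rw [hlogN]
          nlinarith
      _ = 8 * Real.log (X ^ 8 : ℕ) ^ 3 := by ring

lemma exists_sum_gaussian_mul_sq_norm_resonator_pow_le : ∃ C : ℝ, 0 ≤ C ∧
    ∀ᶠ X : ℕ in atTop, ∀ (r : ℕ → ℝ) (Z : Finset ℂ),
      (∀ ρ ∈ Z, riemannZeta ρ = 0 ∧ ρ.re = 1 / 2 ∧ 4 ≤ ρ.im ∧ ρ.im ≤ (X : ℝ) ^ 24 + 1) →
      ∑ ρ ∈ Z, Real.exp (-(ρ.im - (X : ℝ) ^ 12) ^ 2 / (2 * ((X : ℝ) ^ 9) ^ 2)) *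
          ‖resonator r (X ^ 8) ρ.im‖ ^ 2 ≤
        C * Real.log (X ^ 8 : ℕ) ^ 3 * (X : ℝ) ^ 9 * ∑ n ∈ Finset.Icc 1 (X ^ 8), r n ^ 2 := by
  obtain ⟨C, hC1, hsieve⟩ := exists_sum_gaussian_mul_sq_norm_resonator_le
  refine ⟨8 * C, by linarith, ?_⟩
  filter_upwards [eventually_gaussian_sieve_parameters, eventually_ge_atTop 4]
    with X ⟨htail, hlog⟩ hX r Z hZ
  have hX4 : (4 : ℝ) ≤ X := Nat.ofNat_le_cast.mpr hX
  have hY : 4 ≤ (X : ℝ) ^ 24 + 1 := by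
    linarith [le_self_pow₀ (show 1 ≤ (X : ℝ) by linarith) (show 24 ≠ 0 by norm_num)]
  have : 0 ≤ ∑ n ∈ Finset.Icc 1 (X ^ 8), r n ^ 2 := Finset.sum_nonneg fun n _ ↦ sq_nonneg (r n)
  calc _ ≤ _ := hsieve r (X ^ 8) _ _ _ Z (one_le_pow₀ (by linarith)) htail hY hZ
    _ = C * (Real.log ((X : ℝ) ^ 24 + 1 + 1) * (2 + Real.log (X ^ 8 : ℕ) ^ 2)) * (X : ℝ) ^ 9 *
        ∑ n ∈ Finset.Icc 1 (X ^ 8), r n ^ 2 := by ring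
    _ ≤ C * (8 * Real.log (X ^ 8 : ℕ) ^ 3) * (X : ℝ) ^ 9 *
        ∑ n ∈ Finset.Icc 1 (X ^ 8), r n ^ 2 := by gcongr
    _ = _ := by ring

lemma sum_gaussian_div_norm_deriv_le {c X : ℝ} (hc0 : 0 ≤ c) (hc1 : c ≤ 1) (hX : 128 ≤ X)
    {Z : Finset ℂ} (hZ : ∀ ρ ∈ Z, Real.exp (Real.exp 1) ≤ ρ.im)
    (hlarge : ∀ ρ ∈ Z, Real.exp (-c * sqrtLogDivLogLog ρ.im) < ‖deriv riemannZeta ρ‖)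
    (R : ℂ → ℝ) (hR : ∀ ρ ∈ Z, 0 ≤ R ρ) :
    ∑ ρ ∈ Z, Real.exp (-(ρ.im - X ^ 12) ^ 2 / (X ^ 9) ^ 2) * R ρ / ‖deriv riemannZeta ρ‖ ≤
      Real.exp (c * sqrtLogDivLogLog (2 * X ^ 12)) *
        ∑ ρ ∈ Z, Real.exp (-(ρ.im - X ^ 12) ^ 2 / (2 * (X ^ 9) ^ 2)) * R ρ := by
  rw [Finset.mul_sum]
  refine Finset.sum_le_sum fun ρ hρ ↦ ?_
  have hRρ := hR ρ hρ
  have hinv : ‖deriv riemannZeta ρ‖⁻¹ ≤ Real.exp (c * sqrtLogDivLogLog ρ.im) := by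
    refine inv_le_of_inv_le₀ (Real.exp_pos _) ?_
    rw [← Real.exp_neg, ← neg_mul]
    exact (hlarge ρ hρ).le
  calc _ = Real.exp (-(ρ.im - X ^ 12) ^ 2 / (X ^ 9) ^ 2) * ‖deriv riemannZeta ρ‖⁻¹ * R ρ := by ring
    _ ≤ Real.exp (-(ρ.im - X ^ 12) ^ 2 / (X ^ 9) ^ 2) *
        Real.exp (c * sqrtLogDivLogLog ρ.im) * R ρ := by gcongr
    _ ≤ Real.exp (c * sqrtLogDivLogLog (2 * X ^ 12)) *
        Real.exp (-(ρ.im - X ^ 12) ^ 2 / (2 * (X ^ 9) ^ 2)) * R ρ :=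
      mul_le_mul_of_nonneg_right
        (exp_gaussian_mul_exp_sqrtLogDivLogLog_le hc0 hc1 hX (hZ ρ hρ)) hRρ
    _ = _ := by ring

section

variable {c T₀ : ℝ}

lemma exists_resonatorForm_le_of_forall_lt_norm_deriv (hc0 : 0 ≤ c) (hc1 : c ≤ 1)
    (hT₀ : Real.exp (Real.exp 1) ≤ T₀)
    (hline : ∀ ρ : ℂ, riemannZeta ρ = 0 → T₀ ≤ ρ.im → ρ.re = 1 / 2)
    (hlarge : ∀ ρ : ℂ, riemannZeta ρ = 0 → T₀ ≤ ρ.im →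
      Real.exp (-c * sqrtLogDivLogLog ρ.im) < ‖deriv riemannZeta ρ‖) :
    ∃ C : ℝ, ∀ᶠ X : ℕ in atTop, ∀ r : ℕ → ℝ, (∀ n, |r n| ≤ 1) →
      resonatorForm r (X ^ 8) ≤ 1 + C * Real.log (X ^ 8 : ℕ) ^ 3 *
        Real.exp (c * sqrtLogDivLogLog (2 * X ^ 12)) * ∑ n ∈ Finset.Icc 1 (X ^ 8), r n ^ 2 := by
  have hsimple : ∀ ρ : ℂ, riemannZeta ρ = 0 → T₀ ≤ ρ.im → deriv riemannZeta ρ ≠ 0 :=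
    fun ρ hρ him ↦ norm_pos_iff.mp ((Real.exp_pos _).trans (hlarge ρ hρ him))
  obtain ⟨C, hC, hsieve⟩ := exists_sum_gaussian_mul_sq_norm_resonator_pow_le
  refine ⟨2 * Real.pi * C, ?_⟩
  filter_upwards [exists_zeros_resonatorForm_le hline hsimple, hsieve, eventually_ge_atTop 128]
    with X hform hsieve hX r hr
  have hX128 : (128 : ℝ) ≤ X := Nat.ofNat_le_cast.mpr hX
  obtain ⟨Z, hZ, hform⟩ := hform r hr
  have hresidues := sum_gaussian_div_norm_deriv_le hc0 hc1 hX128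
    (fun ρ hρ ↦ hT₀.trans (hZ ρ hρ).2.2.1)
    (fun ρ hρ ↦ hlarge ρ (hZ ρ hρ).1 (hZ ρ hρ).2.2.1)
    (fun ρ ↦ ‖resonator r (X ^ 8) ρ.im‖ ^ 2) fun ρ _ ↦ sq_nonneg _
  have hsum := hsieve r Z fun ρ hρ ↦ ⟨(hZ ρ hρ).1, (hZ ρ hρ).2.1,
    four_le_exp_exp_one.trans (hT₀.trans (hZ ρ hρ).2.2.1), (hZ ρ hρ).2.2.2⟩
  set F := Real.exp (c * sqrtLogDivLogLog (2 * X ^ 12))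
  set S := ∑ n ∈ Finset.Icc 1 (X ^ 8), r n ^ 2
  have : 0 ≤ S := Finset.sum_nonneg fun n _ ↦ sq_nonneg (r n)
  have : 0 ≤ Real.log (X ^ 8 : ℕ) := Real.log_natCast_nonneg _
  have hbound : Real.sqrt Real.pi * (X : ℝ) ^ 9 * resonatorForm r (X ^ 8) ≤
      (X : ℝ) ^ 9 * (1 + 2 * Real.pi * C * Real.log (X ^ 8 : ℕ) ^ 3 * F * S) := by
    have hscaled := mul_le_mul_of_nonneg_left
      (hresidues.trans (mul_le_mul_of_nonneg_left hsum (Real.exp_pos _).le)) Real.two_pi_pos.le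
    linarith
  rcases le_total (resonatorForm r (X ^ 8)) 0 with hneg | hpos
  · exact hneg.trans (by positivity)
  · refine le_of_mul_le_mul_left (le_trans ?_ hbound) (show 0 < (X : ℝ) ^ 9 by positivity)
    have : 1 ≤ Real.sqrt Real.pi := Real.one_le_sqrt.mpr (by linarith [Real.pi_gt_three])
    gcongr
    exact le_mul_of_one_le_left (by positivity) this

lemma not_forall_exp_lt_norm_deriv (hc0 : 0 ≤ c) (hc : c < Real.sqrt (2 / 3))
    (hT₀ : Real.exp (Real.exp 1) ≤ T₀)
    (hline : ∀ ρ : ℂ, riemannZeta ρ = 0 → T₀ ≤ ρ.im → ρ.re = 1 / 2) :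
    ¬ ∀ ρ : ℂ, riemannZeta ρ = 0 → T₀ ≤ ρ.im →
      Real.exp (-c * sqrtLogDivLogLog ρ.im) < ‖deriv riemannZeta ρ‖ := by
  intro hlarge
  have hc1 : c ≤ 1 := hc.le.trans (Real.sqrt_le_one.mpr (by norm_num))
  have hca : c * Real.sqrt (3 / 2) < 1 := by
    calc c * Real.sqrt (3 / 2) < Real.sqrt (2 / 3) * Real.sqrt (3 / 2) := by gcongr
      _ = 1 := by rw [← Real.sqrt_mul (by norm_num)]; norm_num
  obtain ⟨a, hca, ha⟩ := exists_between hca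
  obtain ⟨C, hupper⟩ :=
    exists_resonatorForm_le_of_forall_lt_norm_deriv hc0 hc1 hT₀ hline hlarge
  obtain ⟨X, hupper, ⟨r, hr, hr1, hlower⟩, hcompare, hX⟩ := (hupper.and
    (((tendsto_pow_atTop (by simp : 8 ≠ 0)).eventually (exists_resonator_le_resonatorForm ha)).and
      ((eventually_mul_exp_sqrtLogDivLogLog_lt hc0 hca (1 + C)).and
        (eventually_ge_atTop 3)))).exists
  have hlog : 1 ≤ Real.log (X ^ 8 : ℕ) := by
    refine (Real.le_log_iff_exp_le (by positivity)).mpr (Real.exp_one_lt_three.le.trans ?_)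
    exact_mod_cast hX.trans (Nat.le_self_pow (by simp) X)
  have hS : 1 ≤ ∑ n ∈ Finset.Icc 1 (X ^ 8), r n ^ 2 := by
    refine le_trans (by rw [hr1, one_pow]) (Finset.single_le_sum (fun n _ ↦ sq_nonneg (r n))
      (Finset.mem_Icc.mpr ⟨le_rfl, Nat.one_le_pow _ _ (by lia)⟩))
  have hF : 1 ≤ Real.exp (c * sqrtLogDivLogLog (2 * X ^ 12)) :=
    Real.one_le_exp (mul_nonneg hc0 (Real.sqrt_nonneg _))
  specialize hupper r hr
  generalize Real.log (X ^ 8 : ℕ) = ℓ at *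
  generalize Real.exp (c * sqrtLogDivLogLog (2 * X ^ 12)) = F at *
  generalize ∑ n ∈ Finset.Icc 1 (X ^ 8), r n ^ 2 = S at *
  have hone : 1 ≤ ℓ ^ 3 * F * S :=
    one_le_mul_of_one_le_of_one_le (one_le_mul_of_one_le_of_one_le (one_le_pow₀ hlog) hF) hS
  have hstrict := mul_lt_mul_of_pos_right hcompare (zero_lt_one.trans_le hS)
  linarith

end

lemma re_eq_half_of_riemannHypothesis (hRH : RiemannHypothesis) {ρ : ℂ} (hρ : riemannZeta ρ = 0)
    (him : 0 < ρ.im) : ρ.re = 1 / 2 := by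
  refine hRH ρ hρ ?_ ?_
  · rintro ⟨n, rfl⟩
    simp at him
  · rintro rfl
    simp at him

theorem theorem3_general {T₀ : ℝ} (hline : ∀ ρ : ℂ, riemannZeta ρ = 0 → T₀ ≤ ρ.im → ρ.re = 1 / 2)
    {c : ℝ} (hc : c < Real.sqrt (2 / 3)) :
    {γ : ℝ | ∃ ρ : ℂ, IsNontrivialZetaZero ρ ∧ ρ.im = γ ∧
      ‖deriv riemannZeta ρ‖ ≤
        Real.exp (-c * Real.sqrt (Real.log |γ| / Real.log (Real.log |γ|)))}.Infinite := by
  intro hfin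
  obtain ⟨M, hM⟩ := hfin.bddAbove
  obtain ⟨T, hT⟩ := exists_gt (max (max T₀ (Real.exp (Real.exp 1))) M)
  simp only [max_lt_iff] at hT
  obtain ⟨⟨hT₀, hTexp⟩, hTM⟩ := hT
  have hhalf : 1 / 2 < Real.sqrt (2 / 3) := Real.lt_sqrt_of_sq_lt (by norm_num)
  refine not_forall_exp_lt_norm_deriv (c := max c (1 / 2)) (le_max_of_le_right (by norm_num))
    (max_lt hc hhalf) hTexp.le (fun ρ hρ him ↦ hline ρ hρ (hT₀.le.trans him)) fun ρ hρ him ↦ ?_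
  by_contra hsmall
  have hre := hline ρ hρ (hT₀.le.trans him)
  refine (hTM.trans_le him).not_ge (hM ⟨ρ, ⟨hρ, ?_, ?_⟩, rfl, (not_lt.mp hsmall).trans ?_⟩)
  · norm_num [hre]
  · norm_num [hre]
  · rw [abs_of_pos ((Real.exp_pos _).trans (hTexp.trans_le him)), sqrtLogDivLogLog]
    gcongr
    exact le_max_left _ _

theorem theorem3 (hRH : RiemannHypothesis) (c : ℝ) (hc : c < Real.sqrt (2 / 3)) :
    ∃ C : ℝ, 0 < C ∧
      {γ : ℝ | ∃ ρ : ℂ, IsNontrivialZetaZero ρ ∧ ρ.im = γ ∧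
        ‖deriv riemannZeta ρ‖ ≤
          C * Real.exp (-c * Real.sqrt (Real.log |γ| / Real.log (Real.log |γ|)))}.Infinite :=
  ⟨1, one_pos, by
    simpa only [one_mul] using theorem3_general (T₀ := 1)
      (fun _ hρ him ↦ re_eq_half_of_riemannHypothesis hRH hρ (one_pos.trans_le him)) hc⟩
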